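/- **Setting.** Let $X$ be a random design matrix with $n$ i.i.d. centered rows in $\mathbb R^p$ (or in $\ell^2$, when $p=\infty$), whose covariance is $\Sigma=\operatorname{diag}(\lambda_1,\lambda_2,\dots)$ with $\lambda_1\ge\lambda_2\ge\dots>0$. Let the rows of $X\Sigma^{-1/2}$ have sub-gaussian norm at most $\sigma_x$, where $\|Z\|_{\psi_2}=\inf\{t>0:\mathbb E\,e^{Z^2/t^2}\le 2\}$ for a random variable and $\|Z\|_{\psi_2}=\sup_{s\ne0}\|\langle s,Z\rangle/\|s\|\|_{\psi_2}$ for a random vector (in infinite dimension $s$ ranges over finitely supported vectors). Let $\varepsilon\in\mathbb R^n$ be a noise vector, independent of $X$, whose components are independent, centered, and have sub-gaussian norm at most $\sigma_\varepsilon$. Let $\theta^*\in\mathbb R^p$ (or $\ell^2$) be fixed. For $\lambda\in\mathbb R$ such that $\lambda I_n+XX^\top$ is invertible, the bias and variance terms of the ridge estimator $X^\top(\lambda I_n+XX^\top)^{-1}(X\theta^*+\varepsilon)$ are $$B=\|(I-X^\top(\lambda I_n+XX^\top)^{-1}X)\theta^*\|_\Sigma^2,\qquad V=\|X^\top(\lambda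 I_n+XX^\top)^{-1}\varepsilon\|_\Sigma^2,\qquad \|v\|_\Sigma^2=v^\top\Sigma v .$$ **Statement.** For every $\sigma_x>0$ there is a constant $c_x>0$, depending only on $\sigma_x$, such that the following holds. 1. For every $a>0$ there is a constant $C$, depending only on $\sigma_x$ and $a$, such that, if $\lambda_i=e^{-\gamma i}$ for $1\le i<\infty$ with $\gamma\ge a/n$, then for every integer $0\le k<n/c_x$ and every $t\in(c_x,n/c_x)$, for $\lambda=ne^{-\gamma(k+1)}$, with probability at least $1-26e^{-t/c_x}$ the matrix $\lambda I_n+XX^\top$ is invertible and $$B\le C\Big(\sum_{i>k}|\theta_i^*|^2e^{-\gamma i}+\sum_{i=1}^k|\theta_i^*|^2e^{-\gamma(2(k+1)-i)}\Big),\qquad V\le C\sigma_\varepsilon^2t\Big(\frac kn+\frac1{n(1-e^{-2\gamma})}\Big).$$ 2. There is a constant $C$, depending only on $\sigma_x$, such that the following holds. Suppose that the components of each data vector (row of $X$) are independent, that $0\le k<n/c_x$ and $c_xn<p<\infty$, and that $\lambda_i=\lambda_1$ for $i\le k$ and $\lambda_i=\lambda_{k+1}$ for $k<i\le p$, with $\lambda_1\ge\lambda_{k+1}>0$.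 Let $t\in(c_x,n/c_x)$. (a) For $\lambda=0$, with probability at least $1-22e^{-t/c_x}$ the matrix $\lambda I_n+XX^\top$ is invertible and $$B\le C\Big(\lambda_{k+1}\sum_{i>k}|\theta^*_i|^2+\frac{\lambda_{k+1}^2p^2}{\lambda_1n^2}\sum_{i\le k}|\theta^*_i|^2\Big),\qquad V\le C\sigma_\varepsilon^2t\Big(\frac kn+\frac np\Big).$$ (b) For every $\xi>c_x$ and $\lambda=-\lambda_{k+1}p+\xi\lambda_{k+1}\sqrt{np}$ (which is negative when $\xi<\sqrt{p/n}$), with probability at least $1-20e^{-t/c_x}$ the matrix $\lambda I_n+XX^\top$ is invertible and $$B\le C\Big(\lambda_{k+1}\sum_{i>k}|\theta^*_i|^2+\frac{\xi^2\lambda_{k+1}^2p}{\lambda_1n}\sum_{i\le k}|\theta^*_i|^2\Big),\qquad V\le C\sigma_\varepsilon^2t\Big(\frac kn+\frac1{\xi^2}\Big).$$ -/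

import Mathlib

open MeasureTheory ProbabilityTheory
open scoped ENNReal NNReal Matrix

/-- The sub-gaussian norm `inf {t > 0 : E exp (Z² / t²) ≤ 2}` of a real random variable, with values
in `[0, ∞]` (it is `∞` when no such `t` exists). -/
noncomputable def psi2Norm {Ω : Type*} [MeasurableSpace Ω] (μ : Measure Ω) (Z : Ω → ℝ) : ℝ≥0∞ :=
  sInf {s : ℝ≥0∞ | ∃ t : ℝ, 0 < t ∧ s = ENNReal.ofReal t ∧
    ∫⁻ ω, ENNReal.ofReal (Real.exp (Z ω ^ 2 / t ^ 2)) ∂μ ≤ 2}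

/-- The sub-gaussian norm `sup_{s ≠ 0} ‖⟨s, Z⟩ / ‖s‖‖_{ψ₂}` of a random vector. If the index set `ι`
is finite, `s` ranges over all nonzero vectors; if it is infinite, over those with finitely many
nonzero coordinates (a dense set of directions, on which `⟨s, Z⟩` always makes sense). -/
noncomputable def psi2NormVec {Ω ι : Type*} [MeasurableSpace Ω] (μ : Measure Ω)
    (Z : Ω → ι → ℝ) : ℝ≥0∞ :=
  ⨆ (s : ι →₀ ℝ) (_ : s ≠ 0),
    psi2Norm μ (fun ω => (s.sum fun i c => c * Z ω i) / √(s.sum fun _ c => c ^ 2))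

/-- Real vectors with square-summable coordinates indexed by `ι`: `ℝᵖ` with its Euclidean norm for
`ι = Fin p`, the sequence space `ℓ²` for `ι = ℕ`. -/
abbrev FeatureSpace (ι : Type*) : Type _ := lp (fun _ : ι => ℝ) 2

section Estimator

/-- `‖v‖_Σ² = vᵀ Σ v` for `Σ = diag(lam)`. -/
noncomputable def sigmaNormSq {ι : Type*} (lam : ι → ℝ) (v : FeatureSpace ι) : ℝ :=
  ∑' i, lam i * v i ^ 2

/-- The `n × n` matrix `reg Iₙ + X Xᵀ`, where `x a` is the `a`-th row of `X`. -/
noncomputable def regGram {ι : Type*} {n : ℕ} (reg : ℝ) (x : Fin n → FeatureSpace ι) :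
    Matrix (Fin n) (Fin n) ℝ :=
  reg • (1 : Matrix (Fin n) (Fin n) ℝ) + Matrix.gram ℝ x

/-- The vector `X v`. -/
noncomputable def designMul {ι : Type*} {n : ℕ} (x : Fin n → FeatureSpace ι)
    (v : FeatureSpace ι) : Fin n → ℝ :=
  fun a => inner ℝ (x a) v

/-- The vector `Xᵀ w`. -/
noncomputable def designTransposeMul {ι : Type*} {n : ℕ} (x : Fin n → FeatureSpace ι)
    (w : Fin n → ℝ) : FeatureSpace ι :=
  ∑ a, w a • x a

/-- The ridge estimator `Xᵀ (reg Iₙ + X Xᵀ)⁻¹ y`. -/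
noncomputable def ridgeEstimator {ι : Type*} {n : ℕ} (reg : ℝ) (x : Fin n → FeatureSpace ι)
    (y : Fin n → ℝ) : FeatureSpace ι :=
  designTransposeMul x ((regGram reg x)⁻¹ *ᵥ y)

/-- The bias term `‖(I - Xᵀ (reg Iₙ + X Xᵀ)⁻¹ X) θ‖_Σ²`. -/
noncomputable def biasTerm {ι : Type*} {n : ℕ} (lam : ι → ℝ) (reg : ℝ)
    (x : Fin n → FeatureSpace ι) (θ : FeatureSpace ι) : ℝ :=
  sigmaNormSq lam (θ - ridgeEstimator reg x (designMul x θ))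

/-- The variance term `‖Xᵀ (reg Iₙ + X Xᵀ)⁻¹ ε‖_Σ²`. -/
noncomputable def varianceTerm {ι : Type*} {n : ℕ} (lam : ι → ℝ) (reg : ℝ)
    (x : Fin n → FeatureSpace ι) (e : Fin n → ℝ) : ℝ :=
  sigmaNormSq lam (ridgeEstimator reg x e)

end Estimator

/-- The statistical model: `X a ω` is the `a`-th row of the design matrix, `ε ω` the noise vector,
`diag(lam)` the covariance of a row, `σx` and `σε` bounds for the sub-gaussian norms of the whitened
rows and of the noise components. -/
structure RidgeModel {Ω ι : Type*} [MeasurableSpace Ω] (μ : Measure Ω) (n : ℕ)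
    (lam : ι → ℝ) (σx σε : ℝ) (X : Fin n → Ω → FeatureSpace ι) (ε : Ω → Fin n → ℝ) : Prop where
  measurable_row : ∀ a i, Measurable fun ω => X a ω i
  measurable_noise : ∀ a, Measurable fun ω => ε ω a
  rows_indep : iIndepFun (fun (a : Fin n) (ω : Ω) (i : ι) => X a ω i) μ
  rows_identDistrib : ∀ a b : Fin n,
    IdentDistrib (fun (ω : Ω) (i : ι) => X a ω i) (fun (ω : Ω) (i : ι) => X b ω i) μ μ
  rows_centered : ∀ a i, ∫ ω, X a ω i ∂μ = 0
  rows_cov : ∀ a i, covariance (fun ω => X a ω i) (fun ω => X a ω i) μ = lam i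
  rows_cov_offDiag : ∀ a i j, i ≠ j →
    covariance (fun ω => X a ω i) (fun ω => X a ω j) μ = 0
  rows_subgaussian : ∀ a,
    psi2NormVec μ (fun ω i => X a ω i / √(lam i)) ≤ ENNReal.ofReal σx
  noise_indep_design :
    IndepFun (fun (ω : Ω) (a : Fin n) (i : ι) => X a ω i) ε μ
  noise_indep : iIndepFun (fun (a : Fin n) (ω : Ω) => ε ω a) μ
  noise_centered : ∀ a, ∫ ω, ε ω a ∂μ = 0
  noise_subgaussian : ∀ a, psi2Norm μ (fun ω => ε ω a) ≤ ENNReal.ofReal σε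

/-- Eigenvalues `e^{-γ i}`, `i = 1, 2, …`; the index `j : ℕ` stands for `i = j + 1`. -/
noncomputable def expEigenvalues (γ : ℝ) : ℕ → ℝ := fun j => Real.exp (-γ * ((j : ℝ) + 1))

/-- Spiked covariance in dimension `p`: the first `k` eigenvalues are `top`, the others `tail`. -/
def spikedEigenvalues (p k : ℕ) (top tail : ℝ) : Fin p → ℝ :=
  fun i => if (i : ℕ) < k then top else tail

/-- `∑_{i ≤ k} θ_i²` (indices of `Fin p` start at `0`). -/
noncomputable def headNormSq {p : ℕ} (k : ℕ) (θ : FeatureSpace (Fin p)) : ℝ :=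
  ∑ i : Fin p, if (i : ℕ) < k then θ i ^ 2 else 0

/-- `∑_{i > k} θ_i²` (indices of `Fin p` start at `0`). -/
noncomputable def tailNormSq {p : ℕ} (k : ℕ) (θ : FeatureSpace (Fin p)) : ℝ :=
  ∑ i : Fin p, if k ≤ (i : ℕ) then θ i ^ 2 else 0

/-!
Split the features into the head (the first `k`) and the tail, and let `K` be `λ Iₙ + X Xᵀ` without
the contribution of the head. Three conditions control the ridge estimator deterministically: the
eigenvalues of `K` are comparable to some `α > 0`; the Gram matrix of the whitened head features is
bounded below by `n / 2`; the tail Gram matrix weighted by the covariance is at most of order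
`α² / n`. Indeed the dual vector `w = (λ Iₙ + X Xᵀ)⁻¹ y` solves `K w = y - (head part of X Xᵀ w)`;
testing this system against `w` bounds `w`, hence the residual on the head.

The head condition holds with high probability because a sample covariance matrix of `n` isotropic
rows concentrates in dimension `k ≪ n`. For `K` there are two mechanisms. If the eigenvalues decay
exponentially, `λ` itself is the lower bound; the tail is cut into blocks of `n` features, whose
Gram matrices have exponential moments and whose sizes form a geometric series. If the covariance is
spiked with independent components, the `p - k` tail features are independent isotropic vectors of
`ℝⁿ`, so their Gram matrix is `λ_{k+1} (p - k) Iₙ` up to an error of order `λ_{k+1} √(n p)`, which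
still leaves room for a negative `λ`. The variance is a weighted sum of squares of linear forms of
the noise, whose weights are functions of `X`, hence independent of the noise.
-/

/-! ### Sub-gaussian random variables -/

/-- `E exp (Y² / v) ≤ 2`: the variable `Y` has sub-gaussian norm at most `√v`. Indexing by the
square `v` of the bound keeps square roots out of the estimates. -/
def HasPsi2Bound {Ω : Type*} [MeasurableSpace Ω] (μ : Measure Ω) (Y : Ω → ℝ) (v : ℝ) : Prop :=
  ∫⁻ ω, ENNReal.ofReal (Real.exp (Y ω ^ 2 / v)) ∂μ ≤ 2

lemma exp_le_one_add_self_add_sq_mul_exp_abs (x : ℝ) :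
    Real.exp x ≤ 1 + x + x ^ 2 * Real.exp |x| := by
  have h := Complex.norm_exp_sub_sum_le_norm_mul_exp (x : ℂ) 2
  have hsum : Complex.exp (x : ℂ) - ∑ m ∈ Finset.range 2, (x : ℂ) ^ m / (m.factorial : ℂ) =
      ((Real.exp x - (1 + x) : ℝ) : ℂ) := by
    simp [Finset.sum_range_succ]
  rw [hsum, Complex.norm_real, Complex.norm_real, Real.norm_eq_abs, Real.norm_eq_abs, sq_abs] at h
  linarith [le_abs_self (Real.exp x - (1 + x))]

lemma sq_le_eight_mul_exp_half {y : ℝ} (hy : 0 ≤ y) : y ^ 2 ≤ 8 * Real.exp (y / 2) := by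
  have := Real.quadratic_le_exp_of_nonneg (x := y / 2) (by positivity)
  nlinarith

lemma sq_le_mul_exp_sq_div {v : ℝ} (hv : 0 < v) (y : ℝ) : y ^ 2 ≤ v * Real.exp (y ^ 2 / v) := by
  calc y ^ 2 = v * (y ^ 2 / v) := by field_simp
    _ ≤ v * Real.exp (y ^ 2 / v) := by
        gcongr
        linarith [Real.add_one_le_exp (y ^ 2 / v)]

lemma abs_mul_le_half_add {v : ℝ} (hv : 0 < v) (t y : ℝ) :
    |t * y| ≤ t ^ 2 * v / 2 + y ^ 2 / v / 2 := by
  have hle := two_mul_le_add_sq (|t| * √v) (|y| / √v)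
  have hsq : √v ^ 2 = v := Real.sq_sqrt hv.le
  have hv' : √v ≠ 0 := (Real.sqrt_pos.2 hv).ne'
  rw [mul_pow, div_pow, sq_abs, sq_abs, hsq] at hle
  have hprod : 2 * (|t| * √v) * (|y| / √v) = 2 * |t * y| := by
    rw [abs_mul]
    field_simp
  linarith

lemma sq_mul_exp_abs_le {v : ℝ} (hv : 0 < v) (t y : ℝ) :
    y ^ 2 * Real.exp |t * y| ≤ 2 * v * Real.exp (t ^ 2 * v / 2) * Real.exp (y ^ 2 / v) := by
  have hsq : y ^ 2 ≤ 2 * v * Real.exp (y ^ 2 / v / 2) := by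
    have := sq_le_mul_exp_sq_div (v := 2 * v) (by positivity) y
    rwa [show y ^ 2 / (2 * v) = y ^ 2 / v / 2 by field_simp] at this
  calc y ^ 2 * Real.exp |t * y|
      ≤ (2 * v * Real.exp (y ^ 2 / v / 2)) * Real.exp (t ^ 2 * v / 2 + y ^ 2 / v / 2) := by
        gcongr
        exact abs_mul_le_half_add hv t y
    _ = 2 * v * Real.exp (t ^ 2 * v / 2) *
        (Real.exp (y ^ 2 / v / 2) * Real.exp (y ^ 2 / v / 2)) := by
        rw [Real.exp_add]; ring
    _ = 2 * v * Real.exp (t ^ 2 * v / 2) * Real.exp (y ^ 2 / v) := by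
        rw [← Real.exp_add, add_halves]

lemma sq_sq_mul_exp_abs_mul_sq_le {v s : ℝ} (hv : 0 < v) (hs : |s| ≤ 1 / (2 * v)) (y : ℝ) :
    (y ^ 2) ^ 2 * Real.exp |s * y ^ 2| ≤ 8 * v ^ 2 * Real.exp (y ^ 2 / v) := by
  have hsq : (y ^ 2) ^ 2 ≤ 8 * v ^ 2 * Real.exp (y ^ 2 / v / 2) := by
    calc (y ^ 2) ^ 2 = v ^ 2 * (y ^ 2 / v) ^ 2 := by field_simp
      _ ≤ v ^ 2 * (8 * Real.exp (y ^ 2 / v / 2)) := by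
          gcongr
          exact sq_le_eight_mul_exp_half (by positivity)
      _ = 8 * v ^ 2 * Real.exp (y ^ 2 / v / 2) := by ring
  have hexp : |s * y ^ 2| ≤ y ^ 2 / v / 2 := by
    calc |s * y ^ 2| = |s| * y ^ 2 := by rw [abs_mul, abs_of_nonneg (sq_nonneg y)]
      _ ≤ 1 / (2 * v) * y ^ 2 := by gcongr
      _ = y ^ 2 / v / 2 := by field_simp
  calc (y ^ 2) ^ 2 * Real.exp |s * y ^ 2|
      ≤ (8 * v ^ 2 * Real.exp (y ^ 2 / v / 2)) * Real.exp (y ^ 2 / v / 2) := by gcongr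
    _ = 8 * v ^ 2 * Real.exp (y ^ 2 / v) := by rw [mul_assoc, ← Real.exp_add, add_halves]

section SubGaussian

variable {Ω : Type*} [MeasurableSpace Ω] {μ : Measure Ω} {Y : Ω → ℝ} {v : ℝ}

lemma mgf_le_one_add_mul_integral_add [IsProbabilityMeasure μ] {t : ℝ} (hY : Integrable Y μ)
    (hsq : Integrable (fun ω => Y ω ^ 2 * Real.exp |t * Y ω|) μ) :
    mgf Y μ t ≤ 1 + t * ∫ ω, Y ω ∂μ + t ^ 2 * ∫ ω, Y ω ^ 2 * Real.exp |t * Y ω| ∂μ := by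
  have hlin : Integrable (fun ω => 1 + t * Y ω) μ := (integrable_const 1).add (hY.const_mul t)
  calc mgf Y μ t ≤ ∫ ω, (1 + t * Y ω + t ^ 2 * (Y ω ^ 2 * Real.exp |t * Y ω|)) ∂μ := by
        refine integral_mono_of_nonneg (.of_forall fun ω => (Real.exp_pos _).le)
          (hlin.add (hsq.const_mul _)) (.of_forall fun ω => ?_)
        have := exp_le_one_add_self_add_sq_mul_exp_abs (t * Y ω)
        rwa [mul_pow, mul_assoc] at this
    _ = 1 + t * ∫ ω, Y ω ∂μ + t ^ 2 * ∫ ω, Y ω ^ 2 * Real.exp |t * Y ω| ∂μ := by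
        rw [integral_add hlin (hsq.const_mul _),
          integral_add (integrable_const 1) (hY.const_mul t), integral_const_mul,
          integral_const_mul, integral_const, probReal_univ, one_smul]

namespace HasPsi2Bound

lemma mono {w : ℝ} (h : HasPsi2Bound μ Y v) (hv : 0 < v) (hvw : v ≤ w) : HasPsi2Bound μ Y w := by
  refine le_trans (lintegral_mono fun ω => ?_) h
  gcongr

lemma zero [IsProbabilityMeasure μ] : HasPsi2Bound μ (fun _ : Ω => (0 : ℝ)) v := by
  simp [HasPsi2Bound]

lemma integrable_exp (h : HasPsi2Bound μ Y v) (hY : Measurable Y) :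
    Integrable (fun ω => Real.exp (Y ω ^ 2 / v)) μ := by
  refine ⟨by fun_prop, ?_⟩
  rw [hasFiniteIntegral_iff_ofReal (.of_forall fun ω => (Real.exp_pos _).le)]
  exact lt_of_le_of_lt h ENNReal.ofNat_lt_top

lemma integral_exp_le (h : HasPsi2Bound μ Y v) (hY : Measurable Y) :
    ∫ ω, Real.exp (Y ω ^ 2 / v) ∂μ ≤ 2 := by
  rw [← ENNReal.ofReal_le_ofReal_iff zero_le_two, ENNReal.ofReal_ofNat,
    ofReal_integral_eq_lintegral_ofReal (h.integrable_exp hY)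
      (.of_forall fun ω => (Real.exp_pos _).le)]
  exact h

lemma integrable_of_le (h : HasPsi2Bound μ Y v) (hY : Measurable Y) {f : Ω → ℝ}
    (hf : Measurable f) (C : ℝ) (hfC : ∀ ω, |f ω| ≤ C * Real.exp (Y ω ^ 2 / v)) :
    Integrable f μ :=
  Integrable.mono' ((h.integrable_exp hY).const_mul C) hf.aestronglyMeasurable (.of_forall hfC)

lemma integral_le_of_le (h : HasPsi2Bound μ Y v) (hY : Measurable Y) {f : Ω → ℝ}
    (hf : Measurable f) {C : ℝ} (hC : 0 ≤ C) (hfC : ∀ ω, |f ω| ≤ C * Real.exp (Y ω ^ 2 / v)) :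
    ∫ ω, f ω ∂μ ≤ C * 2 := by
  calc ∫ ω, f ω ∂μ ≤ ∫ ω, C * Real.exp (Y ω ^ 2 / v) ∂μ :=
        integral_mono (h.integrable_of_le hY hf C hfC) ((h.integrable_exp hY).const_mul C)
          fun ω => (le_abs_self _).trans (hfC ω)
    _ = C * ∫ ω, Real.exp (Y ω ^ 2 / v) ∂μ := integral_const_mul _ _
    _ ≤ C * 2 := by gcongr; exact h.integral_exp_le hY

lemma integrable_sq (h : HasPsi2Bound μ Y v) (hv : 0 < v) (hY : Measurable Y) :
    Integrable (fun ω => Y ω ^ 2) μ :=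
  h.integrable_of_le hY (by fun_prop) v fun ω => by
    rw [abs_of_nonneg (sq_nonneg _)]; exact sq_le_mul_exp_sq_div hv _

lemma memLp_two (h : HasPsi2Bound μ Y v) (hv : 0 < v) (hY : Measurable Y) : MemLp Y 2 μ :=
  (memLp_two_iff_integrable_sq hY.aestronglyMeasurable).2 (h.integrable_sq hv hY)

lemma integrable_exp_mul (h : HasPsi2Bound μ Y v) (hv : 0 < v) (hY : Measurable Y) (t : ℝ) :
    Integrable (fun ω => Real.exp (t * Y ω)) μ := by
  refine h.integrable_of_le hY (by fun_prop) (Real.exp (t ^ 2 * v / 2)) fun ω => ?_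
  rw [abs_of_pos (Real.exp_pos _), ← Real.exp_add, Real.exp_le_exp]
  have : 0 ≤ Y ω ^ 2 / v := by positivity
  linarith [le_abs_self (t * Y ω), abs_mul_le_half_add hv t (Y ω)]

lemma mgf_le (h : HasPsi2Bound μ Y v) [IsProbabilityMeasure μ] (hv : 0 < v) (hY : Measurable Y)
    (h0 : ∫ ω, Y ω ∂μ = 0) (t : ℝ) : mgf Y μ t ≤ Real.exp (9 * v * t ^ 2 / 2) := by
  have hYint : Integrable Y μ := (h.memLp_two hv hY).integrable one_le_two
  have hbound : ∀ ω, |Y ω ^ 2 * Real.exp (|t * Y ω|)| ≤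
      2 * v * Real.exp (t ^ 2 * v / 2) * Real.exp (Y ω ^ 2 / v) := fun ω => by
    rw [abs_of_nonneg (by positivity)]; exact sq_mul_exp_abs_le hv _ _
  have hmeas : Measurable fun ω => Y ω ^ 2 * Real.exp |t * Y ω| :=
    (hY.pow_const 2).mul (hY.const_mul t).abs.exp
  calc mgf Y μ t ≤ 1 + t * ∫ ω, Y ω ∂μ + t ^ 2 * ∫ ω, Y ω ^ 2 * Real.exp |t * Y ω| ∂μ :=
        mgf_le_one_add_mul_integral_add hYint (h.integrable_of_le hY hmeas _ hbound)
    _ ≤ 1 + t ^ 2 * (2 * v * Real.exp (t ^ 2 * v / 2) * 2) := by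
        rw [h0, mul_zero, add_zero]
        gcongr
        exact h.integral_le_of_le hY hmeas (by positivity) hbound
    _ ≤ Real.exp (t ^ 2 * v / 2) * (4 * (t ^ 2 * v) + 1) := by
        linarith [Real.one_le_exp (x := t ^ 2 * v / 2) (by positivity)]
    _ ≤ Real.exp (t ^ 2 * v / 2) * Real.exp (4 * (t ^ 2 * v)) := by
        gcongr
        exact Real.add_one_le_exp _
    _ = Real.exp (9 * v * t ^ 2 / 2) := by
        rw [← Real.exp_add]
        congr 1; ring

lemma hasSubgaussianMGF [IsProbabilityMeasure μ] (h : HasPsi2Bound μ Y v) (hv : 0 < v)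
    (hY : Measurable Y) (h0 : ∫ ω, Y ω ∂μ = 0) :
    HasSubgaussianMGF Y (Real.toNNReal (9 * v)) μ where
  integrable_exp_mul := h.integrable_exp_mul hv hY
  mgf_le t := by
    rw [Real.coe_toNNReal _ (by positivity)]
    exact h.mgf_le hv hY h0 t

end HasPsi2Bound

lemma lintegral_exp_mul_gaussianReal (w : ℝ≥0) (y : ℝ) :
    ∫⁻ g, ENNReal.ofReal (Real.exp (y * g)) ∂gaussianReal 0 w =
      ENNReal.ofReal (Real.exp (w * y ^ 2 / 2)) := by
  have hmgf := mgf_gaussianReal (X := id) (p := gaussianReal 0 w) (μ := 0) (v := w) (by simp) y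
  simp only [mgf, id, zero_mul, zero_add] at hmgf
  rw [← hmgf, ofReal_integral_eq_lintegral_ofReal (integrable_exp_mul_gaussianReal y)
    (.of_forall fun ω => (Real.exp_pos _).le)]

lemma lintegral_exp_mul_sq_gaussianReal {w : ℝ≥0} (hw : w ≠ 0) {s : ℝ} (hs : 2 * s * w < 1) :
    ∫⁻ g, ENNReal.ofReal (Real.exp (s * g ^ 2)) ∂gaussianReal 0 w =
      ENNReal.ofReal (√(1 - 2 * s * w)⁻¹) := by
  have : (0 : ℝ) < w := NNReal.coe_pos.2 (pos_iff_ne_zero.2 hw)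
  have hb : 0 < 1 / (2 * w) - s := by
    rw [sub_pos, lt_div_iff₀ (by positivity)]
    linarith
  have hdensity : ∀ g : ℝ, (gaussianPDF 0 w * fun g => ENNReal.ofReal (Real.exp (s * g ^ 2))) g =
      ENNReal.ofReal ((√(2 * Real.pi * w))⁻¹ * Real.exp (-(1 / (2 * w) - s) * g ^ 2)) := by
    intro g
    simp only [Pi.mul_apply, gaussianPDF, gaussianPDFReal]
    rw [← ENNReal.ofReal_mul (by positivity), mul_assoc, ← Real.exp_add]
    congr 3
    field_simp
    ring
  rw [gaussianReal_of_var_ne_zero _ hw,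
    lintegral_withDensity_eq_lintegral_mul _ (measurable_gaussianPDF _ _) (by fun_prop)]
  simp_rw [hdensity]
  rw [← ofReal_integral_eq_lintegral_ofReal ((integrable_exp_neg_mul_sq hb).const_mul _)
    (.of_forall fun g => by positivity), integral_const_mul, integral_gaussian, ← Real.sqrt_inv,
    ← Real.sqrt_mul (by positivity)]
  congr 2
  have : 1 - 2 * s * w ≠ 0 := by linarith
  rw [show 1 / (2 * w) - s = (1 - 2 * s * w) / (2 * w) by field_simp]
  field_simp

/- With `g` a centered Gaussian of variance `1 / (2c)` independent of `Y`, both sides of the moment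
bound are `E exp (g Y)`, computed by conditioning on `Y` and on `g` respectively. -/
lemma HasPsi2Bound.of_hasSubgaussianMGF [SFinite μ] {c : ℝ≥0} (h : HasSubgaussianMGF Y c μ)
    (hY : Measurable Y) (hc : 0 < c) : HasPsi2Bound μ Y (4 * c) := by
  have : (0 : ℝ) < c := hc
  obtain ⟨w, hw⟩ : ∃ w : ℝ≥0, (w : ℝ) = 1 / (2 * c) := ⟨⟨1 / (2 * c), by positivity⟩, rfl⟩
  have hw0 : w ≠ 0 := by rw [← NNReal.coe_ne_zero, hw]; positivity
  have hcw : 2 * ((c : ℝ) / 2) * w = 1 / 2 := by rw [hw]; field_simp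
  calc ∫⁻ ω, ENNReal.ofReal (Real.exp (Y ω ^ 2 / (4 * c))) ∂μ
      = ∫⁻ ω, ∫⁻ g, ENNReal.ofReal (Real.exp (Y ω * g)) ∂gaussianReal 0 w ∂μ := by
        refine lintegral_congr fun ω => ?_
        rw [lintegral_exp_mul_gaussianReal, hw]
        congr 2; field_simp; ring
    _ = ∫⁻ g, ∫⁻ ω, ENNReal.ofReal (Real.exp (Y ω * g)) ∂μ ∂gaussianReal 0 w := by
        rw [lintegral_lintegral_swap]
        fun_prop
    _ ≤ ∫⁻ g, ENNReal.ofReal (Real.exp (c / 2 * g ^ 2)) ∂gaussianReal 0 w := by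
        refine lintegral_mono fun g => ?_
        simp_rw [mul_comm (Y _) g]
        rw [← ofReal_integral_eq_lintegral_ofReal (h.integrable_exp_mul g)
          (.of_forall fun ω => (Real.exp_pos _).le), div_mul_eq_mul_div]
        exact ENNReal.ofReal_le_ofReal (h.mgf_le g)
    _ = ENNReal.ofReal (√(1 - 1 / 2)⁻¹) := by
        rw [lintegral_exp_mul_sq_gaussianReal hw0 (by rw [hcw]; norm_num), hcw]
    _ ≤ 2 := by
        rw [← ENNReal.ofReal_ofNat]
        exact ENNReal.ofReal_le_ofReal (Real.sqrt_le_iff.2 (by norm_num))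

lemma HasPsi2Bound.sum_of_iIndepFun [IsProbabilityMeasure μ] {m : Type*} [Fintype m]
    {Y : m → Ω → ℝ} (hindep : iIndepFun Y μ) (hY : ∀ a, Measurable (Y a)) (hv : 0 < v)
    (h : ∀ a, HasPsi2Bound μ (Y a) v) (h0 : ∀ a, ∫ ω, Y a ω ∂μ = 0) (u : m → ℝ) :
    HasPsi2Bound μ (fun ω => ∑ a, u a * Y a ω) (36 * v * ∑ a, u a ^ 2) := by
  rcases (Finset.sum_nonneg fun a _ => sq_nonneg (u a)).eq_or_lt' with hu | hu
  · have hu0 : ∀ a, u a = 0 := fun a =>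
      pow_eq_zero_iff two_ne_zero |>.1
        ((Finset.sum_eq_zero_iff_of_nonneg fun a _ => sq_nonneg (u a)).1 hu a (Finset.mem_univ a))
    simpa [hu0] using zero
  have hsum := HasSubgaussianMGF.sum_of_iIndepFun (s := Finset.univ)
    (hindep.comp (fun a y => u a * y) fun a => by fun_prop)
    fun a _ => ((h a).hasSubgaussianMGF hv (hY a) (h0 a)).const_mul (u a)
  obtain ⟨c, hcv, hc⟩ : ∃ c : ℝ≥0, (c : ℝ) = 9 * v * ∑ a, u a ^ 2 ∧
      HasSubgaussianMGF (fun ω => ∑ a, u a * Y a ω) c μ := by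
    refine ⟨_, ?_, hsum⟩
    rw [NNReal.coe_sum, Finset.mul_sum]
    refine Finset.sum_congr rfl fun a _ => ?_
    change u a ^ 2 * ((9 * v).toNNReal : ℝ) = _
    rw [Real.coe_toNNReal _ (by positivity), mul_comm]
  have hcpos : 0 < c := by rw [← NNReal.coe_pos, hcv]; positivity
  have := of_hasSubgaussianMGF hc (by fun_prop) hcpos
  rwa [hcv, show 4 * (9 * v * ∑ a, u a ^ 2) = 36 * v * ∑ a, u a ^ 2 by ring] at this

lemma HasPsi2Bound.integrable_exp_mul_sq (h : HasPsi2Bound μ Y v) (hv : 0 < v) (hY : Measurable Y)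
    {s : ℝ} (hs : |s| ≤ 1 / (2 * v)) : Integrable (fun ω => Real.exp (s * Y ω ^ 2)) μ := by
  refine h.integrable_of_le hY (by fun_prop) 1 fun ω => ?_
  rw [abs_of_pos (Real.exp_pos _), one_mul, Real.exp_le_exp]
  calc s * Y ω ^ 2 ≤ 1 / v * Y ω ^ 2 := by
        gcongr
        calc s ≤ 1 / (2 * v) := (le_abs_self s).trans hs
          _ ≤ 1 / v := by gcongr; linarith
    _ = Y ω ^ 2 / v := by ring

lemma HasPsi2Bound.mgf_sq_le [IsProbabilityMeasure μ] (h : HasPsi2Bound μ Y v) (hv : 0 < v)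
    (hY : Measurable Y) (h1 : ∫ ω, Y ω ^ 2 ∂μ = 1) {s : ℝ} (hs : |s| ≤ 1 / (2 * v)) :
    mgf (fun ω => Y ω ^ 2) μ s ≤ Real.exp (s + 16 * v ^ 2 * s ^ 2) := by
  have hbound : ∀ ω, |(Y ω ^ 2) ^ 2 * Real.exp (|s * Y ω ^ 2|)| ≤
      8 * v ^ 2 * Real.exp (Y ω ^ 2 / v) := fun ω => by
    rw [abs_of_nonneg (by positivity)]
    exact sq_sq_mul_exp_abs_mul_sq_le hv hs _
  have hmeas : Measurable fun ω => (Y ω ^ 2) ^ 2 * Real.exp |s * Y ω ^ 2| :=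
    ((hY.pow_const 2).pow_const 2).mul ((hY.pow_const 2).const_mul s).abs.exp
  calc mgf (fun ω => Y ω ^ 2) μ s
      ≤ 1 + s * ∫ ω, Y ω ^ 2 ∂μ + s ^ 2 * ∫ ω, (Y ω ^ 2) ^ 2 * Real.exp |s * Y ω ^ 2| ∂μ :=
        mgf_le_one_add_mul_integral_add (h.integrable_sq hv hY)
          (h.integrable_of_le hY hmeas _ hbound)
    _ ≤ 1 + s + s ^ 2 * (8 * v ^ 2 * 2) := by
        rw [h1, mul_one]
        gcongr
        exact h.integral_le_of_le hY hmeas (by positivity) hbound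
    _ = (s + 16 * v ^ 2 * s ^ 2) + 1 := by ring
    _ ≤ Real.exp (s + 16 * v ^ 2 * s ^ 2) := Real.add_one_le_exp _

lemma mgf_sum_sq_le [IsProbabilityMeasure μ] {m : Type*} [Fintype m] {Y : m → Ω → ℝ}
    (hindep : iIndepFun Y μ) (hY : ∀ a, Measurable (Y a)) (hv : 0 < v)
    (h : ∀ a, HasPsi2Bound μ (Y a) v) (h1 : ∀ a, ∫ ω, Y a ω ^ 2 ∂μ = 1) {s : ℝ}
    (hs : |s| ≤ 1 / (2 * v)) :
    mgf (fun ω => ∑ a, Y a ω ^ 2) μ s ≤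
      Real.exp (Fintype.card m * (s + 16 * v ^ 2 * s ^ 2)) := by
  have hsq : iIndepFun (fun a ω => Y a ω ^ 2) μ :=
    hindep.comp (fun _ y => y ^ 2) fun _ => by fun_prop
  have hsum : (fun ω => ∑ a, Y a ω ^ 2) = ∑ a, fun ω => Y a ω ^ 2 := by
    ext ω
    simp only [Finset.sum_apply]
  rw [hsum, hsq.mgf_sum fun a => by fun_prop, Real.exp_nat_mul]
  calc ∏ a, mgf (fun ω => Y a ω ^ 2) μ s ≤ ∏ _a : m, Real.exp (s + 16 * v ^ 2 * s ^ 2) :=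
        Finset.prod_le_prod (fun _ _ => mgf_nonneg) fun a _ => (h a).mgf_sq_le hv (hY a) (h1 a) hs
    _ = Real.exp (s + 16 * v ^ 2 * s ^ 2) ^ Fintype.card m := Finset.prod_const _

lemma integrable_exp_mul_sum_sq [IsProbabilityMeasure μ] {m : Type*} [Fintype m] {Y : m → Ω → ℝ}
    (hindep : iIndepFun Y μ) (hY : ∀ a, Measurable (Y a)) (hv : 0 < v)
    (h : ∀ a, HasPsi2Bound μ (Y a) v) {s : ℝ} (hs : |s| ≤ 1 / (2 * v)) :
    Integrable (fun ω => Real.exp (s * ∑ a, Y a ω ^ 2)) μ := by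
  have hsq : iIndepFun (fun a ω => Y a ω ^ 2) μ :=
    hindep.comp (fun _ y => y ^ 2) fun _ => by fun_prop
  have := hsq.integrable_exp_mul_sum (fun a => by fun_prop) (s := Finset.univ) (t := s)
    fun a _ => (h a).integrable_exp_mul_sq hv (hY a) hs
  simpa only [Finset.sum_apply] using this

lemma measureReal_le_abs_sub_le_of_mgf_le [IsFiniteMeasure μ] {s x B : ℝ} (b : ℝ) (hs : 0 ≤ s)
    (hinteg : ∀ s' ∈ ({s, -s} : Set ℝ), Integrable (fun ω => Real.exp (s' * Y ω)) μ)
    (hmgf : ∀ s' ∈ ({s, -s} : Set ℝ), mgf Y μ s' ≤ Real.exp (s' * b + B)) :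
    μ.real {ω | x ≤ |Y ω - b|} ≤ 2 * Real.exp (-s * x + B) := by
  have hupper : μ.real {ω | b + x ≤ Y ω} ≤ Real.exp (-s * x + B) :=
    calc μ.real {ω | b + x ≤ Y ω} ≤ Real.exp (-s * (b + x)) * mgf Y μ s :=
          measure_ge_le_exp_mul_mgf _ hs (hinteg s (by simp))
      _ ≤ Real.exp (-s * (b + x)) * Real.exp (s * b + B) := by
          gcongr; exact hmgf s (by simp)
      _ = Real.exp (-s * x + B) := by rw [← Real.exp_add]; ring_nf
  have hlower : μ.real {ω | Y ω ≤ b - x} ≤ Real.exp (-s * x + B) :=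
    calc μ.real {ω | Y ω ≤ b - x} ≤ Real.exp (- -s * (b - x)) * mgf Y μ (-s) :=
          measure_le_le_exp_mul_mgf _ (by linarith) (hinteg (-s) (by simp))
      _ ≤ Real.exp (- -s * (b - x)) * Real.exp (-s * b + B) := by
          gcongr; exact hmgf (-s) (by simp)
      _ = Real.exp (-s * x + B) := by rw [← Real.exp_add]; ring_nf
  calc μ.real {ω | x ≤ |Y ω - b|} ≤ μ.real ({ω | b + x ≤ Y ω} ∪ {ω | Y ω ≤ b - x}) := by
        refine measureReal_mono fun ω hω => ?_
        simp only [Set.mem_ofPred_eq, Set.mem_union] at hω ⊢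
        rcases le_abs.1 hω with hle | hle
        · exact Or.inl (by linarith)
        · exact Or.inr (by linarith)
    _ ≤ 2 * Real.exp (-s * x + B) := (measureReal_union_le _ _).trans (by linarith)

lemma measureReal_abs_sum_sq_sub_card_ge_le [IsProbabilityMeasure μ] {m : Type*} [Fintype m]
    {Y : m → Ω → ℝ} (hindep : iIndepFun Y μ) (hY : ∀ a, Measurable (Y a)) (hv : 0 < v)
    (h : ∀ a, HasPsi2Bound μ (Y a) v) (h1 : ∀ a, ∫ ω, Y a ω ^ 2 ∂μ = 1) {r : ℝ} (hr : 0 ≤ r)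
    (hrm : r ≤ Fintype.card m) :
    μ.real {ω | 14 * v * √(Fintype.card m * r) ≤ |∑ a, Y a ω ^ 2 - Fintype.card m|} ≤
      2 * Real.exp (-3 * r) := by
  set N : ℝ := (Fintype.card m : ℝ) with hN_def
  rcases (hr.trans hrm).eq_or_lt with hN | hN
  · obtain rfl : r = 0 := le_antisymm (by linarith) hr
    simp only [mul_zero, Real.exp_zero, mul_one]
    exact measureReal_le_one.trans one_le_two
  obtain ⟨q, hq, hqq, hqN⟩ : ∃ q, 0 ≤ q ∧ q ^ 2 = N * r ∧ √(N * r) = q :=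
    ⟨√(N * r), Real.sqrt_nonneg _, Real.sq_sqrt (by positivity), rfl⟩
  have hle : q ≤ N := by nlinarith
  -- the minimizer of `-14 v q s + 16 v² N s²` is this `s` up to a constant factor
  set s := q / (2 * v * N) with hs
  have hs0 : 0 ≤ s := by positivity
  have hs1 : s ≤ 1 / (2 * v) := by
    rw [hs, div_le_div_iff₀ (by positivity) (by positivity)]
    nlinarith
  have habs : ∀ s' ∈ ({s, -s} : Set ℝ), |s'| ≤ 1 / (2 * v) ∧ s' ^ 2 = s ^ 2 := by
    rintro s' (rfl | rfl)
    · exact ⟨by rwa [abs_of_nonneg hs0], rfl⟩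
    · exact ⟨by rwa [abs_neg, abs_of_nonneg hs0], neg_sq s⟩
  have htail := measureReal_le_abs_sub_le_of_mgf_le (x := 14 * v * q)
    (B := N * (16 * v ^ 2 * s ^ 2)) N hs0
    (fun s' hs' => integrable_exp_mul_sum_sq hindep hY hv h (habs s' hs').1) fun s' hs' => by
      refine (mgf_sum_sq_le hindep hY hv h h1 (habs s' hs').1).trans_eq ?_
      rw [(habs s' hs').2, ← hN_def]
      ring_nf
  rw [hqN]
  refine htail.trans_eq ?_
  congr 2
  rw [hs]
  field_simp
  linear_combination -12 * hqq

end SubGaussian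

/-! ### Quadratic forms on the unit sphere -/

section Net

variable {E : Type*} [NormedAddCommGroup E]

lemma card_le_of_isSeparated_sphere [NormedSpace ℝ E] [FiniteDimensional ℝ E] {s : Finset E}
    (hs : (s : Set E) ⊆ Metric.sphere 0 1) (hsep : Metric.IsSeparated (1 / 2) (s : Set E)) :
    s.card ≤ 5 ^ Module.finrank ℝ E := by
  classical
  have hinj : Function.Injective fun x : E => (2 : ℝ) • x := smul_right_injective E two_ne_zero
  rw [← Finset.card_image_of_injective s hinj]
  apply Besicovitch.card_le_of_separated
  · rintro _ hc
    obtain ⟨u, hu, rfl⟩ := Finset.mem_image.1 hc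
    simp [norm_smul, mem_sphere_zero_iff_norm.1 (hs hu)]
  · rintro _ hc _ hd hcd
    obtain ⟨u, hu, rfl⟩ := Finset.mem_image.1 hc
    obtain ⟨w, hw, rfl⟩ := Finset.mem_image.1 hd
    have huw : 1 / 2 < ‖u - w‖ := by
      have : 1 / 2 < edist u w := hsep hu hw fun h => hcd (by rw [h])
      rwa [edist_dist, ← ENNReal.ofReal_one, ← ENNReal.ofReal_ofNat 2,
        ← ENNReal.ofReal_div_of_pos two_pos, ENNReal.ofReal_lt_ofReal_iff_of_nonneg (by positivity),
        dist_eq_norm] at this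
    rw [← smul_sub, norm_smul, Real.norm_ofNat]
    linarith

lemma packingNumber_sphere_le [NormedSpace ℝ E] [FiniteDimensional ℝ E] :
    Metric.packingNumber (1 / 2) (Metric.sphere (0 : E) 1) ≤ (5 ^ Module.finrank ℝ E : ℕ) := by
  refine iSup_le fun C => iSup₂_le fun hC hsep => ?_
  by_contra! hlt
  obtain ⟨t, htC, ht⟩ := Set.exists_subset_encard_eq (Order.add_one_le_of_lt hlt)
  have hfin : t.Finite := Set.finite_of_encard_eq_coe (k := 5 ^ Module.finrank ℝ E + 1) ht
  have := card_le_of_isSeparated_sphere (s := hfin.toFinset) (by simpa using htC.trans hC)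
    (by simpa using hsep.subset htC)
  rw [hfin.encard_eq_coe_toFinset_card] at ht
  norm_cast at ht
  omega

lemma exists_sphere_net (E : Type*) [NormedAddCommGroup E] [NormedSpace ℝ E]
    [FiniteDimensional ℝ E] :
    ∃ N : Finset E, N.card ≤ 5 ^ Module.finrank ℝ E ∧ (∀ u ∈ N, ‖u‖ = 1) ∧
      ∀ v : E, ‖v‖ = 1 → ∃ u ∈ N, ‖v - u‖ ≤ 1 / 2 := by
  have hle := (Metric.coveringNumber_le_packingNumber _ _).trans (packingNumber_sphere_le (E := E))
  have htop : Metric.coveringNumber (1 / 2) (Metric.sphere (0 : E) 1) ≠ ⊤ :=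
    ne_top_of_le_ne_top (ENat.natCast_ne_top _) hle
  have hfin : (Metric.minimalCover (1 / 2) (Metric.sphere (0 : E) 1)).Finite :=
    Metric.finite_minimalCover
  refine ⟨hfin.toFinset, ?_, fun u hu => ?_, fun v hv => ?_⟩
  · rw [← Metric.encard_minimalCover htop, hfin.encard_eq_coe_toFinset_card] at hle
    exact_mod_cast hle
  · exact mem_sphere_zero_iff_norm.1 (Metric.minimalCover_subset (hfin.mem_toFinset.1 hu))
  · obtain ⟨u, hu, hvu⟩ := Metric.isCover_minimalCover htop (mem_sphere_zero_iff_norm.2 hv)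
    refine ⟨u, hfin.mem_toFinset.2 hu, ?_⟩
    rw [← dist_eq_norm]
    exact_mod_cast (edist_le_coe.1 hvu : nndist v u ≤ 1 / 2)

variable [InnerProductSpace ℝ E]

lemma abs_inner_sub_inner_le {T : E →L[ℝ] E} (hT : T.IsSymmetric) {w u : E} (hw : ‖w‖ = 1)
    (hu : ‖u‖ = 1) (hwu : ‖w - u‖ ≤ 1 / 2) :
    |inner ℝ (T w) w - inner ℝ (T u) u| ≤ 31 / 32 * ‖T‖ := by
  have hfactor : inner ℝ (T w) w - inner ℝ (T u) u = inner ℝ (T (w - u)) (w + u) := by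
    have := hT w u
    simp only [map_sub, inner_sub_left, inner_add_right]
    have h2 : inner ℝ (T u) w = inner ℝ (T w) u := by
      rw [real_inner_comm]; exact this.symm
    linarith
  have hpar : ‖w + u‖ ^ 2 + ‖w - u‖ ^ 2 = 4 := by
    have := parallelogram_law_with_norm ℝ w u
    rw [hw, hu] at this
    linarith
  have hprod : ‖w - u‖ * ‖w + u‖ ≤ 31 / 32 := by
    refine abs_le_of_sq_le_sq' ?_ (by norm_num) |>.2
    rw [mul_pow]
    have : ‖w - u‖ ^ 2 ≤ 1 / 4 := by nlinarith [norm_nonneg (w - u)]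
    nlinarith
  calc |inner ℝ (T w) w - inner ℝ (T u) u| = |inner ℝ (T (w - u)) (w + u)| := by rw [hfactor]
    _ ≤ ‖T (w - u)‖ * ‖w + u‖ := abs_real_inner_le_norm _ _
    _ ≤ ‖T‖ * ‖w - u‖ * ‖w + u‖ := by gcongr; exact T.le_opNorm _
    _ ≤ 31 / 32 * ‖T‖ := by
        rw [mul_assoc, mul_comm (31 / 32 : ℝ)]
        gcongr

lemma opNorm_le_of_sphere_net {T : E →L[ℝ] E} (hT : T.IsSymmetric) {N : Set E}
    (hN : ∀ u ∈ N, ‖u‖ = 1) (hcover : ∀ v : E, ‖v‖ = 1 → ∃ u ∈ N, ‖v - u‖ ≤ 1 / 2) {M : ℝ}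
    (hM0 : 0 ≤ M) (hM : ∀ u ∈ N, |inner ℝ (T u) u| ≤ M) : ‖T‖ ≤ 32 * M := by
  have hsup : ‖T‖ ≤ M + 31 / 32 * ‖T‖ := by
    conv_lhs => rw [T.norm_eq_iSup_rayleighQuotient hT]
    refine ciSup_le fun x => ?_
    rcases eq_or_ne x 0 with rfl | hx
    · rw [T.rayleighQuotient_apply_zero]
      simp only [abs_zero]
      positivity
    set w : E := (‖x‖⁻¹ : ℝ) • x with hw
    have hw1 : ‖w‖ = 1 := by
      rw [hw, norm_smul, norm_inv, norm_norm, inv_mul_cancel₀ (norm_ne_zero_iff.2 hx)]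
    obtain ⟨u, hu, hwu⟩ := hcover w hw1
    have hxw : T.rayleighQuotient x = inner ℝ (T w) w := by
      rw [← T.rayleigh_smul x (c := ‖x‖⁻¹) (inv_ne_zero (norm_ne_zero_iff.2 hx)), ← hw]
      simp [ContinuousLinearMap.rayleighQuotient, ContinuousLinearMap.reApplyInnerSelf_apply, hw1]
    rw [hxw]
    have := abs_sub_abs_le_abs_sub (inner ℝ (T w) w) (inner ℝ (T u) u)
    linarith [hM u hu, abs_inner_sub_inner_le hT hw1 (hN u hu) hwu]
  linarith

lemma abs_norm_sq_sub_le_of_sphere_net {F : Type*} [NormedAddCommGroup F] [InnerProductSpace ℝ F]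
    [CompleteSpace E] [CompleteSpace F] (A : E →L[ℝ] F) {N : Set E} (hN : ∀ u ∈ N, ‖u‖ = 1)
    (hcover : ∀ v : E, ‖v‖ = 1 → ∃ u ∈ N, ‖v - u‖ ≤ 1 / 2) {c M : ℝ}
    (hM : ∀ u ∈ N, |‖A u‖ ^ 2 - c| ≤ M) (v : E) :
    |‖A v‖ ^ 2 - c * ‖v‖ ^ 2| ≤ 32 * M * ‖v‖ ^ 2 := by
  rcases eq_or_ne v 0 with rfl | hv
  · simp
  have hM0 : 0 ≤ M := by
    obtain ⟨u, hu, -⟩ := hcover ((‖v‖⁻¹ : ℝ) • v) (by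
      rw [norm_smul, norm_inv, norm_norm, inv_mul_cancel₀ (norm_ne_zero_iff.2 hv)])
    exact (abs_nonneg _).trans (hM u hu)
  let T : E →L[ℝ] E := A.adjoint ∘L A - c • ContinuousLinearMap.id ℝ E
  have hquad : ∀ w, inner ℝ (T w) w = ‖A w‖ ^ 2 - c * ‖w‖ ^ 2 := fun w => by
    simp [T, inner_sub_left, ContinuousLinearMap.adjoint_inner_left, inner_smul_left]
  have hT : T.IsSymmetric := fun w u => by
    simp [T, inner_sub_left, inner_sub_right, ContinuousLinearMap.adjoint_inner_left,
      ContinuousLinearMap.adjoint_inner_right, inner_smul_left, inner_smul_right]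
  have hnorm : ‖T‖ ≤ 32 * M := opNorm_le_of_sphere_net hT hN hcover hM0 fun u hu => by
    rw [hquad, hN u hu, one_pow, mul_one]
    exact hM u hu
  calc |‖A v‖ ^ 2 - c * ‖v‖ ^ 2| = |inner ℝ (T v) v| := by rw [hquad]
    _ ≤ ‖T v‖ * ‖v‖ := abs_real_inner_le_norm _ _
    _ ≤ ‖T‖ * ‖v‖ * ‖v‖ := by gcongr; exact T.le_opNorm v
    _ ≤ 32 * M * ‖v‖ * ‖v‖ := by gcongr
    _ = 32 * M * ‖v‖ ^ 2 := by ring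

lemma exists_net_abs_sum_sq_sub_le (m κ : Type*) [Fintype m] [Fintype κ] :
    ∃ N : Finset (κ → ℝ), N.card ≤ 5 ^ Fintype.card κ ∧ (∀ u ∈ N, ∑ j, u j ^ 2 = 1) ∧
      ∀ (y : m → κ → ℝ) (c M : ℝ), (∀ u ∈ N, |∑ a, (∑ j, u j * y a j) ^ 2 - c| ≤ M) →
        ∀ v : κ → ℝ, |∑ a, (∑ j, v j * y a j) ^ 2 - c * ∑ j, v j ^ 2| ≤
          32 * M * ∑ j, v j ^ 2 := by
  classical
  obtain ⟨N, hcard, hunit, hcover⟩ := exists_sphere_net (EuclideanSpace ℝ κ)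
  refine ⟨N.image WithLp.ofLp, Finset.card_image_le.trans (by simpa using hcard), ?_, ?_⟩
  · intro u hu
    obtain ⟨w, hw, rfl⟩ := Finset.mem_image.1 hu
    rw [← EuclideanSpace.real_norm_sq_eq, hunit w hw, one_pow]
  · intro y c M hM v
    let A : EuclideanSpace ℝ κ →L[ℝ] EuclideanSpace ℝ m :=
      (Matrix.toEuclideanLin (Matrix.of y)).toContinuousLinearMap
    have hA : ∀ w, ‖A w‖ ^ 2 = ∑ a, (∑ j, w j * y a j) ^ 2 := fun w => by
      simp [A, EuclideanSpace.real_norm_sq_eq, Matrix.mulVec, dotProduct, mul_comm]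
    have := abs_norm_sq_sub_le_of_sphere_net A (N := N) hunit hcover (c := c) (M := M)
      (fun u hu => by rw [hA]; exact hM _ (Finset.mem_image_of_mem _ hu)) (WithLp.toLp 2 v)
    rwa [hA, EuclideanSpace.real_norm_sq_eq] at this

end Net

/-! ### Sample covariance of independent isotropic sub-gaussian vectors -/

section Covariance

variable {Ω : Type*} [MeasurableSpace Ω] {μ : Measure Ω}

lemma measureReal_biUnion_finset_le_card_mul {α : Type*} [IsFiniteMeasure μ] (N : Finset α)
    (B : α → Set Ω) {ρ : ℝ} (h : ∀ u ∈ N, μ.real (B u) ≤ ρ) :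
    μ.real (⋃ u ∈ N, B u) ≤ N.card * ρ :=
  (measureReal_biUnion_finset_le N B).trans
    ((Finset.sum_le_card_nsmul N _ ρ h).trans_eq (nsmul_eq_mul _ _))

lemma five_pow_mul_exp_le {d : ℕ} {r : ℝ} (hd : (d : ℝ) ≤ r) :
    (5 : ℝ) ^ d * Real.exp (-3 * r) ≤ Real.exp (-r) := by
  have h5 : (5 : ℝ) ≤ Real.exp 2 := by
    have := Real.exp_one_gt_d9
    rw [show (2 : ℝ) = 1 + 1 by norm_num, Real.exp_add]
    nlinarith
  calc (5 : ℝ) ^ d * Real.exp (-3 * r) ≤ Real.exp 2 ^ d * Real.exp (-3 * r) := by gcongr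
    _ = Real.exp (d * 2 + -3 * r) := by rw [← Real.exp_nat_mul, Real.exp_add]
    _ ≤ Real.exp (-r) := Real.exp_le_exp.2 (by linarith)

lemma measureReal_exists_abs_sum_sq_sub_gt_le [IsProbabilityMeasure μ] {m κ : Type*} [Fintype m]
    [Fintype κ] {Y : m → Ω → κ → ℝ} (hindep : iIndepFun Y μ) (hY : ∀ a, Measurable (Y a))
    {v r : ℝ} (hv : 0 < v)
    (h : ∀ a (u : κ → ℝ), ∑ j, u j ^ 2 = 1 → HasPsi2Bound μ (fun ω => ∑ j, u j * Y a ω j) v)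
    (h1 : ∀ a (u : κ → ℝ), ∑ j, u j ^ 2 = 1 → ∫ ω, (∑ j, u j * Y a ω j) ^ 2 ∂μ = 1)
    (hκ : (Fintype.card κ : ℝ) ≤ r) (hrm : r ≤ Fintype.card m) :
    μ.real {ω | ∃ w : κ → ℝ, 448 * v * √(Fintype.card m * r) * ∑ j, w j ^ 2 <
        |∑ a, (∑ j, w j * Y a ω j) ^ 2 - Fintype.card m * ∑ j, w j ^ 2|} ≤
      2 * Real.exp (-r) := by
  obtain ⟨N, hcard, hunit, hcontrol⟩ := exists_net_abs_sum_sq_sub_le m κ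
  have hr0 : 0 ≤ r := le_trans (by positivity) hκ
  set M := 14 * v * √(Fintype.card m * r) with hM
  let B : (κ → ℝ) → Set Ω := fun u =>
    {ω | M ≤ |∑ a, (∑ j, u j * Y a ω j) ^ 2 - Fintype.card m|}
  have hB : ∀ u ∈ N, μ.real (B u) ≤ 2 * Real.exp (-3 * r) := fun u hu => by
    refine measureReal_abs_sum_sq_sub_card_ge_le (Y := fun a ω => ∑ j, u j * Y a ω j) ?_ ?_ hv
      (fun a => h a u (hunit u hu)) (fun a => h1 a u (hunit u hu)) hr0 hrm
    · exact hindep.comp (fun _ y => ∑ j, u j * y j) fun _ => by fun_prop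
    · intro a
      have := hY a
      fun_prop
  have hsub : {ω | ∃ w : κ → ℝ, 448 * v * √(Fintype.card m * r) * ∑ j, w j ^ 2 <
      |∑ a, (∑ j, w j * Y a ω j) ^ 2 - Fintype.card m * ∑ j, w j ^ 2|} ⊆ ⋃ u ∈ N, B u := by
    rintro ω ⟨w, hw⟩
    by_contra hout
    simp only [Set.mem_iUnion, not_exists] at hout
    have := hcontrol (fun a => Y a ω) (Fintype.card m) M
      (fun u hu => (not_le.1 (hout u hu)).le) w
    rw [hM] at this
    linarith
  calc _ ≤ μ.real (⋃ u ∈ N, B u) := measureReal_mono hsub (measure_ne_top _ _)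
    _ ≤ N.card * (2 * Real.exp (-3 * r)) := measureReal_biUnion_finset_le_card_mul N B hB
    _ ≤ (5 ^ Fintype.card κ : ℕ) * (2 * Real.exp (-3 * r)) := by gcongr
    _ = 2 * ((5 : ℝ) ^ Fintype.card κ * Real.exp (-3 * r)) := by push_cast; ring
    _ ≤ 2 * Real.exp (-r) := by gcongr; exact five_pow_mul_exp_le hκ

end Covariance

section Transpose

variable {Ω ι κ 𝓧 : Type*} [MeasurableSpace Ω] {μ : Measure Ω} [MeasurableSpace 𝓧]
  {X : ι → κ → Ω → 𝓧}

lemma iIndepFun_curry (mX : ∀ i j, Measurable (X i j))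
    (h : iIndepFun (fun (p : ι × κ) ω => X p.1 p.2 ω) μ) :
    iIndepFun (fun i ω j => X i j ω) μ := by
  have := h.isProbabilityMeasure
  have : ∀ i j, IsProbabilityMeasure (μ.map (X i j)) :=
    fun i j => Measure.isProbabilityMeasure_map (mX i j).aemeasurable
  have hsigma : iIndepFun (fun (p : (_ : ι) × κ) ω => X p.1 p.2 ω) μ :=
    h.precomp (Equiv.sigmaEquivProd ι κ).injective
  have hrow : ∀ i, iIndepFun (X i) μ := fun i =>
    h.precomp (g := fun j => (i, j)) fun j j' hj => by simpa using hj
  rw [iIndepFun_iff_map_fun_eq_infinitePi_map (by fun_prop)]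
  have hcurry : (fun ω i j => X i j ω) =
      (MeasurableEquiv.piCurry (fun (_ : ι) (_ : κ) => 𝓧)) ∘
        (fun ω (p : (_ : ι) × κ) => X p.1 p.2 ω) := rfl
  rw [hcurry, ← Measure.map_map (by fun_prop) (by fun_prop),
    (iIndepFun_iff_map_fun_eq_infinitePi_map (by fun_prop)).1 hsigma,
    Measure.infinitePi_map_piCurry (fun i j => μ.map (X i j))]
  congrm Measure.infinitePi fun i => ?_
  rw [(iIndepFun_iff_map_fun_eq_infinitePi_map (by fun_prop)).1 (hrow i)]

lemma iIndepFun_transpose (mX : ∀ i j, Measurable (X i j))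
    (h1 : iIndepFun (fun i ω j => X i j ω) μ) (h2 : ∀ i, iIndepFun (X i) μ) :
    iIndepFun (fun j ω i => X i j ω) μ :=
  iIndepFun_curry (X := fun j i => X i j) (fun j i => mX i j)
    ((iIndepFun_uncurry' mX h1 h2).precomp (Equiv.prodComm κ ι).injective)

end Transpose

/-! ### Random mixtures of exponentials -/

section Mixture

variable {Ω ι α β : Type*} [MeasurableSpace Ω] [MeasurableSpace α] [MeasurableSpace β]
  {μ : Measure Ω}

lemma two_pow_le_ofReal_exp (n : ℕ) : (2 : ℝ≥0∞) ^ n ≤ ENNReal.ofReal (Real.exp n) := by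
  calc (2 : ℝ≥0∞) ^ n ≤ ENNReal.ofReal (Real.exp 1) ^ n := by
        gcongr
        rw [← ENNReal.ofReal_ofNat]
        exact ENNReal.ofReal_le_ofReal (by linarith [Real.add_one_le_exp 1])
    _ = ENNReal.ofReal (Real.exp n) := by
        rw [← ENNReal.ofReal_pow (Real.exp_pos _).le, ← Real.exp_nat_mul, mul_one]

lemma measureReal_ofReal_exp_lt_le [IsFiniteMeasure μ] {Φ : Ω → ℝ≥0∞} (hΦ : AEMeasurable Φ μ)
    {A B : ℝ} (h : ∫⁻ ω, Φ ω ∂μ ≤ ENNReal.ofReal (Real.exp A)) :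
    μ.real {ω | ENNReal.ofReal (Real.exp B) < Φ ω} ≤ Real.exp (A - B) := by
  have hmarkov : ENNReal.ofReal (Real.exp B) * μ {ω | ENNReal.ofReal (Real.exp B) < Φ ω} ≤
      ENNReal.ofReal (Real.exp A) :=
    calc _ ≤ ENNReal.ofReal (Real.exp B) * μ {ω | ENNReal.ofReal (Real.exp B) ≤ Φ ω} :=
          mul_le_mul' le_rfl (measure_mono fun ω (hω : _ < Φ ω) => hω.le)
      _ ≤ ∫⁻ ω, Φ ω ∂μ := mul_meas_ge_le_lintegral₀ hΦ _
      _ ≤ _ := h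
  have hreal := ENNReal.toReal_mono ENNReal.ofReal_ne_top hmarkov
  rw [ENNReal.toReal_mul, ENNReal.toReal_ofReal (Real.exp_pos _).le,
    ENNReal.toReal_ofReal (Real.exp_pos _).le] at hreal
  rwa [Real.exp_sub, le_div_iff₀' (Real.exp_pos _)]

lemma lintegral_exp_sum_sq_div_le {m : Type*} [Fintype m] {Y : m → Ω → ℝ} {v : ℝ}
    (hindep : iIndepFun Y μ) (hY : ∀ a, Measurable (Y a)) (h : ∀ a, HasPsi2Bound μ (Y a) v) :
    ∫⁻ ω, ENNReal.ofReal (Real.exp ((∑ a, Y a ω ^ 2) / v)) ∂μ ≤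
      ENNReal.ofReal (Real.exp (Fintype.card m)) := by
  have hprod : ∀ ω, ENNReal.ofReal (Real.exp ((∑ a, Y a ω ^ 2) / v)) =
      ∏ a, ENNReal.ofReal (Real.exp (Y a ω ^ 2 / v)) := fun ω => by
    rw [Finset.sum_div, Real.exp_sum, ENNReal.ofReal_prod_of_nonneg fun a _ => (Real.exp_pos _).le]
  calc ∫⁻ ω, ENNReal.ofReal (Real.exp ((∑ a, Y a ω ^ 2) / v)) ∂μ
      = ∏ a, ∫⁻ ω, ENNReal.ofReal (Real.exp (Y a ω ^ 2 / v)) ∂μ := by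
        simp_rw [hprod]
        exact lintegral_prod_eq_prod_lintegral_of_indepFun _ _
          (hindep.comp (fun _ y => ENNReal.ofReal (Real.exp (y ^ 2 / v))) fun _ => by fun_prop)
          fun a => by fun_prop
    _ ≤ ∏ _a : m, (2 : ℝ≥0∞) := Finset.prod_le_prod' fun a _ => h a
    _ = 2 ^ Fintype.card m := by rw [Finset.prod_const, Finset.card_univ]
    _ ≤ _ := two_pow_le_ofReal_exp _

lemma measureReal_two_mul_card_mul_lt_sum_sq_le [IsFiniteMeasure μ] {m : Type*} [Fintype m]
    {Y : m → Ω → ℝ} {v : ℝ} (hindep : iIndepFun Y μ) (hY : ∀ a, Measurable (Y a)) (hv : 0 < v)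
    (h : ∀ a, HasPsi2Bound μ (Y a) v) :
    μ.real {ω | 2 * Fintype.card m * v < ∑ a, Y a ω ^ 2} ≤ Real.exp (-Fintype.card m) := by
  convert measureReal_ofReal_exp_lt_le (B := 2 * Fintype.card m) (by fun_prop)
    (lintegral_exp_sum_sq_div_le hindep hY h) using 2
  · ext ω
    rw [Set.mem_ofPred_eq, Set.mem_ofPred_eq, ENNReal.ofReal_lt_ofReal_iff (Real.exp_pos _),
      Real.exp_lt_exp, lt_div_iff₀ hv]
  · ring

lemma HasPsi2Bound.of_tendsto {u : Filter ι} [u.IsCountablyGenerated] [u.NeBot] {Z : ι → Ω → ℝ}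
    {Y : Ω → ℝ} {v : ℝ} (hZ : ∀ i, Measurable (Z i)) (h : ∀ i, HasPsi2Bound μ (Z i) v)
    (hlim : ∀ ω, Filter.Tendsto (fun i => Z i ω) u (nhds (Y ω))) : HasPsi2Bound μ Y v := by
  have hexp : ∀ ω, Filter.liminf (fun i => ENNReal.ofReal (Real.exp (Z i ω ^ 2 / v))) u =
      ENNReal.ofReal (Real.exp (Y ω ^ 2 / v)) := fun ω =>
    (ENNReal.tendsto_ofReal ((Real.continuous_exp.tendsto _).comp
      (((hlim ω).pow 2).div_const v))).liminf_eq
  unfold HasPsi2Bound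
  simp_rw [← hexp]
  exact (lintegral_liminf_le fun i => by fun_prop).trans
    (Filter.liminf_le_of_frequently_le' (Filter.Frequently.of_forall h))

/-- From `F ≤ T + exp (F - T)`. -/
lemma tsum_mul_ofReal_le_of_tsum_mul_exp_le {q : ι → ℝ≥0∞} {F : ι → ℝ} {T : ℝ} (hT : 0 ≤ T)
    (h : ∑' i, q i * ENNReal.ofReal (Real.exp (F i)) ≤
      (∑' i, q i) * ENNReal.ofReal (Real.exp T)) :
    ∑' i, q i * ENNReal.ofReal (F i) ≤ (∑' i, q i) * ENNReal.ofReal (T + 1) := by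
  have hterm : ∀ i, q i * ENNReal.ofReal (F i) ≤ q i * ENNReal.ofReal T +
      ENNReal.ofReal (Real.exp (-T)) * (q i * ENNReal.ofReal (Real.exp (F i))) := fun i => by
    rw [mul_left_comm, ← mul_add, ← ENNReal.ofReal_mul (Real.exp_pos _).le, ← Real.exp_add,
      ← ENNReal.ofReal_add hT (Real.exp_pos _).le]
    gcongr
    linarith [Real.add_one_le_exp (-T + F i)]
  calc ∑' i, q i * ENNReal.ofReal (F i)
      ≤ ∑' i, (q i * ENNReal.ofReal T +
          ENNReal.ofReal (Real.exp (-T)) * (q i * ENNReal.ofReal (Real.exp (F i)))) :=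
        ENNReal.tsum_le_tsum hterm
    _ = (∑' i, q i) * ENNReal.ofReal T + ENNReal.ofReal (Real.exp (-T)) *
          ∑' i, q i * ENNReal.ofReal (Real.exp (F i)) := by
        rw [ENNReal.tsum_add, ENNReal.tsum_mul_right, ENNReal.tsum_mul_left]
    _ ≤ (∑' i, q i) * ENNReal.ofReal T + ENNReal.ofReal (Real.exp (-T)) *
          ((∑' i, q i) * ENNReal.ofReal (Real.exp T)) := by
        gcongr
    _ = (∑' i, q i) * ENNReal.ofReal (T + 1) := by
        rw [mul_left_comm, ← mul_add, ← ENNReal.ofReal_mul (Real.exp_pos _).le, ← Real.exp_add,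
          neg_add_cancel, Real.exp_zero, ← ENNReal.ofReal_add hT zero_le_one]

lemma ofReal_exp_lt_tsum_div_mul {q : ι → ℝ≥0∞} {F : ι → ℝ} {T : ℝ} (hT : 0 ≤ T)
    (h : (∑' i, q i) * ENNReal.ofReal (T + 1) < ∑' i, q i * ENNReal.ofReal (F i)) :
    ENNReal.ofReal (Real.exp T) <
      ∑' i, q i / (∑' j, q j) * ENNReal.ofReal (Real.exp (F i)) := by
  have hexp := not_le.1 (mt (tsum_mul_ofReal_le_of_tsum_mul_exp_le hT) h.not_ge)
  have htop : ∑' i, q i ≠ ∞ := fun htop => by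
    rw [htop, ENNReal.top_mul (by positivity)] at hexp
    exact not_top_lt hexp
  have hdiv : ∀ i, q i / (∑' j, q j) * ENNReal.ofReal (Real.exp (F i)) =
      q i * ENNReal.ofReal (Real.exp (F i)) / ∑' j, q j := fun i => ENNReal.mul_div_right_comm.symm
  simp_rw [hdiv, div_eq_mul_inv]
  rw [ENNReal.tsum_mul_right, ← div_eq_mul_inv]
  refine (ENNReal.lt_div_iff_mul_lt (Or.inr ENNReal.ofReal_ne_top) (Or.inl htop)).2 ?_
  rwa [mul_comm]

lemma lintegral_tsum_mul_le_of_indepFun [IsProbabilityMeasure μ] [Countable ι] {V : Ω → α}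
    {e : Ω → β} (hV : Measurable V) (he : Measurable e) (hVe : IndepFun V e μ)
    {p : ι → α → ℝ≥0∞} (hp : ∀ i, Measurable (p i)) (hp1 : ∀ u, ∑' i, p i u ≤ 1)
    {G : ι → α → β → ℝ≥0∞} (hG : ∀ i, Measurable (Function.uncurry (G i))) {B : ℝ≥0∞}
    (h : ∀ i u, ∫⁻ ω, G i u (e ω) ∂μ ≤ B) :
    ∫⁻ ω, ∑' i, p i (V ω) * G i (V ω) (e ω) ∂μ ≤ B := by
  have hΦ : Measurable fun z : α × β => ∑' i, p i z.1 * G i z.1 z.2 :=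
    .tsum fun i => ((hp i).comp measurable_fst).mul (hG i)
  have hGu : ∀ i u, Measurable (G i u) := fun i u => (hG i).comp measurable_prodMk_left
  have := Measure.isProbabilityMeasure_map (μ := μ) hV.aemeasurable
  have := Measure.isProbabilityMeasure_map (μ := μ) he.aemeasurable
  calc ∫⁻ ω, ∑' i, p i (V ω) * G i (V ω) (e ω) ∂μ
      = ∫⁻ u, ∫⁻ y, ∑' i, p i u * G i u y ∂(μ.map e) ∂(μ.map V) := by
        rw [← lintegral_prod _ hΦ.aemeasurable,
          ← (indepFun_iff_map_prod_eq_prod_map_map hV.aemeasurable he.aemeasurable).1 hVe,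
          lintegral_map hΦ (hV.prodMk he)]
    _ ≤ ∫⁻ _, B ∂(μ.map V) := lintegral_mono fun u => by
        change ∫⁻ y, ∑' i, p i u * G i u y ∂(μ.map e) ≤ B
        rw [lintegral_tsum fun i => ((hGu i u).const_mul _).aemeasurable]
        calc _ ≤ ∑' i, p i u * B := ENNReal.tsum_le_tsum fun i => by
              rw [lintegral_const_mul _ (hGu i u), lintegral_map (hGu i u) he]
              gcongr
              exact h i u
          _ ≤ 1 * B := by rw [ENNReal.tsum_mul_right]; gcongr; exact hp1 u
          _ = B := one_mul B
    _ = B := by simp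

/-- Each exponential moment is controlled conditionally on the weights; convexity of `exp` then
controls the weighted average of the exponents by a single application of Markov's inequality. -/
lemma measureReal_tsum_mul_lt_le_of_indepFun [IsProbabilityMeasure μ] [Countable ι] {V : Ω → α}
    {e : Ω → β} (hV : Measurable V) (he : Measurable e) (hVe : IndepFun V e μ)
    {q : ι → α → ℝ≥0∞} (hq : ∀ i, Measurable (q i)) {F : ι → α → β → ℝ}
    (hF : ∀ i, Measurable (Function.uncurry (F i))) {A T : ℝ} (hT : 0 ≤ T)
    (h : ∀ i u, ∫⁻ ω, ENNReal.ofReal (Real.exp (F i u (e ω))) ∂μ ≤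
      ENNReal.ofReal (Real.exp A)) :
    μ.real {ω | (∑' i, q i (V ω)) * ENNReal.ofReal (T + 1) <
      ∑' i, q i (V ω) * ENNReal.ofReal (F i (V ω) (e ω))} ≤ Real.exp (A - T) := by
  have hp : ∀ i, Measurable fun u => q i u / ∑' j, q j u := fun i => by fun_prop
  have hE : ∀ i, Measurable (Function.uncurry fun u y => ENNReal.ofReal (Real.exp (F i u y))) :=
    fun i => ENNReal.measurable_ofReal.comp (Real.measurable_exp.comp (hF i))
  have hmean := lintegral_tsum_mul_le_of_indepFun hV he hVe hp
    (fun u => by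
      simp_rw [div_eq_mul_inv]
      rw [ENNReal.tsum_mul_right]
      exact ENNReal.mul_inv_le_one _) hE h
  refine (measureReal_mono (fun ω hω => ?_) (measure_ne_top _ _)).trans
    (measureReal_ofReal_exp_lt_le (B := T) (Measurable.tsum fun i =>
      ((hp i).comp hV).mul ((hE i).comp (hV.prodMk he))).aemeasurable hmean)
  exact ofReal_exp_lt_tsum_div_mul hT hω

lemma measureReal_tsum_mul_lt_le [IsProbabilityMeasure μ] [Countable ι] (q : ι → ℝ≥0∞)
    {F : ι → Ω → ℝ} (hF : ∀ i, Measurable (F i)) {A T : ℝ} (hT : 0 ≤ T)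
    (h : ∀ i, ∫⁻ ω, ENNReal.ofReal (Real.exp (F i ω)) ∂μ ≤ ENNReal.ofReal (Real.exp A)) :
    μ.real {ω | (∑' i, q i) * ENNReal.ofReal (T + 1) <
      ∑' i, q i * ENNReal.ofReal (F i ω)} ≤ Real.exp (A - T) :=
  measureReal_tsum_mul_lt_le_of_indepFun (V := fun _ => ()) (e := id) measurable_const
    measurable_id (indepFun_const_left _ _) (q := fun i _ => q i) (fun _ => measurable_const)
    (F := fun i _ => F i) (fun i => (hF i).comp measurable_snd) hT fun i _ => h i

end Mixture

/-! ### Sub-gaussian norms of the rows and of the noise -/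

section Psi2Norm

variable {Ω ι : Type*} [MeasurableSpace Ω] {μ : Measure Ω}

lemma HasPsi2Bound.of_psi2Norm_lt {Z : Ω → ℝ} {τ : ℝ} (h : psi2Norm μ Z < ENNReal.ofReal τ) :
    HasPsi2Bound μ Z (τ ^ 2) := by
  obtain ⟨_, ⟨t, ht, rfl, hle⟩, hlt⟩ := sInf_lt_iff.1 h
  have htτ : t < τ := (ENNReal.ofReal_lt_ofReal_iff_of_nonneg ht.le).1 hlt
  exact mono (v := t ^ 2) hle (by positivity) (by gcongr)

lemma HasPsi2Bound.of_psi2Norm_le {Z : Ω → ℝ} {σ : ℝ} (hσ : 0 < σ)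
    (h : psi2Norm μ Z ≤ ENNReal.ofReal σ) : HasPsi2Bound μ Z (4 * σ ^ 2) := by
  have := of_psi2Norm_lt (τ := 2 * σ)
    (h.trans_lt ((ENNReal.ofReal_lt_ofReal_iff (by positivity)).2 (by linarith)))
  rwa [mul_pow, show (2 : ℝ) ^ 2 = 4 by norm_num] at this

lemma ae_eq_zero_of_psi2Norm_eq_zero [IsProbabilityMeasure μ] {Z : Ω → ℝ} (hZ : Measurable Z)
    (h : psi2Norm μ Z = 0) : Z =ᵐ[μ] 0 := by
  have hbound : ∀ τ : ℝ, 0 < τ → HasPsi2Bound μ Z τ := fun τ hτ => by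
    have := HasPsi2Bound.of_psi2Norm_lt (μ := μ) (Z := Z) (τ := √τ) (by simpa [h] using hτ)
    rwa [Real.sq_sqrt hτ.le] at this
  have hle : ∀ τ : ℝ, 0 < τ → ∫ ω, Z ω ^ 2 ∂μ ≤ τ * 2 := fun τ hτ =>
    (hbound τ hτ).integral_le_of_le hZ (by fun_prop) hτ.le fun ω => by
      rw [abs_of_nonneg (sq_nonneg _)]; exact sq_le_mul_exp_sq_div hτ _
  have hzero : ∫ ω, Z ω ^ 2 ∂μ = 0 :=
    le_antisymm (le_of_forall_pos_le_add fun τ hτ => by linarith [hle (τ / 2) (by positivity)])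
      (integral_nonneg fun ω => sq_nonneg _)
  rw [integral_eq_zero_iff_of_nonneg (fun ω => sq_nonneg _)
    ((hbound 1 one_pos).integrable_sq one_pos hZ)] at hzero
  filter_upwards [hzero] with ω hω
  exact pow_eq_zero_iff (two_ne_zero) |>.1 hω

lemma HasPsi2Bound.finsuppSum_of_psi2NormVec_le {Z : Ω → ι → ℝ} {σ : ℝ} (hσ : 0 < σ)
    (h : psi2NormVec μ Z ≤ ENNReal.ofReal σ) {d : ι →₀ ℝ} (hd : 0 < d.sum fun _ c => c ^ 2) :
    HasPsi2Bound μ (fun ω => d.sum fun i c => c * Z ω i) (4 * σ ^ 2 * d.sum fun _ c => c ^ 2) := by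
  have hd0 : d ≠ 0 := by
    rintro rfl
    simp at hd
  have hnorm : HasPsi2Bound μ
      (fun ω => (d.sum fun i c => c * Z ω i) / √(d.sum fun _ c => c ^ 2)) (4 * σ ^ 2) :=
    of_psi2Norm_le hσ ((le_iSup₂ (f := fun (s : ι →₀ ℝ) (_ : s ≠ 0) => psi2Norm μ fun ω =>
      (s.sum fun i c => c * Z ω i) / √(s.sum fun _ c => c ^ 2)) d hd0).trans h)
  unfold HasPsi2Bound at hnorm ⊢
  simpa only [div_pow, Real.sq_sqrt hd.le, div_div, mul_comm] using hnorm

lemma HasPsi2Bound.sum_of_psi2NormVec_le [IsProbabilityMeasure μ] {Z : Ω → ι → ℝ} {σ : ℝ}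
    (hσ : 0 < σ) (h : psi2NormVec μ Z ≤ ENNReal.ofReal σ) {s : Finset ι} {d : ι → ℝ} {Q : ℝ}
    (hQ : ∑ i ∈ s, d i ^ 2 ≤ Q) :
    HasPsi2Bound μ (fun ω => ∑ i ∈ s, d i * Z ω i) (4 * σ ^ 2 * Q) := by
  classical
  rcases (Finset.sum_nonneg fun i (_ : i ∈ s) => sq_nonneg (d i)).eq_or_lt' with h0 | hpos
  · have hd : ∀ i ∈ s, d i = 0 := fun i hi =>
      pow_eq_zero_iff two_ne_zero |>.1
        ((Finset.sum_eq_zero_iff_of_nonneg fun i _ => sq_nonneg (d i)).1 h0 i hi)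
    have hsum : ∀ ω, ∑ i ∈ s, d i * Z ω i = 0 := fun ω =>
      Finset.sum_eq_zero fun i hi => by rw [hd i hi, zero_mul]
    simpa only [hsum] using zero
  · have hsq : ((Finsupp.indicator s fun i _ => d i).sum fun _ c => c ^ 2) = ∑ i ∈ s, d i ^ 2 :=
      Finsupp.sum_indicator_index _ fun i _ => by simp
    have hlin : ∀ ω, ((Finsupp.indicator s fun i _ => d i).sum fun i c => c * Z ω i) =
        ∑ i ∈ s, d i * Z ω i := fun ω => Finsupp.sum_indicator_index _ fun i _ => by simp
    have := finsuppSum_of_psi2NormVec_le hσ h (hsq ▸ hpos)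
    simp only [hsq, hlin] at this
    exact this.mono (by positivity) (by gcongr)

end Psi2Norm

section Whitening

variable {ι : Type*} {lam : ι → ℝ}

lemma sum_sqrt_mul_mul_div_sqrt (hlam : ∀ i, 0 < lam i) (s : Finset ι) (w x : ι → ℝ) :
    ∑ j : s, √(lam j) * w j * (x j / √(lam j)) = ∑ i ∈ s, w i * x i := by
  rw [← Finset.sum_coe_sort s]
  refine Finset.sum_congr rfl fun j _ => ?_
  have := (Real.sqrt_pos.2 (hlam j)).ne'
  field_simp

lemma sum_sqrt_mul_sq (hlam : ∀ i, 0 < lam i) (s : Finset ι) (w : ι → ℝ) :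
    ∑ j : s, (√(lam j) * w j) ^ 2 = ∑ i ∈ s, lam i * w i ^ 2 := by
  simp only [mul_pow, Real.sq_sqrt (hlam _).le]
  exact Finset.sum_coe_sort s fun i => lam i * w i ^ 2

lemma exists_eq_sqrt_mul (hlam : ∀ i, 0 < lam i) {s : Finset ι} (u : s → ℝ) :
    ∃ w : ι → ℝ, u = fun j : s => √(lam j) * w j := by
  classical
  refine ⟨fun i => if h : i ∈ s then u ⟨i, h⟩ / √(lam i) else 0, funext fun j => ?_⟩
  have := (Real.sqrt_pos.2 (hlam j)).ne'
  simp only [Finset.coe_mem, dite_true, Subtype.coe_eta]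
  field_simp

lemma sum_mul_div_sqrt_sq {m : Type*} [Fintype m] {l : ℝ} (hl : 0 < l) (w x : m → ℝ) :
    l * (∑ a, w a * (x a / √l)) ^ 2 = (∑ a, w a * x a) ^ 2 := by
  simp_rw [← mul_div_assoc, ← Finset.sum_div]
  rw [div_pow, Real.sq_sqrt hl.le]
  field_simp

end Whitening

section Tail

variable {ι : Type*} [DecidableEq ι]

lemma hasSum_ite_mem_zero {f : ι → ℝ} {S : ℝ} (hf : HasSum f S) (s : Finset ι) :
    HasSum (fun i => if i ∈ s then 0 else f i) (S - ∑ i ∈ s, f i) := by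
  have hhead : HasSum (fun i => if i ∈ s then f i else 0) (∑ i ∈ s, f i) := by
    have := hasSum_sum_of_ne_finset_zero (f := fun i => if i ∈ s then f i else 0) (s := s)
      (L := SummationFilter.unconditional ι) (by simp +contextual)
    rwa [Finset.sum_congr rfl fun i hi => if_pos hi] at this
  refine (hf.sub hhead).congr_fun fun i => ?_
  split_ifs <;> simp

lemma hasSum_tail_inner (s : Finset ι) (x θ : FeatureSpace ι) :
    HasSum (fun i => (if i ∈ s then 0 else θ i) * x i) (inner ℝ x θ - ∑ i ∈ s, x i * θ i) := by
  have hall : HasSum (fun i => x i * θ i) (inner ℝ x θ) := by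
    simpa [mul_comm] using lp.hasSum_inner (𝕜 := ℝ) x θ
  refine (hasSum_ite_mem_zero hall s).congr_fun fun i => ?_
  split_ifs <;> ring

end Tail

namespace RidgeModel

section Rows

variable {Ω ι : Type*} [MeasurableSpace Ω] {μ : Measure Ω} {n : ℕ}
  {lam : ι → ℝ} {σx σε : ℝ} {X : Fin n → Ω → FeatureSpace ι} {ε : Ω → Fin n → ℝ}

lemma measurable_sum_row (hM : RidgeModel μ n lam σx σε X ε) (a : Fin n) (s : Finset ι)
    (c : ι → ℝ) : Measurable fun ω => ∑ i ∈ s, c i * X a ω i :=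
  Finset.measurable_sum _ fun i _ => (hM.measurable_row a i).const_mul _

lemma integral_mul_coord [DecidableEq ι] (hM : RidgeModel μ n lam σx σε X ε) (a : Fin n)
    (i j : ι) : ∫ ω, X a ω i * X a ω j ∂μ = if i = j then lam i else 0 := by
  have hcov : covariance (fun ω => X a ω i) (fun ω => X a ω j) μ = ∫ ω, X a ω i * X a ω j ∂μ := by
    simp [covariance, hM.rows_centered]
  rw [← hcov]
  split_ifs with hij
  · rw [← hij, hM.rows_cov]
  · exact hM.rows_cov_offDiag a i j hij

variable [IsProbabilityMeasure μ]

lemma hasPsi2Bound_row (hM : RidgeModel μ n lam σx σε X ε) (hlam : ∀ i, 0 < lam i) (hσx : 0 < σx)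
    (a : Fin n) {s : Finset ι} {c : ι → ℝ} {Q : ℝ} (hQ : ∑ i ∈ s, lam i * c i ^ 2 ≤ Q) :
    HasPsi2Bound μ (fun ω => ∑ i ∈ s, c i * X a ω i) (4 * σx ^ 2 * Q) := by
  have := HasPsi2Bound.sum_of_psi2NormVec_le hσx (hM.rows_subgaussian a) (s := s)
    (d := fun i => √(lam i) * c i) (Q := Q)
    (by simpa only [mul_pow, Real.sq_sqrt (hlam _).le] using hQ)
  convert this using 3 with ω i
  have := (Real.sqrt_pos.2 (hlam i)).ne'
  field_simp

lemma hasPsi2Bound_coord (hM : RidgeModel μ n lam σx σε X ε) (hσx : 0 < σx) (a : Fin n) (i : ι) :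
    HasPsi2Bound μ (fun ω => X a ω i / √(lam i)) (4 * σx ^ 2) := by
  have := HasPsi2Bound.sum_of_psi2NormVec_le hσx (hM.rows_subgaussian a) (s := {i})
    (d := fun _ => 1) (Q := 1) (by simp)
  simpa using this

lemma memLp_coord (hM : RidgeModel μ n lam σx σε X ε) (hlam : ∀ i, 0 < lam i) (hσx : 0 < σx)
    (a : Fin n) (i : ι) : MemLp (fun ω => X a ω i) 2 μ := by
  have := hM.hasPsi2Bound_row hlam hσx a (s := {i}) (c := fun _ => 1) (Q := lam i) (by simp)
  simp only [Finset.sum_singleton, one_mul] at this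
  exact this.memLp_two (by have := hlam i; positivity) (hM.measurable_row a i)

lemma integral_sum_row_sq (hM : RidgeModel μ n lam σx σε X ε) (hlam : ∀ i, 0 < lam i)
    (hσx : 0 < σx) (a : Fin n) (s : Finset ι) (c : ι → ℝ) :
    ∫ ω, (∑ i ∈ s, c i * X a ω i) ^ 2 ∂μ = ∑ i ∈ s, lam i * c i ^ 2 := by
  classical
  have hinteg : ∀ i j, Integrable (fun ω => X a ω i * X a ω j) μ := fun i j =>
    (hM.memLp_coord hlam hσx a i).integrable_mul (hM.memLp_coord hlam hσx a j)
  have hexp : ∀ ω, (∑ i ∈ s, c i * X a ω i) ^ 2 =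
      ∑ i ∈ s, ∑ j ∈ s, (c i * c j) * (X a ω i * X a ω j) := fun ω => by
    rw [sq, Finset.sum_mul_sum]
    exact Finset.sum_congr rfl fun i _ => Finset.sum_congr rfl fun j _ => by ring
  simp_rw [hexp]
  rw [integral_finsetSum _ fun i _ => integrable_finsetSum _ fun j _ => (hinteg i j).const_mul _]
  refine Finset.sum_congr rfl fun i hi => ?_
  rw [integral_finsetSum _ fun j _ => (hinteg i j).const_mul _]
  simp_rw [integral_const_mul, hM.integral_mul_coord]
  simp [hi]; ring

lemma measureReal_head_le (hM : RidgeModel μ n lam σx σε X ε) (hlam : ∀ i, 0 < lam i)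
    (hσx : 0 < σx) (s : Finset ι) {r : ℝ} (hs : (s.card : ℝ) ≤ r) (hr : r ≤ n) :
    μ.real {ω | ∃ w : ι → ℝ, 448 * (4 * σx ^ 2) * √(n * r) * ∑ i ∈ s, lam i * w i ^ 2 <
        |∑ a, (∑ i ∈ s, w i * X a ω i) ^ 2 - n * ∑ i ∈ s, lam i * w i ^ 2|} ≤
      2 * Real.exp (-r) := by
  have hunif := measureReal_exists_abs_sum_sq_sub_gt_le (μ := μ) (m := Fin n) (κ := s)
    (Y := fun a ω j => X a ω j / √(lam j)) (v := 4 * σx ^ 2) (r := r)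
    (hM.rows_indep.comp (fun _ y (j : s) => y j / √(lam j)) fun _ => by fun_prop)
    (fun a => measurable_pi_lambda _ fun j => (hM.measurable_row a j).div_const _)
    (by positivity) (fun a u hu => ?_) (fun a u hu => ?_) (by simpa using hs) (by simpa using hr)
  · refine le_trans (measureReal_mono ?_ (measure_ne_top _ _)) hunif
    rintro ω ⟨w, hw⟩
    refine ⟨fun j => √(lam j) * w j, ?_⟩
    simpa only [sum_sqrt_mul_mul_div_sqrt hlam, sum_sqrt_mul_sq hlam, Fintype.card_fin] using hw
  · obtain ⟨w, rfl⟩ := exists_eq_sqrt_mul hlam u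
    rw [sum_sqrt_mul_sq hlam] at hu
    simp_rw [sum_sqrt_mul_mul_div_sqrt hlam]
    simpa only [mul_one] using hM.hasPsi2Bound_row hlam hσx a hu.le
  · obtain ⟨w, rfl⟩ := exists_eq_sqrt_mul hlam u
    simp_rw [sum_sqrt_mul_mul_div_sqrt hlam]
    rw [hM.integral_sum_row_sq hlam hσx a s w, ← sum_sqrt_mul_sq hlam, hu]

lemma lintegral_exp_sum_row_sq_le (hM : RidgeModel μ n lam σx σε X ε) (hlam : ∀ i, 0 < lam i)
    (hσx : 0 < σx) {s : Finset ι} {c : ι → ℝ} {Q : ℝ} (hQ : ∑ i ∈ s, lam i * c i ^ 2 ≤ Q) :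
    ∫⁻ ω, ENNReal.ofReal (Real.exp ((∑ a, (∑ i ∈ s, c i * X a ω i) ^ 2) / (4 * σx ^ 2 * Q))) ∂μ ≤
      ENNReal.ofReal (Real.exp n) := by
  simpa using lintegral_exp_sum_sq_div_le
    (hM.rows_indep.comp (fun _ y => ∑ i ∈ s, c i * y i) fun _ => by fun_prop)
    (fun a => hM.measurable_sum_row a s c) fun a => hM.hasPsi2Bound_row hlam hσx a hQ

lemma measureReal_lt_sum_hasSum_sq_le [Countable ι] (hM : RidgeModel μ n lam σx σε X ε)
    (hlam : ∀ i, 0 < lam i) (hσx : 0 < σx) {c : ι → ℝ} (hsum : Summable fun i => lam i * c i ^ 2)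
    {R : Fin n → Ω → ℝ} (hR : ∀ a ω, HasSum (fun i => c i * X a ω i) (R a ω)) :
    μ.real {ω | 2 * n * (4 * σx ^ 2 * ∑' i, lam i * c i ^ 2) < ∑ a, R a ω ^ 2} ≤
      Real.exp (-n) := by
  have hterm : ∀ i, 0 ≤ lam i * c i ^ 2 := fun i => mul_nonneg (hlam i).le (sq_nonneg _)
  rcases (tsum_nonneg hterm).eq_or_lt' with h0 | hpos
  · have hc : ∀ i, c i = 0 := fun i => by
      have := congrFun ((hasSum_zero_iff_of_nonneg hterm).1 (h0 ▸ hsum.hasSum)) i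
      simpa [(hlam i).ne'] using this
    have hR0 : ∀ a ω, R a ω = 0 := fun a ω => (hR a ω).unique (by simp [hc])
    simp [h0, hR0, Real.exp_nonneg]
  · have hRtsum : ∀ a, R a = fun ω => ∑' i, c i * X a ω i := fun a =>
      funext fun ω => (hR a ω).tsum_eq.symm
    have hindep : iIndepFun R μ := by
      have hg : Measurable fun y : ι → ℝ => ∑' i, c i * y i := by fun_prop
      rw [funext hRtsum]
      exact hM.rows_indep.comp (fun _ y => ∑' i, c i * y i) fun _ => hg
    have hmeas : ∀ a, Measurable (R a) := fun a => by
      rw [hRtsum a]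
      exact .tsum fun i => (hM.measurable_row a i).const_mul _
    have hpsi : ∀ a, HasPsi2Bound μ (R a) (4 * σx ^ 2 * ∑' i, lam i * c i ^ 2) := fun a =>
      .of_tendsto (fun s => hM.measurable_sum_row a s c)
        (fun s => hM.hasPsi2Bound_row hlam hσx a (hsum.sum_le_tsum s fun i _ => hterm i))
        fun ω => hR a ω
    simpa using measureReal_two_mul_card_mul_lt_sum_sq_le hindep hmeas (by positivity) hpsi

lemma measureReal_tail_signal_le [Countable ι] [DecidableEq ι]
    (hM : RidgeModel μ n lam σx σε X ε) (hlam : ∀ i, 0 < lam i) (hσx : 0 < σx) (s : Finset ι)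
    (θ : FeatureSpace ι) (hsum : Summable fun i => if i ∈ s then 0 else lam i * θ i ^ 2) :
    μ.real {ω | 2 * n * (4 * σx ^ 2) * ∑' i, (if i ∈ s then 0 else lam i * θ i ^ 2) <
      ∑ a, (inner ℝ (X a ω) θ - ∑ i ∈ s, X a ω i * θ i) ^ 2} ≤ Real.exp (-n) := by
  have hcoef : ∀ i, (if i ∈ s then 0 else lam i * θ i ^ 2) =
      lam i * (if i ∈ s then 0 else θ i) ^ 2 := fun i => by
    split_ifs <;> simp
  simp_rw [hcoef] at hsum ⊢
  simpa only [mul_assoc] using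
    hM.measureReal_lt_sum_hasSum_sq_le hlam hσx hsum fun a ω => hasSum_tail_inner s (X a ω) θ

lemma measureReal_tail_trace_le [Countable ι] [DecidableEq ι]
    (hM : RidgeModel μ n lam σx σε X ε) (hlam : ∀ i, 0 < lam i) (hσx : 0 < σx) (hn : 0 < n)
    (s : Finset ι) (hsum : Summable fun i => if i ∈ s then 0 else lam i ^ 2) :
    μ.real {ω | ENNReal.ofReal (3 * n * (4 * σx ^ 2) * ∑' i, (if i ∈ s then 0 else lam i ^ 2)) <
      ∑' i, ENNReal.ofReal (if i ∈ s then 0 else lam i * ∑ a, X a ω i ^ 2)} ≤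
      Real.exp (-n) := by
  have hmix := measureReal_tsum_mul_lt_le (μ := μ) (A := n) (T := 2 * n)
    (fun i => ENNReal.ofReal (4 * σx ^ 2 * if i ∈ s then 0 else lam i ^ 2))
    (F := fun i ω => (∑ a, X a ω i ^ 2) / (4 * σx ^ 2 * lam i))
    (fun i => by have := fun a => hM.measurable_row a i; fun_prop) (by positivity)
    fun i => by
      simpa using hM.lintegral_exp_sum_row_sq_le hlam hσx (s := {i}) (c := fun _ => 1)
        (Q := lam i) (by simp)
  rw [show (n : ℝ) - 2 * n = -n by ring] at hmix
  refine le_trans (measureReal_mono (fun ω hω => ?_) (measure_ne_top _ _)) hmix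
  rw [Set.mem_ofPred_eq] at hω ⊢
  have hw : ∀ i, 0 ≤ 4 * σx ^ 2 * (if i ∈ s then 0 else lam i ^ 2) := fun i => by
    split_ifs <;> positivity
  calc _ = ENNReal.ofReal ((∑' i, 4 * σx ^ 2 * if i ∈ s then 0 else lam i ^ 2) *
        (2 * n + 1)) := by
        rw [← ENNReal.ofReal_tsum_of_nonneg hw (hsum.mul_left _),
          ← ENNReal.ofReal_mul (tsum_nonneg hw)]
    _ ≤ ENNReal.ofReal (3 * n * (4 * σx ^ 2) * ∑' i, (if i ∈ s then 0 else lam i ^ 2)) := by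
        have hn1 : (1 : ℝ) ≤ n := by exact_mod_cast hn
        refine ENNReal.ofReal_le_ofReal ?_
        have : 0 ≤ ∑' i, 4 * σx ^ 2 * (if i ∈ s then 0 else lam i ^ 2) := tsum_nonneg hw
        rw [tsum_mul_left] at this ⊢
        nlinarith
    _ < _ := hω
    _ = _ := tsum_congr fun i => by
        rw [← ENNReal.ofReal_mul (hw i)]
        have := (hlam i).ne'
        congr 1
        split_ifs
        · simp
        · field_simp

end Rows

section Noise

variable {Ω ι : Type*} [MeasurableSpace Ω] {μ : Measure Ω} {n : ℕ}
  {lam : ι → ℝ} {σx σε : ℝ} {X : Fin n → Ω → FeatureSpace ι} {ε : Ω → Fin n → ℝ}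

lemma indepFun_noise (hM : RidgeModel μ n lam σx σε X ε) {β : Type*} [MeasurableSpace β]
    {V : Ω → β}
    (hV : Measurable[MeasurableSpace.comap (fun ω (a : Fin n) i => X a ω i) inferInstance] V) :
    IndepFun V ε μ := by
  rw [IndepFun_iff_Indep]
  exact indep_of_indep_of_le_left ((IndepFun_iff_Indep _ _ _).1 hM.noise_indep_design)
    (measurable_iff_comap_le.1 hV)

lemma measurable_of_measurable_comap_design (hM : RidgeModel μ n lam σx σε X ε) {β : Type*}
    [MeasurableSpace β] {V : Ω → β}
    (hV : Measurable[MeasurableSpace.comap (fun ω (a : Fin n) i => X a ω i) inferInstance] V) :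
    Measurable V :=
  hV.mono (measurable_pi_lambda _ fun a => measurable_pi_lambda _ fun i =>
    hM.measurable_row a i).comap_le le_rfl

lemma measureReal_noise_le [Countable ι] [IsProbabilityMeasure μ]
    (hM : RidgeModel μ n lam σx σε X ε) (hσε : 0 < σε) {U : ι → Ω → Fin n → ℝ}
    (hU : ∀ i, Measurable[MeasurableSpace.comap (fun ω (a : Fin n) i => X a ω i) inferInstance]
      (U i)) {t : ℝ} (ht : 0 ≤ t) :
    μ.real {ω | ENNReal.ofReal (144 * σε ^ 2 * (t + 2)) *
        ∑' i, ENNReal.ofReal (lam i * ∑ a, U i ω a ^ 2) <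
      ∑' i, ENNReal.ofReal (lam i * (∑ a, U i ω a * ε ω a) ^ 2)} ≤ Real.exp (-t) := by
  have hV := (@measurable_pi_iff Ω ι _ (MeasurableSpace.comap _ _) _ fun ω i => U i ω).2 hU
  have hmix := measureReal_tsum_mul_lt_le_of_indepFun (A := 1) (T := t + 1)
    (hM.measurable_of_measurable_comap_design hV) (measurable_pi_iff.2 hM.measurable_noise)
    (hM.indepFun_noise hV)
    (q := fun i u => ENNReal.ofReal (144 * σε ^ 2) * ENNReal.ofReal (lam i * ∑ a, u i a ^ 2))
    (fun i => by fun_prop)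
    (F := fun i u e => (∑ a, u i a * e a) ^ 2 / (36 * (4 * σε ^ 2) * ∑ a, u i a ^ 2))
    (fun i => by unfold Function.uncurry; fun_prop) (by positivity)
    fun i u => le_trans (HasPsi2Bound.sum_of_iIndepFun hM.noise_indep hM.measurable_noise
      (by positivity) (fun a => .of_psi2Norm_le hσε (hM.noise_subgaussian a)) hM.noise_centered
      (u i)) (by simpa using two_pow_le_ofReal_exp 1)
  have hterm : ∀ i ω, ENNReal.ofReal (144 * σε ^ 2) * ENNReal.ofReal (lam i * ∑ a, U i ω a ^ 2) *
      ENNReal.ofReal ((∑ a, U i ω a * ε ω a) ^ 2 / (36 * (4 * σε ^ 2) * ∑ a, U i ω a ^ 2)) =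
      ENNReal.ofReal (lam i * (∑ a, U i ω a * ε ω a) ^ 2) := fun i ω => by
    rw [← ENNReal.ofReal_mul (by positivity), ← ENNReal.ofReal_mul' (by positivity)]
    congr 1
    by_cases hz : ∑ a, U i ω a ^ 2 = 0
    · have hU0 : ∀ a, U i ω a = 0 := fun a => pow_eq_zero_iff two_ne_zero |>.1
        ((Finset.sum_eq_zero_iff_of_nonneg fun a _ => sq_nonneg (U i ω a)).1 hz a
          (Finset.mem_univ a))
      simp [hU0]
    · field_simp
      ring
  simp_rw [hterm, ENNReal.tsum_mul_left] at hmix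
  convert hmix using 3
  · ext ω
    rw [ENNReal.ofReal_mul (by positivity), mul_right_comm, add_assoc t, one_add_one_eq_two]
  · ring

end Noise

end RidgeModel

/-! ### The Gram matrix of the tail coordinates -/

section SecondMoment

variable {Ω : Type*} [MeasurableSpace Ω] {μ : Measure Ω}

lemma integral_sum_mul_sq_of_iIndepFun {m : Type*} [Fintype m] {Y : m → Ω → ℝ}
    (hindep : iIndepFun Y μ) (hY : ∀ a, MemLp (Y a) 2 μ) (h0 : ∀ a, ∫ ω, Y a ω ∂μ = 0)
    (h1 : ∀ a, ∫ ω, Y a ω ^ 2 ∂μ = 1) (u : m → ℝ) :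
    ∫ ω, (∑ a, u a * Y a ω) ^ 2 ∂μ = ∑ a, u a ^ 2 := by
  classical
  have hinteg : ∀ i j, Integrable (fun ω => Y i ω * Y j ω) μ := fun i j =>
    (hY i).integrable_mul (hY j)
  have hmul : ∀ i j, ∫ ω, Y i ω * Y j ω ∂μ = if i = j then 1 else 0 := fun i j => by
    split_ifs with hij
    · subst hij
      simp_rw [← sq]
      exact h1 i
    · rw [(hindep.indepFun hij).integral_fun_mul_eq_mul_integral (hY i).1 (hY j).1, h0, zero_mul]
  have hexp : ∀ ω, (∑ i, u i * Y i ω) ^ 2 = ∑ i, ∑ j, (u i * u j) * (Y i ω * Y j ω) := fun ω => by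
    rw [sq, Finset.sum_mul_sum]
    exact Finset.sum_congr rfl fun i _ => Finset.sum_congr rfl fun j _ => by ring
  simp_rw [hexp]
  rw [integral_finsetSum _ fun i _ => integrable_finsetSum _ fun j _ => (hinteg i j).const_mul _]
  refine Finset.sum_congr rfl fun i _ => ?_
  rw [integral_finsetSum _ fun j _ => (hinteg i j).const_mul _]
  simp_rw [integral_const_mul, hmul]
  simp [sq]

end SecondMoment

section Transpose

variable {m κ : Type*} [Fintype m] [Fintype κ]

lemma sum_sq_transpose_le {y : m → κ → ℝ} {M : ℝ} (hM : 0 ≤ M)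
    (h : ∀ v : κ → ℝ, ∑ a, (∑ j, v j * y a j) ^ 2 ≤ M * ∑ j, v j ^ 2) (w : m → ℝ) :
    ∑ j, (∑ a, w a * y a j) ^ 2 ≤ M * ∑ a, w a ^ 2 := by
  set v : κ → ℝ := fun j => ∑ a, w a * y a j with hv
  have hdual : ∑ j, v j ^ 2 = ∑ a, w a * ∑ j, v j * y a j := by
    simp_rw [Finset.mul_sum]
    rw [Finset.sum_comm]
    refine Finset.sum_congr rfl fun j _ => ?_
    rw [sq]
    nth_rewrite 2 [hv]
    rw [Finset.mul_sum]
    exact Finset.sum_congr rfl fun a _ => by ring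
  have : 0 ≤ ∑ a, w a ^ 2 := by positivity
  have hV : 0 ≤ ∑ j, v j ^ 2 := by positivity
  have hsq : (∑ j, v j ^ 2) ^ 2 ≤ (∑ a, w a ^ 2) * (M * ∑ j, v j ^ 2) := by
    have hCS := Finset.sum_mul_sq_le_sq_mul_sq Finset.univ w fun a => ∑ j, v j * y a j
    rw [← hdual] at hCS
    exact hCS.trans (by gcongr; exact h v)
  rcases hV.eq_or_lt with h0 | hpos
  · rw [← h0]; positivity
  · nlinarith

variable {Ω : Type*} [MeasurableSpace Ω] {μ : Measure Ω} [IsProbabilityMeasure μ]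

/- The witness is the logarithm of the sum of `1` and of the exponential moments along a net of the
sphere: it dominates the quadratic form at each point of the net. -/
lemma exists_lintegral_exp_le_sum_sq_transpose_le {z : Ω → m → κ → ℝ}
    (hz : ∀ a j, Measurable fun ω => z ω a j) {v M : ℝ} (hv : 0 < v) (hM : 0 ≤ M)
    (h : ∀ u : κ → ℝ, ∑ j, u j ^ 2 = 1 →
      ∫⁻ ω, ENNReal.ofReal (Real.exp ((∑ a, (∑ j, u j * z ω a j) ^ 2) / v)) ∂μ ≤
        ENNReal.ofReal M) :
    ∃ Φ : Ω → ℝ, Measurable Φ ∧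
      ∫⁻ ω, ENNReal.ofReal (Real.exp (Φ ω)) ∂μ ≤ ENNReal.ofReal (1 + 5 ^ Fintype.card κ * M) ∧
      ∀ ω (w : m → ℝ), ∑ j, (∑ a, w a * z ω a j) ^ 2 ≤ 32 * (v * Φ ω) * ∑ a, w a ^ 2 := by
  obtain ⟨N, hcard, hunit, hcontrol⟩ := exists_net_abs_sum_sq_sub_le m κ
  let E : (κ → ℝ) → Ω → ℝ := fun u ω => Real.exp ((∑ a, (∑ j, u j * z ω a j) ^ 2) / v)
  have hE0 : ∀ u ω, 0 ≤ E u ω := fun u ω => (Real.exp_pos _).le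
  have hEm : ∀ u, Measurable (E u) := fun u => by fun_prop
  have hone : ∀ ω, 1 ≤ 1 + ∑ u ∈ N, E u ω := fun ω => by
    simpa using Finset.sum_nonneg fun u _ => hE0 u ω
  refine ⟨fun ω => Real.log (1 + ∑ u ∈ N, E u ω), by fun_prop, ?_, fun ω w => ?_⟩
  · simp_rw [Real.exp_log (one_pos.trans_le (hone _)),
      ENNReal.ofReal_add zero_le_one (Finset.sum_nonneg fun u _ => hE0 u _),
      ENNReal.ofReal_sum_of_nonneg fun u _ => hE0 u _]
    rw [lintegral_add_left measurable_const,
      lintegral_finsetSum _ fun u _ => (hEm u).ennreal_ofReal, ENNReal.ofReal_add zero_le_one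
      (by positivity), ENNReal.ofReal_mul (by positivity), ENNReal.ofReal_pow (by norm_num)]
    gcongr
    · simp
    · refine (Finset.sum_le_card_nsmul _ _ _ fun u hu => h u (hunit u hu)).trans ?_
      rw [nsmul_eq_mul]
      gcongr
      simpa using (Nat.cast_le (α := ℝ≥0∞)).2 hcard
  · have hlog := Real.log_nonneg (hone ω)
    refine sum_sq_transpose_le (by positivity) (fun y => ?_) w
    have hnet : ∀ u ∈ N, ∑ a, (∑ j, u j * z ω a j) ^ 2 ≤
        v * Real.log (1 + ∑ u ∈ N, E u ω) := fun u hu => by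
      rw [← div_le_iff₀' hv, Real.le_log_iff_exp_le (one_pos.trans_le (hone ω))]
      exact (Finset.single_le_sum (fun u _ => hE0 u ω) hu).trans (le_add_of_nonneg_left zero_le_one)
    have hquad := hcontrol (z ω) 0 (v * Real.log (1 + ∑ u ∈ N, E u ω)) (fun u hu => by
      rw [sub_zero, abs_of_nonneg (by positivity)]
      exact hnet u hu) y
    rw [zero_mul, sub_zero] at hquad
    exact (le_abs_self _).trans hquad

end Transpose

lemma one_add_five_pow_mul_exp_le_exp {n : ℕ} (hn : n ≠ 0) :
    1 + 5 ^ n * Real.exp n ≤ Real.exp (3 * n) := by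
  have hbase : 1 + 5 * Real.exp 1 ≤ Real.exp 3 := by
    have he := Real.exp_one_gt_d9
    have hcube : Real.exp 3 = Real.exp 1 * Real.exp 1 ^ 2 := by
      rw [← Real.exp_nat_mul, ← Real.exp_add]
      norm_num
    rw [hcube]
    nlinarith
  calc 1 + 5 ^ n * Real.exp n = 1 ^ n + (5 * Real.exp 1) ^ n := by
        rw [one_pow, mul_pow, ← Real.exp_nat_mul, mul_one]
    _ ≤ (1 + 5 * Real.exp 1) ^ n := pow_add_pow_le zero_le_one (by positivity) hn
    _ ≤ Real.exp 3 ^ n := by gcongr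
    _ = Real.exp (3 * n) := by rw [← Real.exp_nat_mul, mul_comm]

lemma tsum_ofReal_sum_blocks {n : ℕ} [NeZero n] {f : ℕ → ℝ} (hf : ∀ i, 0 ≤ f i) :
    ∑' i, ENNReal.ofReal (f i) = ∑' b : ℕ, ENNReal.ofReal (∑ j : Fin n, f (b * n + j)) := by
  rw [← (Nat.divModEquiv n).symm.tsum_eq, ENNReal.tsum_prod']
  refine tsum_congr fun b => ?_
  rw [tsum_fintype, ENNReal.ofReal_sum_of_nonneg fun j _ => hf _]
  simp [Nat.divModEquiv]

lemma tsum_ofReal_le_of_block_le {n : ℕ} [NeZero n] {f c F : ℕ → ℝ} {C : ℝ} (hf : ∀ i, 0 ≤ f i)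
    (hC : 0 ≤ C) (hc : ∀ b, 0 ≤ c b) (h : ∀ b, ∑ j : Fin n, f (b * n + j) ≤ C * (c b * F b)) :
    ∑' i, ENNReal.ofReal (f i) ≤
      ENNReal.ofReal C * ∑' b, ENNReal.ofReal (c b) * ENNReal.ofReal (F b) := by
  rw [tsum_ofReal_sum_blocks (n := n) hf, ← ENNReal.tsum_mul_left]
  refine ENNReal.tsum_le_tsum fun b => ?_
  rw [← ENNReal.ofReal_mul (hc b), ← ENNReal.ofReal_mul hC]
  exact ENNReal.ofReal_le_ofReal (h b)

namespace RidgeModel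

section TailGram

variable {Ω ι : Type*} [MeasurableSpace Ω] {μ : Measure Ω} {n : ℕ} {lam : ι → ℝ} {σx σε : ℝ}
  {X : Fin n → Ω → FeatureSpace ι} {ε : Ω → Fin n → ℝ}

lemma iIndepFun_coord (hM : RidgeModel μ n lam σx σε X ε) (i : ι) :
    iIndepFun (fun a ω => X a ω i / √(lam i)) μ :=
  hM.rows_indep.comp (fun _ y => y i / √(lam i)) fun _ => by fun_prop

lemma integral_coord (hM : RidgeModel μ n lam σx σε X ε) (a : Fin n) (i : ι) :
    ∫ ω, X a ω i / √(lam i) ∂μ = 0 := by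
  rw [integral_div, hM.rows_centered, zero_div]

variable [IsProbabilityMeasure μ]

lemma integral_sum_mul_coord_sq (hM : RidgeModel μ n lam σx σε X ε) (hlam : ∀ i, 0 < lam i)
    (hσx : 0 < σx) (i : ι) (u : Fin n → ℝ) :
    ∫ ω, (∑ a, u a * (X a ω i / √(lam i))) ^ 2 ∂μ = ∑ a, u a ^ 2 := by
  have hvar : ∀ a, ∫ ω, (X a ω i / √(lam i)) ^ 2 ∂μ = 1 := fun a => by
    have hsum := hM.integral_sum_row_sq hlam hσx a {i} fun i => (√(lam i))⁻¹
    simp only [Finset.sum_singleton, inv_pow, Real.sq_sqrt (hlam i).le,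
      mul_inv_cancel₀ (hlam i).ne'] at hsum
    simpa only [div_eq_inv_mul] using hsum
  exact integral_sum_mul_sq_of_iIndepFun (hM.iIndepFun_coord i)
    (fun a => (hM.hasPsi2Bound_coord hσx a i).memLp_two (by positivity)
      ((hM.measurable_row a i).div_const _)) (fun a => hM.integral_coord a i) hvar u

lemma hasPsi2Bound_sum_mul_coord (hM : RidgeModel μ n lam σx σε X ε) (hσx : 0 < σx) (i : ι)
    (u : Fin n → ℝ) :
    HasPsi2Bound μ (fun ω => ∑ a, u a * (X a ω i / √(lam i)))
      (36 * (4 * σx ^ 2) * ∑ a, u a ^ 2) :=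
  .sum_of_iIndepFun (hM.iIndepFun_coord i) (fun a => (hM.measurable_row a i).div_const _)
    (by positivity) (fun a => hM.hasPsi2Bound_coord hσx a i) (fun a => hM.integral_coord a i) u

lemma measureReal_tail_gram_le (hM : RidgeModel μ n lam σx σε X ε) (hlam : ∀ i, 0 < lam i)
    (hσx : 0 < σx) (hind : ∀ a, iIndepFun (fun (i : ι) (ω : Ω) => X a ω i) μ) (s : Finset ι)
    {r : ℝ} (hnr : (n : ℝ) ≤ r) (hr : r ≤ s.card) :
    μ.real {ω | ∃ w : Fin n → ℝ, 448 * (36 * (4 * σx ^ 2)) * √(s.card * r) * ∑ a, w a ^ 2 <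
        |∑ i ∈ s, (∑ a, w a * X a ω i) ^ 2 / lam i - s.card * ∑ a, w a ^ 2|} ≤
      2 * Real.exp (-r) := by
  classical
  have hcol : iIndepFun (fun i ω a => X a ω i) μ :=
    iIndepFun_transpose (X := fun a i ω => X a ω i) hM.measurable_row hM.rows_indep hind
  have hnet := measureReal_exists_abs_sum_sq_sub_gt_le (μ := μ) (m := s) (κ := Fin n)
    (Y := fun i ω a => X a ω i / √(lam i)) (v := 36 * (4 * σx ^ 2)) (r := r)
    ((hcol.precomp Subtype.val_injective).comp (fun (i : s) y a => y a / √(lam i))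
      fun i => by fun_prop)
    (fun i => measurable_pi_lambda _ fun a => (hM.measurable_row a i).div_const _) (by positivity)
    (fun i u hu => by simpa only [hu, mul_one] using hM.hasPsi2Bound_sum_mul_coord hσx (i : ι) u)
    (fun i u hu => by rw [hM.integral_sum_mul_coord_sq hlam hσx, hu])
    (by simpa using hnr) (by simpa using hr)
  have hunwhiten : ∀ ω (w : Fin n → ℝ), ∑ i : s, (∑ a, w a * (X a ω i / √(lam i))) ^ 2 =
      ∑ i ∈ s, (∑ a, w a * X a ω i) ^ 2 / lam i := fun ω w => by
    rw [← Finset.sum_coe_sort s]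
    refine Finset.sum_congr rfl fun i _ => ?_
    rw [← sum_mul_div_sqrt_sq (hlam i) w fun a => X a ω i, mul_div_cancel_left₀ _ (hlam i).ne']
  simpa only [hunwhiten, Fintype.card_coe] using hnet

lemma exists_lintegral_exp_le_sum_block_sq_le (hM : RidgeModel μ n lam σx σε X ε)
    (hlam : ∀ i, 0 < lam i) (hσx : 0 < σx) {κ : Type*} [Fintype κ] [Nonempty κ] {idx : κ → ι}
    (hidx : Function.Injective idx) {L : ℝ} (hL : ∀ j, lam (idx j) ≤ L) :
    ∃ Φ : Ω → ℝ, Measurable Φ ∧ ∫⁻ ω, ENNReal.ofReal (Real.exp (Φ ω)) ∂μ ≤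
        ENNReal.ofReal (1 + 5 ^ Fintype.card κ * Real.exp n) ∧
      ∀ ω (w : Fin n → ℝ), ∑ j, (∑ a, w a * X a ω (idx j)) ^ 2 ≤
        L * (32 * (4 * σx ^ 2 * Φ ω) * ∑ a, w a ^ 2) := by
  classical
  obtain ⟨Φ, hΦm, hΦ, hbound⟩ := exists_lintegral_exp_le_sum_sq_transpose_le (μ := μ)
    (z := fun ω a j => X a ω (idx j) / √(lam (idx j))) (v := 4 * σx ^ 2) (M := Real.exp n)
    (fun a j => (hM.measurable_row a _).div_const _) (by positivity) (by positivity) fun u hu => by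
    let c : ι → ℝ := Function.extend idx (fun j => u j / √(lam (idx j))) 0
    have hc : ∀ j, c (idx j) = u j / √(lam (idx j)) := hidx.extend_apply _ _
    have hQ : ∑ i ∈ Finset.univ.image idx, lam i * c i ^ 2 ≤ 1 := by
      rw [Finset.sum_image hidx.injOn, ← hu]
      refine Finset.sum_le_sum fun j _ => le_of_eq ?_
      rw [hc, div_pow, Real.sq_sqrt (hlam _).le, mul_div_cancel₀ _ (hlam _).ne']
    refine le_of_eq_of_le (lintegral_congr fun ω => ?_)
      (hM.lintegral_exp_sum_row_sq_le hlam hσx hQ)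
    simp_rw [Finset.sum_image hidx.injOn, hc, mul_one, mul_div_assoc', div_mul_eq_mul_div]
  refine ⟨Φ, hΦm, hΦ, fun ω w => ?_⟩
  calc ∑ j, (∑ a, w a * X a ω (idx j)) ^ 2
      = ∑ j, lam (idx j) * (∑ a, w a * (X a ω (idx j) / √(lam (idx j)))) ^ 2 := by
        simp_rw [sum_mul_div_sqrt_sq (hlam _)]
    _ ≤ ∑ j, L * (∑ a, w a * (X a ω (idx j) / √(lam (idx j)))) ^ 2 := by
        gcongr with j
        exact hL j
    _ ≤ L * (32 * (4 * σx ^ 2 * Φ ω) * ∑ a, w a ^ 2) := by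
        rw [← Finset.mul_sum]
        have := (hlam _).le.trans (hL (Classical.arbitrary κ))
        gcongr
        exact hbound ω w

end TailGram

section Geometric

variable {Ω : Type*} [MeasurableSpace Ω] {μ : Measure Ω} [IsProbabilityMeasure μ] {n : ℕ}
  {lam : ℕ → ℝ} {σx σε : ℝ} {X : Fin n → Ω → FeatureSpace ℕ} {ε : Ω → Fin n → ℝ}

lemma measureReal_tail_gram_le_of_geometric (hM : RidgeModel μ n lam σx σε X ε)
    (hlam : ∀ i, 0 < lam i) (hσx : 0 < σx) (hn : n ≠ 0) (k : ℕ) {ρ q : ℝ} (hρ : 0 ≤ ρ)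
    (hq0 : 0 ≤ q) (hq1 : q < 1)
    (hdecay : ∀ (b : ℕ) (j : Fin n), lam (k + (b * n + j)) ≤ ρ * q ^ b) :
    μ.real {ω | ∃ w : Fin n → ℝ,
        ENNReal.ofReal (160 * n * (4 * σx ^ 2) * (ρ / (1 - q)) * ∑ a, w a ^ 2) <
        ∑' i, ENNReal.ofReal ((∑ a, w a * X a ω (k + i)) ^ 2)} ≤ Real.exp (-n) := by
  have : NeZero n := ⟨hn⟩
  have hn1 : (1 : ℝ) ≤ n := by exact_mod_cast Nat.one_le_iff_ne_zero.2 hn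
  have : 0 < 1 - q := sub_pos.2 hq1
  choose Φ hΦm hΦ hblock using fun b : ℕ => hM.exists_lintegral_exp_le_sum_block_sq_le hlam hσx
    (idx := fun j : Fin n => k + (b * n + j)) (fun j j' h => Fin.ext (by simpa using h)) (hdecay b)
  have hmix := measureReal_tsum_mul_lt_le (μ := μ) (fun b => ENNReal.ofReal (ρ * q ^ b)) hΦm
    (A := 3 * n) (T := 4 * n) (by positivity) fun b => (hΦ b).trans (ENNReal.ofReal_le_ofReal
      (by simpa using one_add_five_pow_mul_exp_le_exp hn))
  have hweights : ∑' b : ℕ, ENNReal.ofReal (ρ * q ^ b) = ENNReal.ofReal (ρ / (1 - q)) := by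
    rw [← ENNReal.ofReal_tsum_of_nonneg (fun b => by positivity)
      ((summable_geometric_of_lt_one hq0 hq1).mul_left _), tsum_mul_left,
      tsum_geometric_of_lt_one hq0 hq1, div_eq_mul_inv]
  rw [show (3 : ℝ) * n - 4 * n = -n by ring, hweights] at hmix
  refine le_trans (measureReal_mono (fun ω => ?_) (measure_ne_top _ _)) hmix
  rintro ⟨w, hw⟩
  rw [Set.mem_ofPred_eq]
  by_contra! hcon
  refine hw.not_ge ?_
  have hW : 0 ≤ 32 * (4 * σx ^ 2) * ∑ a, w a ^ 2 := by positivity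
  calc ∑' i, ENNReal.ofReal ((∑ a, w a * X a ω (k + i)) ^ 2)
      ≤ ENNReal.ofReal (32 * (4 * σx ^ 2) * ∑ a, w a ^ 2) *
          ∑' b, ENNReal.ofReal (ρ * q ^ b) * ENNReal.ofReal (Φ b ω) :=
        tsum_ofReal_le_of_block_le (fun i => sq_nonneg _) hW (fun b => by positivity)
          fun b => (hblock b ω w).trans_eq (by ring)
    _ ≤ ENNReal.ofReal (32 * (4 * σx ^ 2) * ∑ a, w a ^ 2) *
          (ENNReal.ofReal (ρ / (1 - q)) * ENNReal.ofReal (4 * n + 1)) := by gcongr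
    _ = ENNReal.ofReal (32 * (4 * n + 1) * ((4 * σx ^ 2) * (ρ / (1 - q)) * ∑ a, w a ^ 2)) := by
        rw [← ENNReal.ofReal_mul (by positivity), ← ENNReal.ofReal_mul hW]
        congr 1
        ring
    _ ≤ _ := by
        refine ENNReal.ofReal_le_ofReal ?_
        have : 0 ≤ (4 * σx ^ 2) * (ρ / (1 - q)) * ∑ a, w a ^ 2 := by positivity
        nlinarith

end Geometric

end RidgeModel

/-! ### Deterministic bounds for the ridge estimator -/

section PerturbedSystem

variable {m ι : Type*}

lemma sum_mul_le_sum_sq (s : Finset ι) {b : ℝ} (hb : 0 < b) (f g : ι → ℝ) :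
    ∑ i ∈ s, f i * g i ≤ b / 2 * ∑ i ∈ s, f i ^ 2 + (∑ i ∈ s, g i ^ 2) / (2 * b) := by
  rw [Finset.mul_sum, Finset.sum_div, ← Finset.sum_add_distrib]
  refine Finset.sum_le_sum fun i _ => ?_
  have hsq : b / 2 * f i ^ 2 + g i ^ 2 / (2 * b) - f i * g i = (b * f i - g i) ^ 2 / (2 * b) := by
    field_simp
    ring
  have : 0 ≤ (b * f i - g i) ^ 2 / (2 * b) := by positivity
  linarith

lemma sum_mul_le_weighted_sum_sq (s : Finset ι) {b : ℝ} (hb : 0 < b) {lam : ι → ℝ}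
    (hlam : ∀ i, 0 < lam i) (f g : ι → ℝ) :
    ∑ i ∈ s, f i * g i ≤
      b / 2 * ∑ i ∈ s, lam i * f i ^ 2 + (∑ i ∈ s, g i ^ 2 / lam i) / (2 * b) := by
  have hsqrt : ∀ i, √(lam i) ^ 2 = lam i := fun i => Real.sq_sqrt (hlam i).le
  have h := sum_mul_le_sum_sq s hb (fun i => √(lam i) * f i) (fun i => g i / √(lam i))
  simp only [mul_pow, div_pow, hsqrt] at h
  refine le_of_eq_of_le (Finset.sum_congr rfl fun i _ => ?_) h
  have : 0 < √(lam i) := Real.sqrt_pos.2 (hlam i)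
  field_simp

variable [Fintype m]

lemma sum_mulVec_sq_le {K : Matrix m m ℝ} (hK : K.IsSymm) {B : ℝ} (hB : 0 < B)
    (hnonneg : ∀ v : m → ℝ, 0 ≤ v ⬝ᵥ K *ᵥ v)
    (hle : ∀ v : m → ℝ, v ⬝ᵥ K *ᵥ v ≤ B * ∑ a, v a ^ 2) (w : m → ℝ) :
    ∑ a, (K *ᵥ w) a ^ 2 ≤ B ^ 2 * ∑ a, w a ^ 2 := by
  set z := K *ᵥ w with hz
  have hsq : z ⬝ᵥ z = ∑ a, z a ^ 2 := by simp only [dotProduct, sq]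
  have hsymm : w ⬝ᵥ K *ᵥ z = z ⬝ᵥ z := by
    rw [Matrix.dotProduct_mulVec, ← Matrix.mulVec_transpose, hK.eq]
  have hexpand : (B • w - z) ⬝ᵥ K *ᵥ (B • w - z) =
      B ^ 2 * (w ⬝ᵥ K *ᵥ w) - 2 * B * ∑ a, z a ^ 2 + z ⬝ᵥ K *ᵥ z := by
    rw [Matrix.mulVec_sub, Matrix.mulVec_smul, ← hz, sub_dotProduct, dotProduct_sub,
      dotProduct_sub, smul_dotProduct, smul_dotProduct, dotProduct_smul, dotProduct_smul, hsymm,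
      hsq]
    simp only [smul_eq_mul]
    ring
  have hquad : 0 ≤ B ^ 2 * (w ⬝ᵥ K *ᵥ w) - 2 * B * ∑ a, z a ^ 2 + z ⬝ᵥ K *ᵥ z :=
    hexpand ▸ hnonneg _
  have hw : B ^ 2 * (w ⬝ᵥ K *ᵥ w) ≤ B ^ 2 * (B * ∑ a, w a ^ 2) := by gcongr; exact hle w
  refine le_of_mul_le_mul_left ?_ hB
  linarith [hle z]

/-- The deterministic conditions under which the ridge estimator is controlled: the quadratic form
of `K` (the part of `reg Iₙ + X Xᵀ` coming from the features outside `s`) lies between `α` and `L α`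
times the identity, and the features in `s`, whitened by `lam`, have a Gram matrix bounded below
by `N / 2`. -/
structure IsWellConditioned (K : Matrix m m ℝ) (x : m → ι → ℝ) (s : Finset ι) (lam : ι → ℝ)
    (α L N : ℝ) : Prop where
  lower : ∀ v : m → ℝ, α * ∑ a, v a ^ 2 ≤ v ⬝ᵥ K *ᵥ v
  upper : ∀ v : m → ℝ, v ⬝ᵥ K *ᵥ v ≤ L * α * ∑ a, v a ^ 2
  head : ∀ c : ι → ℝ, N / 2 * ∑ i ∈ s, lam i * c i ^ 2 ≤ ∑ a, (∑ i ∈ s, c i * x a i) ^ 2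

variable {K : Matrix m m ℝ} {x : m → ι → ℝ} {s : Finset ι} {lam : ι → ℝ} {α L N : ℝ}
  {w r : m → ℝ} {θ δ : ι → ℝ}

lemma dotProduct_mulVec_le_of_perturbed_system (hδ : ∀ i, δ i = θ i - ∑ a, w a * x a i)
    (hw : ∀ a, (K *ᵥ w) a = ∑ i ∈ s, δ i * x a i + r a) :
    w ⬝ᵥ K *ᵥ w ≤ ∑ i ∈ s, δ i * θ i + ∑ a, w a * r a := by
  have henergy : w ⬝ᵥ K *ᵥ w = ∑ i ∈ s, δ i * (θ i - δ i) + ∑ a, w a * r a := by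
    simp only [dotProduct, hw, mul_add, Finset.sum_add_distrib, add_left_inj, Finset.mul_sum]
    rw [Finset.sum_comm]
    refine Finset.sum_congr rfl fun i _ => ?_
    rw [hδ, sub_sub_cancel, Finset.mul_sum]
    exact Finset.sum_congr rfl fun a _ => by ring
  have hdrop : ∑ i ∈ s, δ i * (θ i - δ i) ≤ ∑ i ∈ s, δ i * θ i :=
    Finset.sum_le_sum fun i _ => by nlinarith [sq_nonneg (δ i)]
  linarith

namespace IsWellConditioned

lemma sum_head_sq_le (h : IsWellConditioned K x s lam α L N) (hK : K.IsSymm) (hα : 0 < α)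
    (hL : 1 ≤ L) (hw : ∀ a, (K *ᵥ w) a = ∑ i ∈ s, δ i * x a i + r a) :
    N * ∑ i ∈ s, lam i * δ i ^ 2 ≤
      4 * (L * α) ^ 2 * ∑ a, w a ^ 2 + 4 * ∑ a, r a ^ 2 := by
  have hKw : ∑ a, (K *ᵥ w) a ^ 2 ≤ (L * α) ^ 2 * ∑ a, w a ^ 2 :=
    sum_mulVec_sq_le hK (by positivity) (fun v => le_trans (by positivity) (h.lower v)) h.upper w
  have hsplit : ∑ a, (∑ i ∈ s, δ i * x a i) ^ 2 ≤
      2 * ∑ a, (K *ᵥ w) a ^ 2 + 2 * ∑ a, r a ^ 2 := by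
    rw [Finset.mul_sum, Finset.mul_sum, ← Finset.sum_add_distrib]
    refine Finset.sum_le_sum fun a _ => ?_
    rw [hw a]
    nlinarith [sq_nonneg (∑ i ∈ s, δ i * x a i + 2 * r a)]
  linarith [h.head δ]

lemma sum_sq_le_of_perturbed_system (h : IsWellConditioned K x s lam α L N) (hK : K.IsSymm)
    (hα : 0 < α) (hL : 1 ≤ L) (hN : 0 < N) (hlam : ∀ i, 0 < lam i)
    (hδ : ∀ i, δ i = θ i - ∑ a, w a * x a i)
    (hw : ∀ a, (K *ᵥ w) a = ∑ i ∈ s, δ i * x a i + r a) :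
    ∑ a, w a ^ 2 ≤
      3 * (∑ a, r a ^ 2) / α ^ 2 + 8 * L ^ 2 / N * ∑ i ∈ s, θ i ^ 2 / lam i := by
  have henergy := (h.lower w).trans (dotProduct_mulVec_le_of_perturbed_system hδ hw)
  have hδθ := sum_mul_le_weighted_sum_sq s (b := N / (8 * L ^ 2 * α)) (by positivity) hlam δ θ
  have hwr := sum_mul_le_sum_sq Finset.univ (b := α / 2) (by positivity) w r
  have hD := h.sum_head_sq_le hK hα hL hw
  set W := ∑ a, w a ^ 2
  set T := ∑ a, r a ^ 2
  set D := ∑ i ∈ s, lam i * δ i ^ 2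
  set H := ∑ i ∈ s, θ i ^ 2 / lam i
  have hT : 0 ≤ T / (4 * α) := by positivity
  have hDW : N / (8 * L ^ 2 * α) / 2 * D ≤ α / 4 * W + T / (4 * α) :=
    calc N / (8 * L ^ 2 * α) / 2 * D = N * D / (16 * L ^ 2 * α) := by ring
      _ ≤ (4 * (L * α) ^ 2 * W + 4 * T) / (16 * L ^ 2 * α) := by gcongr
      _ = α / 4 * W + T / (4 * α) / L ^ 2 := by field_simp; ring
      _ ≤ α / 4 * W + T / (4 * α) := by linarith [div_le_self hT (one_le_pow₀ hL (n := 2))]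
  have hgoal : α / 2 * (3 * T / α ^ 2 + 8 * L ^ 2 / N * H) =
      H / (2 * (N / (8 * L ^ 2 * α))) + T / (2 * (α / 2)) + T / (4 * α) + T / (4 * α) := by
    field_simp
    ring
  refine le_of_mul_le_mul_left (a := α / 2) ?_ (by positivity)
  linarith

lemma sum_head_sq_le_of_perturbed_system (h : IsWellConditioned K x s lam α L N) (hK : K.IsSymm)
    (hα : 0 < α) (hL : 1 ≤ L) (hN : 0 < N) (hlam : ∀ i, 0 < lam i)
    (hδ : ∀ i, δ i = θ i - ∑ a, w a * x a i)
    (hw : ∀ a, (K *ᵥ w) a = ∑ i ∈ s, δ i * x a i + r a) :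
    ∑ i ∈ s, lam i * δ i ^ 2 ≤ ((12 * L ^ 2 + 4) * ∑ a, r a ^ 2 +
      32 * L ^ 4 * α ^ 2 / N * ∑ i ∈ s, θ i ^ 2 / lam i) / N := by
  rw [le_div_iff₀' hN]
  calc N * ∑ i ∈ s, lam i * δ i ^ 2
      ≤ 4 * (L * α) ^ 2 * ∑ a, w a ^ 2 + 4 * ∑ a, r a ^ 2 := h.sum_head_sq_le hK hα hL hw
    _ ≤ 4 * (L * α) ^ 2 * (3 * (∑ a, r a ^ 2) / α ^ 2 +
          8 * L ^ 2 / N * ∑ i ∈ s, θ i ^ 2 / lam i) + 4 * ∑ a, r a ^ 2 := by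
        gcongr
        exact h.sum_sq_le_of_perturbed_system hK hα hL hN hlam hδ hw
    _ = _ := by field_simp; ring

end IsWellConditioned

end PerturbedSystem

section Design

variable {ι : Type*} {n : ℕ}

lemma designTransposeMul_apply (x : Fin n → FeatureSpace ι) (w : Fin n → ℝ) (i : ι) :
    designTransposeMul x w i = ∑ a, w a * x a i := by
  rw [designTransposeMul, lp.coeFn_sum]
  exact Finset.sum_apply i Finset.univ fun a => ((w a • x a : FeatureSpace ι) : ι → ℝ)

lemma hasSum_sq_coord (y : FeatureSpace ι) : HasSum (fun i => y i ^ 2) (inner ℝ y y) := by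
  simpa [sq] using lp.hasSum_inner (𝕜 := ℝ) y y

lemma summable_mul_sq_coord {lam : ι → ℝ} {Λ : ℝ} (hlam : ∀ i, 0 < lam i) (hΛ : ∀ i, lam i ≤ Λ)
    (y : FeatureSpace ι) : Summable fun i => lam i * y i ^ 2 :=
  Summable.of_nonneg_of_le (fun i => mul_nonneg (hlam i).le (sq_nonneg _))
    (fun i => mul_le_mul_of_nonneg_right (hΛ i) (sq_nonneg _))
    ((hasSum_sq_coord y).summable.mul_left Λ)

lemma tsum_ite_mul_sub_sq_le [DecidableEq ι] {lam : ι → ℝ} {Λ : ℝ} (hlam : ∀ i, 0 < lam i)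
    (hΛ : ∀ i, lam i ≤ Λ) (s : Finset ι) (y z : FeatureSpace ι) :
    (∑' i, if i ∈ s then 0 else lam i * (y i - z i) ^ 2) ≤
      2 * (∑' i, if i ∈ s then 0 else lam i * y i ^ 2) +
        2 * ∑' i, if i ∈ s then 0 else lam i * z i ^ 2 := by
  have hsum : ∀ u : FeatureSpace ι, Summable fun i => if i ∈ s then 0 else lam i * u i ^ 2 :=
    fun u => (hasSum_ite_mem_zero (summable_mul_sq_coord hlam hΛ u).hasSum s).summable
  rw [← tsum_mul_left, ← tsum_mul_left,
    ← ((hsum y).mul_left 2).tsum_add ((hsum z).mul_left 2)]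
  refine (hsum (y - z)).tsum_le_tsum (fun i => ?_)
    (((hsum y).mul_left 2).add ((hsum z).mul_left 2))
  split_ifs
  · simp
  · change lam i * (y i - z i) ^ 2 ≤ _
    nlinarith [mul_nonneg (hlam i).le (sq_nonneg (y i + z i))]

lemma regGram_mulVec_apply (reg : ℝ) (x : Fin n → FeatureSpace ι) (w : Fin n → ℝ) (a : Fin n) :
    (regGram reg x *ᵥ w) a = reg * w a + inner ℝ (x a) (designTransposeMul x w) := by
  simp only [regGram, Matrix.add_mulVec, Matrix.smul_mulVec, Matrix.one_mulVec, Pi.add_apply,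
    Pi.smul_apply, smul_eq_mul, designTransposeMul, inner_sum, inner_smul_right]
  congr 1
  simp only [Matrix.mulVec, dotProduct, Matrix.gram_apply]
  exact Finset.sum_congr rfl fun b _ => mul_comm _ _

lemma dotProduct_regGram_mulVec (reg : ℝ) (x : Fin n → FeatureSpace ι) (w : Fin n → ℝ) :
    w ⬝ᵥ regGram reg x *ᵥ w = reg * ∑ a, w a ^ 2 +
      inner ℝ (designTransposeMul x w) (designTransposeMul x w) := by
  have hinner : inner ℝ (designTransposeMul x w) (designTransposeMul x w) =
      ∑ a, w a * inner ℝ (x a) (designTransposeMul x w) := by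
    conv_lhs => rw [designTransposeMul, sum_inner]
    exact Finset.sum_congr rfl fun a _ => real_inner_smul_left _ _ _
  rw [hinner, Finset.mul_sum, ← Finset.sum_add_distrib]
  refine Finset.sum_congr rfl fun a _ => ?_
  rw [regGram_mulVec_apply]
  ring

lemma regGram_isSymm (reg : ℝ) (x : Fin n → FeatureSpace ι) : (regGram reg x).IsSymm := by
  ext a b
  simp only [regGram, Matrix.transpose_apply, Matrix.add_apply, Matrix.smul_apply,
    Matrix.gram_apply, Matrix.one_apply, real_inner_comm, eq_comm]

/-- The matrix `reg Iₙ + X Xᵀ` without the contribution of the features in `s`. -/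
noncomputable def tailGram (reg : ℝ) (x : Fin n → FeatureSpace ι) (s : Finset ι) :
    Matrix (Fin n) (Fin n) ℝ :=
  regGram reg x - Matrix.of fun a b => ∑ i ∈ s, x a i * x b i

lemma tailGram_isSymm (reg : ℝ) (x : Fin n → FeatureSpace ι) (s : Finset ι) :
    (tailGram reg x s).IsSymm := by
  refine (regGram_isSymm reg x).sub ?_
  ext a b
  simp [mul_comm]

lemma tailGram_mulVec_apply (reg : ℝ) (x : Fin n → FeatureSpace ι) (s : Finset ι)
    (w : Fin n → ℝ) (a : Fin n) :
    (tailGram reg x s *ᵥ w) a =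
      (regGram reg x *ᵥ w) a - ∑ i ∈ s, (∑ b, w b * x b i) * x a i := by
  rw [tailGram, Matrix.sub_mulVec, Pi.sub_apply]
  congr 1
  simp only [Matrix.mulVec, dotProduct, Matrix.of_apply, Finset.sum_mul]
  rw [Finset.sum_comm]
  exact Finset.sum_congr rfl fun b _ => Finset.sum_congr rfl fun i _ => by ring

lemma dotProduct_regGram_mulVec_eq_add (reg : ℝ) (x : Fin n → FeatureSpace ι) (s : Finset ι)
    (w : Fin n → ℝ) :
    w ⬝ᵥ regGram reg x *ᵥ w =
      w ⬝ᵥ tailGram reg x s *ᵥ w + ∑ i ∈ s, (∑ a, w a * x a i) ^ 2 := by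
  simp only [dotProduct, tailGram_mulVec_apply, mul_sub, Finset.sum_sub_distrib]
  rw [← sub_eq_iff_eq_add', sub_sub_cancel]
  simp_rw [Finset.mul_sum]
  rw [Finset.sum_comm]
  refine Finset.sum_congr rfl fun i _ => ?_
  rw [sq, Finset.mul_sum]
  exact Finset.sum_congr rfl fun a _ => by ring

lemma dotProduct_tailGram_mulVec [DecidableEq ι] (reg : ℝ) (x : Fin n → FeatureSpace ι)
    (s : Finset ι) (w : Fin n → ℝ) :
    w ⬝ᵥ tailGram reg x s *ᵥ w =
      reg * ∑ a, w a ^ 2 + ∑' i, if i ∈ s then 0 else (∑ a, w a * x a i) ^ 2 := by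
  have htail := (hasSum_ite_mem_zero (hasSum_sq_coord (designTransposeMul x w)) s).tsum_eq
  simp only [designTransposeMul_apply] at htail
  rw [htail]
  linarith [dotProduct_regGram_mulVec reg x w, dotProduct_regGram_mulVec_eq_add reg x s w]

end Design

section RidgeBounds

variable {ι : Type*} {n : ℕ} {x : Fin n → FeatureSpace ι} {reg α : ℝ} {s : Finset ι}

lemma le_dotProduct_regGram_mulVec
    (hlower : ∀ v : Fin n → ℝ, α * ∑ a, v a ^ 2 ≤ v ⬝ᵥ tailGram reg x s *ᵥ v) (v : Fin n → ℝ) :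
    α * ∑ a, v a ^ 2 ≤ v ⬝ᵥ regGram reg x *ᵥ v := by
  rw [dotProduct_regGram_mulVec_eq_add reg x s v]
  exact (hlower v).trans (le_add_of_nonneg_right (Finset.sum_nonneg fun i _ => sq_nonneg _))

lemma isUnit_det_regGram (hα : 0 < α)
    (hlower : ∀ v : Fin n → ℝ, α * ∑ a, v a ^ 2 ≤ v ⬝ᵥ tailGram reg x s *ᵥ v) :
    IsUnit (regGram reg x).det := by
  rw [isUnit_iff_ne_zero]
  intro hdet
  obtain ⟨v, hv, hker⟩ := Matrix.exists_mulVec_eq_zero_iff.2 hdet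
  have hle := le_dotProduct_regGram_mulVec hlower v
  rw [hker, dotProduct_zero] at hle
  have hzero : ∑ a, v a ^ 2 = 0 := le_antisymm (by nlinarith) (by positivity)
  refine hv (funext fun a => ?_)
  have := (Finset.sum_eq_zero_iff_of_nonneg (fun a _ => sq_nonneg (v a))).1 hzero a
    (Finset.mem_univ a)
  exact pow_eq_zero_iff two_ne_zero |>.1 this

lemma regGram_mulVec_inv_mulVec (hdet : IsUnit (regGram reg x).det) (y : Fin n → ℝ) :
    regGram reg x *ᵥ ((regGram reg x)⁻¹ *ᵥ y) = y := by
  rw [Matrix.mulVec_mulVec, Matrix.mul_nonsing_inv _ hdet, Matrix.one_mulVec]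

variable {lam : ι → ℝ} {Λ L N : ℝ}

lemma biasTerm_le [DecidableEq ι]
    (h : IsWellConditioned (tailGram reg x s) (fun a i => x a i) s lam α L N)
    (hlam : ∀ i, 0 < lam i) (hΛ : ∀ i, lam i ≤ Λ) (hα : 0 < α) (hL : 1 ≤ L) (hN : 0 < N)
    {β : ℝ} (hβ : 0 ≤ β)
    (hβv : ∀ v : Fin n → ℝ, ∑' i, (if i ∈ s then 0 else lam i * (∑ a, v a * x a i) ^ 2) ≤
      β * ∑ a, v a ^ 2) (θ : FeatureSpace ι) {T : ℝ}
    (hT : ∑ a, (inner ℝ (x a) θ - ∑ i ∈ s, x a i * θ i) ^ 2 ≤ T) :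
    biasTerm lam reg x θ ≤ ((12 * L ^ 2 + 4) * T +
      32 * L ^ 4 * α ^ 2 / N * ∑ i ∈ s, θ i ^ 2 / lam i) / N +
      2 * (∑' i, if i ∈ s then 0 else lam i * θ i ^ 2) +
      2 * β * (3 * T / α ^ 2 + 8 * L ^ 2 / N * ∑ i ∈ s, θ i ^ 2 / lam i) := by
  set w := (regGram reg x)⁻¹ *ᵥ designMul x θ with hwdef
  have hsolve : ∀ a, (regGram reg x *ᵥ w) a = inner ℝ (x a) θ := fun a => by
    rw [hwdef, regGram_mulVec_inv_mulVec (isUnit_det_regGram hα h.lower), designMul]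
  have hsystem : ∀ a, (tailGram reg x s *ᵥ w) a =
      ∑ i ∈ s, (θ i - ∑ b, w b * x b i) * x a i +
        (inner ℝ (x a) θ - ∑ i ∈ s, x a i * θ i) := fun a => by
    have : ∑ i ∈ s, θ i * x a i = ∑ i ∈ s, x a i * θ i :=
      Finset.sum_congr rfl fun i _ => mul_comm _ _
    rw [tailGram_mulVec_apply, hsolve]
    simp only [sub_mul, Finset.sum_sub_distrib, this]
    ring
  have hsymm := tailGram_isSymm reg x s
  have hW := h.sum_sq_le_of_perturbed_system hsymm hα hL hN hlam (fun _ => rfl) hsystem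
  have hD := h.sum_head_sq_le_of_perturbed_system hsymm hα hL hN hlam (fun _ => rfl) hsystem
  have htail := tsum_ite_mul_sub_sq_le hlam hΛ s θ (designTransposeMul x w)
  have hsplit := (hasSum_ite_mem_zero (summable_mul_sq_coord hlam hΛ
    (θ - ridgeEstimator reg x (designMul x θ))).hasSum s).tsum_eq
  simp only [lp.coeFn_sub, Pi.sub_apply, ridgeEstimator, designTransposeMul_apply, ← hwdef]
    at htail hsplit
  have hbias : biasTerm lam reg x θ = ∑' i, lam i * (θ i - ∑ a, w a * x a i) ^ 2 := by
    simp only [biasTerm, sigmaNormSq, ridgeEstimator, lp.coeFn_sub, Pi.sub_apply,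
      designTransposeMul_apply, ← hwdef]
  have hWT := hW.trans (c := 3 * T / α ^ 2 + 8 * L ^ 2 / N * ∑ i ∈ s, θ i ^ 2 / lam i)
    (by gcongr)
  have hDT := hD.trans (c := ((12 * L ^ 2 + 4) * T +
    32 * L ^ 4 * α ^ 2 / N * ∑ i ∈ s, θ i ^ 2 / lam i) / N) (by gcongr)
  have hβW := (hβv w).trans (mul_le_mul_of_nonneg_left hWT hβ)
  rw [hbias]
  linarith

/-- The rows of the matrix `Xᵀ (reg Iₙ + X Xᵀ)⁻¹`. -/
noncomputable def ridgeCoeff (reg : ℝ) (x : Fin n → FeatureSpace ι) (i : ι) : Fin n → ℝ :=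
  (regGram reg x)⁻¹ *ᵥ fun a => x a i

lemma ridgeEstimator_apply (reg : ℝ) (x : Fin n → FeatureSpace ι) (e : Fin n → ℝ) (i : ι) :
    ridgeEstimator reg x e i = ∑ a, ridgeCoeff reg x i a * e a := by
  rw [ridgeEstimator, designTransposeMul_apply]
  have hsymm : ((regGram reg x)⁻¹)ᵀ = (regGram reg x)⁻¹ := by
    rw [Matrix.transpose_nonsing_inv, (regGram_isSymm reg x).eq]
  have : (fun a => x a i) ⬝ᵥ (regGram reg x)⁻¹ *ᵥ e = ridgeCoeff reg x i ⬝ᵥ e := by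
    rw [ridgeCoeff, Matrix.dotProduct_mulVec, ← Matrix.mulVec_transpose, hsymm]
  simpa [dotProduct, mul_comm] using this

lemma sum_ridgeCoeff_sq_head_le
    (h : IsWellConditioned (tailGram reg x s) (fun a i => x a i) s lam α L N)
    (hlam : ∀ i, 0 < lam i) (hα : 0 < α) (hL : 1 ≤ L) (hN : 0 < N) {i : ι} (hi : i ∈ s) :
    lam i * ∑ a, ridgeCoeff reg x i a ^ 2 ≤ 8 * L ^ 2 / N := by
  classical
  have hdet := isUnit_det_regGram hα h.lower
  have hW := h.sum_sq_le_of_perturbed_system (tailGram_isSymm reg x s) hα hL hN hlam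
    (w := ridgeCoeff reg x i) (r := 0) (θ := Pi.single i 1)
    (δ := fun j => (Pi.single i 1 : ι → ℝ) j - ∑ a, ridgeCoeff reg x i a * x a j) (fun _ => rfl)
    (fun a => by
      have hsingle : ∑ j ∈ s, (Pi.single i 1 : ι → ℝ) j * x a j = x a i := by
        simp [Pi.single_apply, hi]
      rw [tailGram_mulVec_apply, ridgeCoeff, regGram_mulVec_inv_mulVec hdet]
      simp only [sub_mul, Finset.sum_sub_distrib, hsingle, Pi.zero_apply, add_zero])
  have hH : ∑ j ∈ s, (Pi.single i 1 : ι → ℝ) j ^ 2 / lam j = 1 / lam i := by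
    rw [Finset.sum_eq_single_of_mem i hi fun j _ hj => by simp [hj], Pi.single_eq_same, one_pow]
  rw [hH] at hW
  simp only [Pi.zero_apply, ne_eq, OfNat.ofNat_ne_zero, not_false_eq_true, zero_pow,
    Finset.sum_const_zero, mul_zero, zero_div, zero_add, mul_one_div] at hW
  rwa [le_div_iff₀' (hlam i)] at hW

lemma sum_ridgeCoeff_sq_le (hα : 0 < α)
    (hlower : ∀ v : Fin n → ℝ, α * ∑ a, v a ^ 2 ≤ v ⬝ᵥ tailGram reg x s *ᵥ v) (i : ι) :
    ∑ a, ridgeCoeff reg x i a ^ 2 ≤ (∑ a, x a i ^ 2) / α ^ 2 := by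
  have hle := le_dotProduct_regGram_mulVec hlower (ridgeCoeff reg x i)
  have heq : ridgeCoeff reg x i ⬝ᵥ regGram reg x *ᵥ ridgeCoeff reg x i =
      ∑ a, ridgeCoeff reg x i a * x a i := by
    have hsolve : regGram reg x *ᵥ ridgeCoeff reg x i = fun a => x a i :=
      regGram_mulVec_inv_mulVec (isUnit_det_regGram hα hlower) _
    rw [hsolve, dotProduct]
  have hyoung := sum_mul_le_sum_sq Finset.univ hα (ridgeCoeff reg x i) (fun a => x a i)
  have hscale : α / 2 * ((∑ a, x a i ^ 2) / α ^ 2) = (∑ a, x a i ^ 2) / (2 * α) := by field_simp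
  refine le_of_mul_le_mul_left (a := α / 2) ?_ (by positivity)
  linarith

lemma tsum_ridgeCoeff_sq_le [DecidableEq ι]
    (h : IsWellConditioned (tailGram reg x s) (fun a i => x a i) s lam α L N)
    (hlam : ∀ i, 0 < lam i) (hα : 0 < α) (hL : 1 ≤ L) (hN : 0 < N) {τ : ℝ} (hτ0 : 0 ≤ τ)
    (hτ : ∑' i, ENNReal.ofReal (if i ∈ s then 0 else lam i * ∑ a, x a i ^ 2) ≤ ENNReal.ofReal τ) :
    ∑' i, ENNReal.ofReal (lam i * ∑ a, ridgeCoeff reg x i a ^ 2) ≤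
      ENNReal.ofReal (s.card * (8 * L ^ 2 / N) + τ / α ^ 2) := by
  have hterm : ∀ i, ENNReal.ofReal (lam i * ∑ a, ridgeCoeff reg x i a ^ 2) ≤
      (if i ∈ s then ENNReal.ofReal (8 * L ^ 2 / N) else 0) +
        ENNReal.ofReal (α ^ 2)⁻¹ *
          ENNReal.ofReal (if i ∈ s then 0 else lam i * ∑ a, x a i ^ 2) := fun i => by
    split_ifs with hi
    · rw [ENNReal.ofReal_zero, mul_zero, add_zero]
      exact ENNReal.ofReal_le_ofReal (sum_ridgeCoeff_sq_head_le h hlam hα hL hN hi)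
    · rw [zero_add, ← ENNReal.ofReal_mul (by positivity), inv_mul_eq_div, mul_div_assoc]
      exact ENNReal.ofReal_le_ofReal
        (mul_le_mul_of_nonneg_left (sum_ridgeCoeff_sq_le hα h.lower i) (hlam i).le)
  have hhead : ∑' i, (if i ∈ s then ENNReal.ofReal (8 * L ^ 2 / N) else 0) =
      ENNReal.ofReal (s.card * (8 * L ^ 2 / N)) := by
    rw [tsum_eq_sum (s := s) (by simp +contextual), Finset.sum_congr rfl fun i hi => if_pos hi,
      Finset.sum_const, nsmul_eq_mul, ENNReal.ofReal_mul (by positivity), ENNReal.ofReal_natCast]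
  refine (ENNReal.tsum_le_tsum hterm).trans ?_
  rw [ENNReal.tsum_add, ENNReal.tsum_mul_left, hhead,
    ENNReal.ofReal_add (by positivity) (by positivity), div_eq_inv_mul τ,
    ENNReal.ofReal_mul (p := (α ^ 2)⁻¹) (by positivity)]
  gcongr

lemma varianceTerm_le_of_tsum_le (hlam : ∀ i, 0 < lam i) (hΛ : ∀ i, lam i ≤ Λ) {e : Fin n → ℝ}
    {M : ℝ} (hM : 0 ≤ M)
    (h : ∑' i, ENNReal.ofReal (lam i * (∑ a, ridgeCoeff reg x i a * e a) ^ 2) ≤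
      ENNReal.ofReal M) :
    varianceTerm lam reg x e ≤ M := by
  simp_rw [← ridgeEstimator_apply] at h
  rwa [← ENNReal.ofReal_tsum_of_nonneg (fun i => mul_nonneg (hlam i).le (sq_nonneg _))
    (summable_mul_sq_coord hlam hΛ _), ENNReal.ofReal_le_ofReal_iff hM] at h

end RidgeBounds

section Measurability

variable {Ω : Type*} {n : ℕ}

lemma measurable_matrix_det {_ : MeasurableSpace Ω} {A : Ω → Matrix (Fin n) (Fin n) ℝ}
    (hA : ∀ i j, Measurable fun ω => A ω i j) : Measurable fun ω => (A ω).det := by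
  simp_rw [Matrix.det_apply']
  fun_prop

lemma measurable_matrix_inv_apply {_ : MeasurableSpace Ω} {A : Ω → Matrix (Fin n) (Fin n) ℝ}
    (hA : ∀ i j, Measurable fun ω => A ω i j) (i j : Fin n) :
    Measurable fun ω => (A ω)⁻¹ i j := by
  simp_rw [Matrix.inv_def, Ring.inverse_eq_inv', Matrix.smul_apply, smul_eq_mul,
    Matrix.adjugate_apply]
  refine (measurable_matrix_det hA).inv.mul (measurable_matrix_det fun i' j' => ?_)
  by_cases h : i' = j
  · subst h
    simp
  · simpa [Matrix.updateRow_ne h] using hA i' j'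

lemma measurable_inner_of_coord {ι : Type*} [Countable ι] {_ : MeasurableSpace Ω}
    {x y : Ω → FeatureSpace ι} (hx : ∀ i, Measurable fun ω => x ω i)
    (hy : ∀ i, Measurable fun ω => y ω i) : Measurable fun ω => (inner ℝ (x ω) (y ω) : ℝ) := by
  obtain ⟨t, ht⟩ := Filter.exists_seq_tendsto (Filter.atTop : Filter (Finset ι))
  refine measurable_of_tendsto_metrizable (f := fun m ω => ∑ i ∈ t m, y ω i * x ω i)
    (fun m => Finset.measurable_sum _ fun i _ => (hy i).mul (hx i))
    (tendsto_pi_nhds.2 fun ω => ?_)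
  have h : HasSum (fun i => y ω i * x ω i) (inner ℝ (x ω) (y ω)) := by
    simpa using lp.hasSum_inner (𝕜 := ℝ) (x ω) (y ω)
  have h' : Filter.Tendsto (fun s => ∑ i ∈ s, y ω i * x ω i) Filter.atTop
    (nhds (inner ℝ (x ω) (y ω))) := h
  exact h'.comp ht

lemma measurable_ridgeCoeff {ι : Type*} [Countable ι] {_ : MeasurableSpace Ω}
    {X : Fin n → Ω → FeatureSpace ι} (hX : ∀ a i, Measurable fun ω => X a ω i) (reg : ℝ) (i : ι) :
    Measurable fun ω => ridgeCoeff reg (fun a => X a ω) i := by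
  refine measurable_pi_iff.2 fun a => ?_
  simp only [ridgeCoeff, Matrix.mulVec, dotProduct]
  refine Finset.measurable_sum _ fun b _ => (measurable_matrix_inv_apply (fun c d => ?_) a b).mul
    (hX b i)
  simp only [regGram, Matrix.add_apply, Matrix.smul_apply, Matrix.gram_apply]
  exact measurable_const.add (measurable_inner_of_coord (hX c) (hX d))

end Measurability

/-! ### Bias and variance with high probability -/

section RidgeConstant

/-- The constant `C` in the bounds for the bias and the variance, in terms of the sub-gaussian norm
`σx` of the rows and of the parameters `L`, `κ` of `IsTailControlled`. The first two entries bound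
the coefficients of the bias, the last two those of the variance. -/
noncomputable def ridgeConstant (σx L κ : ℝ) : ℝ :=
  max (max (8 * σx ^ 2 * (12 * L ^ 2 + 4) + 2 + 48 * κ * σx ^ 2) (32 * L ^ 4 + 16 * L ^ 2 * κ))
    (max (3456 * L ^ 2) (5184 * σx ^ 2))

lemma ridgeConstant_pos {σx : ℝ} (hσx : σx ≠ 0) (L κ : ℝ) : 0 < ridgeConstant σx L κ :=
  lt_max_of_lt_right (lt_max_of_lt_right (by positivity))

lemma bias_tail_coeff_le_ridgeConstant (σx L κ : ℝ) :
    8 * σx ^ 2 * (12 * L ^ 2 + 4) + 2 + 48 * κ * σx ^ 2 ≤ ridgeConstant σx L κ := by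
  simp only [ridgeConstant, le_max_iff, le_refl, true_or]

lemma bias_head_coeff_le_ridgeConstant (σx L κ : ℝ) :
    32 * L ^ 4 + 16 * L ^ 2 * κ ≤ ridgeConstant σx L κ := by
  simp only [ridgeConstant, le_max_iff, le_refl, true_or, or_true]

lemma variance_head_coeff_le_ridgeConstant (σx L κ : ℝ) : 3456 * L ^ 2 ≤ ridgeConstant σx L κ := by
  simp only [ridgeConstant, le_max_iff, le_refl, true_or, or_true]

lemma variance_tail_coeff_le_ridgeConstant (σx L κ : ℝ) : 5184 * σx ^ 2 ≤ ridgeConstant σx L κ := by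
  simp only [ridgeConstant, le_max_iff, le_refl, or_true]

end RidgeConstant

section TailControl

variable {ι : Type*} [DecidableEq ι] {n : ℕ} {reg : ℝ} {x : Fin n → FeatureSpace ι} {s : Finset ι}
  {lam : ι → ℝ} {α L κ : ℝ}

/-- The event on which the features outside `s` behave: the quadratic form of `tailGram reg x s`
lies between `α` and `L α` times the identity, and that of its covariance-weighted version
`∑_{i ∉ s} λᵢ xᵢ xᵢᵀ` is at most `κ α² / n` times the identity. -/
structure IsTailControlled (reg : ℝ) (x : Fin n → FeatureSpace ι) (s : Finset ι) (lam : ι → ℝ)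
    (α L κ : ℝ) : Prop where
  lower : ∀ v : Fin n → ℝ, α * ∑ a, v a ^ 2 ≤ v ⬝ᵥ tailGram reg x s *ᵥ v
  upper : ∀ v : Fin n → ℝ, v ⬝ᵥ tailGram reg x s *ᵥ v ≤ L * α * ∑ a, v a ^ 2
  weighted : ∀ v : Fin n → ℝ, ∑' i, (if i ∈ s then 0 else lam i * (∑ a, v a * x a i) ^ 2) ≤
    κ * α ^ 2 / n * ∑ a, v a ^ 2

lemma IsTailControlled.isWellConditioned (h : IsTailControlled reg x s lam α L κ)
    (hlam : ∀ i, 0 < lam i) {δ : ℝ} (hδ : δ ≤ n / 2)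
    (hhead : ∀ w : ι → ℝ, |∑ a, (∑ i ∈ s, w i * x a i) ^ 2 - n * ∑ i ∈ s, lam i * w i ^ 2| ≤
      δ * ∑ i ∈ s, lam i * w i ^ 2) :
    IsWellConditioned (tailGram reg x s) (fun a i => x a i) s lam α L n where
  lower := h.lower
  upper := h.upper
  head w := by
    have hw : 0 ≤ ∑ i ∈ s, lam i * w i ^ 2 :=
      Finset.sum_nonneg fun i _ => mul_nonneg (hlam i).le (sq_nonneg _)
    linarith [(abs_le.1 (hhead w)).1, mul_le_mul_of_nonneg_right hδ hw]

lemma tsum_ite_mul_sq_nonneg (hlam : ∀ i, 0 < lam i) (s : Finset ι) (y : ι → ℝ) :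
    0 ≤ ∑' i, if i ∈ s then 0 else lam i * y i ^ 2 :=
  tsum_nonneg fun i => by
    split_ifs
    exacts [le_rfl, mul_nonneg (hlam i).le (sq_nonneg _)]

lemma biasTerm_le_ridgeConstant_mul {Λ σx : ℝ}
    (h : IsWellConditioned (tailGram reg x s) (fun a i => x a i) s lam α L n)
    (hlam : ∀ i, 0 < lam i) (hΛ : ∀ i, lam i ≤ Λ) (hn : 0 < n) (hα : 0 < α) (hL : 1 ≤ L)
    (hκ : 0 ≤ κ)
    (hweighted : ∀ v : Fin n → ℝ, ∑' i, (if i ∈ s then 0 else lam i * (∑ a, v a * x a i) ^ 2) ≤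
      κ * α ^ 2 / n * ∑ a, v a ^ 2) (θ : FeatureSpace ι)
    (hsignal : ∑ a, (inner ℝ (x a) θ - ∑ i ∈ s, x a i * θ i) ^ 2 ≤
      2 * n * (4 * σx ^ 2) * ∑' i, if i ∈ s then 0 else lam i * θ i ^ 2) :
    biasTerm lam reg x θ ≤ ridgeConstant σx L κ *
      ((∑' i, if i ∈ s then 0 else lam i * θ i ^ 2) +
        α ^ 2 / n ^ 2 * ∑ i ∈ s, θ i ^ 2 / lam i) := by
  have hn0 : (0 : ℝ) < n := Nat.cast_pos.2 hn
  have hbias := biasTerm_le h hlam hΛ hα hL hn0 (by positivity) hweighted θ hsignal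
  have hQ := tsum_ite_mul_sq_nonneg hlam s θ
  have hH : 0 ≤ ∑ i ∈ s, θ i ^ 2 / lam i :=
    Finset.sum_nonneg fun i _ => div_nonneg (sq_nonneg _) (hlam i).le
  set Q := ∑' i, if i ∈ s then 0 else lam i * θ i ^ 2
  set H := ∑ i ∈ s, θ i ^ 2 / lam i
  have hcollect : ((12 * L ^ 2 + 4) * (2 * n * (4 * σx ^ 2) * Q) +
        32 * L ^ 4 * α ^ 2 / n * H) / n + 2 * Q +
        2 * (κ * α ^ 2 / n) * (3 * (2 * n * (4 * σx ^ 2) * Q) / α ^ 2 + 8 * L ^ 2 / n * H) =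
      (8 * σx ^ 2 * (12 * L ^ 2 + 4) + 2 + 48 * κ * σx ^ 2) * Q +
        (32 * L ^ 4 + 16 * L ^ 2 * κ) * (α ^ 2 / n ^ 2 * H) := by
    field_simp
    ring
  rw [hcollect] at hbias
  rw [mul_add]
  refine hbias.trans ?_
  gcongr
  exacts [bias_tail_coeff_le_ridgeConstant σx L κ, bias_head_coeff_le_ridgeConstant σx L κ]

lemma varianceTerm_le_ridgeConstant_mul {Λ σx σε t : ℝ}
    (h : IsWellConditioned (tailGram reg x s) (fun a i => x a i) s lam α L n)
    (hlam : ∀ i, 0 < lam i) (hΛ : ∀ i, lam i ≤ Λ) (hn : 0 < n) (hα : 0 < α) (hL : 1 ≤ L)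
    (κ : ℝ) (ht : 1 ≤ t)
    (htrace : ∑' i, ENNReal.ofReal (if i ∈ s then 0 else lam i * ∑ a, x a i ^ 2) ≤
      ENNReal.ofReal (3 * n * (4 * σx ^ 2) * ∑' i, if i ∈ s then 0 else lam i ^ 2))
    {e : Fin n → ℝ}
    (hnoise : ∑' i, ENNReal.ofReal (lam i * (∑ a, ridgeCoeff reg x i a * e a) ^ 2) ≤
      ENNReal.ofReal (144 * σε ^ 2 * (t + 2)) *
        ∑' i, ENNReal.ofReal (lam i * ∑ a, ridgeCoeff reg x i a ^ 2)) :
    varianceTerm lam reg x e ≤ ridgeConstant σx L κ * (σε ^ 2 * t) *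
      ((s.card : ℝ) / n + n * (∑' i, if i ∈ s then 0 else lam i ^ 2) / α ^ 2) := by
  have hn0 : (0 : ℝ) < n := Nat.cast_pos.2 hn
  have hS : 0 ≤ ∑' i, if i ∈ s then 0 else lam i ^ 2 :=
    tsum_nonneg fun i => by split_ifs <;> positivity
  set S := ∑' i, if i ∈ s then 0 else lam i ^ 2
  have hcoeff := tsum_ridgeCoeff_sq_le h hlam hα hL hn0 (by positivity) htrace
  have hbound := hnoise.trans (mul_le_mul_right hcoeff _)
  rw [← ENNReal.ofReal_mul (by positivity)] at hbound
  refine (varianceTerm_le_of_tsum_le hlam hΛ (by positivity) hbound).trans ?_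
  calc 144 * σε ^ 2 * (t + 2) * (s.card * (8 * L ^ 2 / n) + 3 * n * (4 * σx ^ 2) * S / α ^ 2)
      ≤ 144 * σε ^ 2 * (t + 2 * t) *
          (s.card * (8 * L ^ 2 / n) + 3 * n * (4 * σx ^ 2) * S / α ^ 2) := by gcongr; linarith
    _ = σε ^ 2 * t * (3456 * L ^ 2 * (s.card / n) + 5184 * σx ^ 2 * (n * S / α ^ 2)) := by ring
    _ ≤ σε ^ 2 * t * (ridgeConstant σx L κ * (s.card / n) +
          ridgeConstant σx L κ * (n * S / α ^ 2)) := by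
        gcongr
        exacts [variance_head_coeff_le_ridgeConstant σx L κ,
          variance_tail_coeff_le_ridgeConstant σx L κ]
    _ = _ := by ring

end TailControl

section UnionBound

variable {Ω : Type*} [MeasurableSpace Ω] {μ : Measure Ω} {A B : Set Ω} {a b : ℝ}

lemma measureReal_union_le_of_le (hA : μ.real A ≤ a) (hB : μ.real B ≤ b) :
    μ.real (A ∪ B) ≤ a + b :=
  (measureReal_union_le A B).trans (add_le_add hA hB)

lemma one_sub_le_measureReal_of_compl_subset [IsProbabilityMeasure μ] (hAB : Aᶜ ⊆ B)
    (hB : μ.real B ≤ b) : 1 - b ≤ μ.real A := by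
  have hcompl := (measureReal_mono hAB (measure_ne_top μ B)).trans hB
  have hunion := measureReal_union_le (μ := μ) A Aᶜ
  rw [Set.union_compl_self, probReal_univ] at hunion
  linarith

end UnionBound

namespace RidgeModel

variable {Ω ι : Type*} [MeasurableSpace Ω] {μ : Measure Ω} [IsProbabilityMeasure μ] {n : ℕ}
  {lam : ι → ℝ} {σx σε : ℝ} {X : Fin n → Ω → FeatureSpace ι} {ε : Ω → Fin n → ℝ}

-- The `ψ₂` tail bound needs `σε > 0`; if `σε = 0`, the noise vanishes almost surely.
lemma exists_noise_event [Countable ι] (hM : RidgeModel μ n lam σx σε X ε) (hσε : 0 ≤ σε)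
    (reg : ℝ) {t : ℝ} (ht : 0 ≤ t) :
    ∃ E : Set Ω, μ.real E ≤ Real.exp (-t) ∧ ∀ ω ∉ E,
      ∑' i, ENNReal.ofReal (lam i * (∑ a, ridgeCoeff reg (fun a => X a ω) i a * ε ω a) ^ 2) ≤
        ENNReal.ofReal (144 * σε ^ 2 * (t + 2)) *
          ∑' i, ENNReal.ofReal (lam i * ∑ a, ridgeCoeff reg (fun a => X a ω) i a ^ 2) := by
  rcases hσε.eq_or_lt with rfl | hpos
  · refine ⟨{ω | ¬ ∀ a, ε ω a = 0}, ?_, fun ω hω => ?_⟩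
    · have hae : ∀ᵐ ω ∂μ, ∀ a, ε ω a = 0 := ae_all_iff.2 fun a =>
        ae_eq_zero_of_psi2Norm_eq_zero (hM.measurable_noise a)
          (by simpa using hM.noise_subgaussian a)
      rw [measureReal_def, ae_iff.1 hae, ENNReal.toReal_zero]
      positivity
    · have hzero : ∀ a, ε ω a = 0 := not_not.1 hω
      simp [hzero]
  · refine ⟨_, hM.measureReal_noise_le hpos
      (U := fun i ω => ridgeCoeff reg (fun a => X a ω) i) (fun i => ?_) ht, fun ω hω => not_lt.1 hω⟩
    refine @measurable_ridgeCoeff Ω n ι _ (MeasurableSpace.comap _ _) X (fun a j => ?_) reg i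
    have heval : Measurable fun y : Fin n → ι → ℝ => y a j := by fun_prop
    exact heval.comp (comap_measurable fun ω (a : Fin n) i => X a ω i)

lemma one_sub_le_measureReal_of_isTailControlled [Countable ι] [DecidableEq ι]
    (hM : RidgeModel μ n lam σx σε X ε) (hlam : ∀ i, 0 < lam i) {Λ : ℝ} (hΛ : ∀ i, lam i ≤ Λ)
    (hlam2 : Summable fun i => lam i ^ 2) (hσx : 0 < σx) (hσε : 0 ≤ σε) (hn : 0 < n)
    {s : Finset ι} {r : ℝ} (hs : (s.card : ℝ) ≤ r) (hr : r ≤ n)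
    (hrn : 448 * (4 * σx ^ 2) * √(n * r) ≤ n / 2) {t : ℝ} (ht : 1 ≤ t) {reg α L κ η : ℝ}
    (hα : 0 < α) (hL : 1 ≤ L) (hκ : 0 ≤ κ)
    (htail : μ.real {ω | ¬ IsTailControlled reg (fun a => X a ω) s lam α L κ} ≤ η)
    (θ : FeatureSpace ι) :
    1 - (η + (2 * Real.exp (-r) + (Real.exp (-n) + (Real.exp (-n) + Real.exp (-t))))) ≤
      μ.real {ω | IsUnit (regGram reg (fun a => X a ω)).det ∧
        biasTerm lam reg (fun a => X a ω) θ ≤ ridgeConstant σx L κ *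
          ((∑' i, if i ∈ s then 0 else lam i * θ i ^ 2) +
            α ^ 2 / n ^ 2 * ∑ i ∈ s, θ i ^ 2 / lam i) ∧
        varianceTerm lam reg (fun a => X a ω) (ε ω) ≤ ridgeConstant σx L κ * (σε ^ 2 * t) *
          ((s.card : ℝ) / n + n * (∑' i, if i ∈ s then 0 else lam i ^ 2) / α ^ 2)} := by
  obtain ⟨E, hE, hnoise⟩ := hM.exists_noise_event hσε reg (t := t) (by linarith)
  have hhead := hM.measureReal_head_le hlam hσx s hs hr
  have hsignal := hM.measureReal_tail_signal_le hlam hσx s θ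
    (hasSum_ite_mem_zero (summable_mul_sq_coord hlam hΛ θ).hasSum s).summable
  have htrace := hM.measureReal_tail_trace_le hlam hσx hn s
    (hasSum_ite_mem_zero hlam2.hasSum s).summable
  refine one_sub_le_measureReal_of_compl_subset (fun ω hω => ?_) <|
    measureReal_union_le_of_le htail <| measureReal_union_le_of_le hhead <|
      measureReal_union_le_of_le hsignal <| measureReal_union_le_of_le htrace hE
  by_contra hgood
  simp only [Set.mem_union, Set.mem_ofPred_eq, not_or, not_not, not_exists, not_lt] at hgood
  obtain ⟨htailω, hheadω, hsignalω, htraceω, hnoiseω⟩ := hgood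
  have hcond := htailω.isWellConditioned hlam hrn hheadω
  exact hω ⟨isUnit_det_regGram hα hcond.lower,
    biasTerm_le_ridgeConstant_mul hcond hlam hΛ hn hα hL hκ htailω.weighted θ hsignalω,
    varianceTerm_le_ridgeConstant_mul hcond hlam hΛ hn hα hL κ ht htraceω (hnoise ω hnoiseω)⟩

end RidgeModel

section Regime

/-- Deviation of the whitened head Gram matrix from its mean, in units of `√(n r)`, where `r ≤ n`
bounds the number of head features. -/
noncomputable def headDeviation (σx : ℝ) : ℝ := 448 * (4 * σx ^ 2)

/-- Deviation of the whitened tail Gram matrix with independent components from its mean, in units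
of `√(p n)`. -/
noncomputable def tailDeviation (σx : ℝ) : ℝ := 448 * (36 * (4 * σx ^ 2))

/-- The constant `c_x` of the theorem: the head dimension and `t` have to be at most `n / c_x`, and
for a spiked covariance the dimension at least `c_x n`. -/
noncomputable def sampleRatio (σx : ℝ) : ℝ :=
  4 * headDeviation σx ^ 2 + 16 * tailDeviation σx ^ 2 + 2 * tailDeviation σx + 100

variable {σx : ℝ}

lemma tailDeviation_nonneg (σx : ℝ) : 0 ≤ tailDeviation σx := by
  unfold tailDeviation
  positivity

lemma four_mul_headDeviation_sq_le_sampleRatio (σx : ℝ) :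
    4 * headDeviation σx ^ 2 ≤ sampleRatio σx := by
  have htail := tailDeviation_nonneg σx
  rw [sampleRatio, add_assoc, add_assoc]
  exact le_add_of_nonneg_right (by positivity)

lemma sixteen_mul_tailDeviation_sq_le_sampleRatio (σx : ℝ) :
    16 * tailDeviation σx ^ 2 ≤ sampleRatio σx := by
  have htail := tailDeviation_nonneg σx
  rw [sampleRatio]
  linarith [sq_nonneg (headDeviation σx)]

lemma two_mul_tailDeviation_add_le_sampleRatio (σx : ℝ) :
    2 * tailDeviation σx + 100 ≤ sampleRatio σx := by
  rw [sampleRatio]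
  linarith [sq_nonneg (headDeviation σx), sq_nonneg (tailDeviation σx)]

lemma hundred_le_sampleRatio (σx : ℝ) : 100 ≤ sampleRatio σx := by
  linarith [tailDeviation_nonneg σx, two_mul_tailDeviation_add_le_sampleRatio σx]

lemma sampleRatio_pos (σx : ℝ) : 0 < sampleRatio σx := by linarith [hundred_le_sampleRatio σx]

lemma sampleSize_pos {n : ℕ} {t : ℝ} (hct : sampleRatio σx < t) (htn : t < n / sampleRatio σx) :
    0 < n := by
  have hc := sampleRatio_pos σx
  exact Nat.cast_pos.1 ((div_pos_iff_of_pos_right hc).1 (hc.trans (hct.trans htn)))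

lemma mul_sqrt_mul_div_le_half {A n c : ℝ} (hA : 0 < A) (hn : 0 ≤ n) (hc : 4 * A ^ 2 ≤ c) :
    A * √(n * (n / c)) ≤ n / 2 := by
  have hsqrt : √(n * (n / c)) ≤ n / (2 * A) := by
    refine Real.sqrt_le_iff.2 ⟨by positivity, ?_⟩
    calc n * (n / c) = n ^ 2 / c := by ring
      _ ≤ n ^ 2 / (4 * A ^ 2) := div_le_div_of_nonneg_left (sq_nonneg n) (by positivity) hc
      _ = (n / (2 * A)) ^ 2 := by ring
  calc A * √(n * (n / c)) ≤ A * (n / (2 * A)) := mul_le_mul_of_nonneg_left hsqrt hA.le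
    _ = n / 2 := by field_simp

lemma failure_probability_le {n c t η : ℝ} (hc : 1 ≤ c) (ht : 0 ≤ t) (htn : t ≤ n / c)
    (hη : η ≤ 2 * Real.exp (-n)) :
    η + (2 * Real.exp (-(n / c)) + (Real.exp (-n) + (Real.exp (-n) + Real.exp (-t)))) ≤
      20 * Real.exp (-t / c) := by
  have hc0 : 0 < c := by linarith
  have hn : 0 ≤ n := by simpa only [zero_mul] using (le_div_iff₀ hc0).1 (ht.trans htn)
  have htc : t / c ≤ t := div_le_self ht hc
  have hnc : n / c ≤ n := div_le_self hn hc
  rw [neg_div]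
  have hexp_ratio : Real.exp (-(n / c)) ≤ Real.exp (-(t / c)) := Real.exp_le_exp.2 (by linarith)
  have hexp_sample : Real.exp (-n) ≤ Real.exp (-(t / c)) := Real.exp_le_exp.2 (by linarith)
  have hexp_t : Real.exp (-t) ≤ Real.exp (-(t / c)) := Real.exp_le_exp.2 (by linarith)
  linarith [Real.exp_pos (-(t / c))]

lemma RidgeModel.one_sub_le_measureReal_of_card_lt {Ω ι : Type*} [MeasurableSpace Ω]
    {μ : Measure Ω} [IsProbabilityMeasure μ] [Countable ι] [DecidableEq ι] {n : ℕ} {lam : ι → ℝ}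
    {σε : ℝ} {X : Fin n → Ω → FeatureSpace ι} {ε : Ω → Fin n → ℝ}
    (hM : RidgeModel μ n lam σx σε X ε) (hlam : ∀ i, 0 < lam i) {Λ : ℝ} (hΛ : ∀ i, lam i ≤ Λ)
    (hlam2 : Summable fun i => lam i ^ 2) (hσx : 0 < σx) (hσε : 0 ≤ σε) {s : Finset ι}
    (hs : (s.card : ℝ) < n / sampleRatio σx) {t : ℝ} (hct : sampleRatio σx < t)
    (htn : t < n / sampleRatio σx) {reg α L κ η : ℝ} (hα : 0 < α) (hL : 1 ≤ L) (hκ : 0 ≤ κ)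
    (htail : μ.real {ω | ¬ IsTailControlled reg (fun a => X a ω) s lam α L κ} ≤ η)
    (hη : η ≤ 2 * Real.exp (-n)) (θ : FeatureSpace ι) :
    1 - 20 * Real.exp (-t / sampleRatio σx) ≤
      μ.real {ω | IsUnit (regGram reg (fun a => X a ω)).det ∧
        biasTerm lam reg (fun a => X a ω) θ ≤ ridgeConstant σx L κ *
          ((∑' i, if i ∈ s then 0 else lam i * θ i ^ 2) +
            α ^ 2 / n ^ 2 * ∑ i ∈ s, θ i ^ 2 / lam i) ∧
        varianceTerm lam reg (fun a => X a ω) (ε ω) ≤ ridgeConstant σx L κ * (σε ^ 2 * t) *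
          ((s.card : ℝ) / n + n * (∑' i, if i ∈ s then 0 else lam i ^ 2) / α ^ 2)} := by
  have hc := hundred_le_sampleRatio σx
  have hdeviation : 448 * (4 * σx ^ 2) * √(n * (n / sampleRatio σx)) ≤ n / 2 :=
    mul_sqrt_mul_div_le_half (by positivity) n.cast_nonneg
      (four_mul_headDeviation_sq_le_sampleRatio σx)
  refine le_trans ?_ (hM.one_sub_le_measureReal_of_isTailControlled hlam hΛ hlam2 hσx hσε
    (sampleSize_pos hct htn) hs.le (div_le_self n.cast_nonneg (by linarith)) hdeviation
    (by linarith : 1 ≤ t) hα hL hκ htail θ)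
  have hfailure := failure_probability_le (by linarith) (by linarith) htn.le hη
  linarith

end Regime

/-! ### Exponentially decaying eigenvalues -/

section ExpEigenvalues

lemma tsum_ite_mem_range (k : ℕ) (f : ℕ → ℝ) :
    (∑' i, if i ∈ Finset.range k then 0 else f i) = ∑' j, f (k + j) := by
  rw [← (add_right_injective k).tsum_eq (f := fun i => if i ∈ Finset.range k then 0 else f i)]
  · simp
  · intro i hi
    have hki : k ≤ i := by
      by_contra h
      exact hi (by simp [not_le.1 h])
    exact ⟨i - k, Nat.add_sub_cancel' hki⟩

lemma expEigenvalues_pos (γ : ℝ) (j : ℕ) : 0 < expEigenvalues γ j := Real.exp_pos _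

lemma expEigenvalues_add (γ : ℝ) (k j : ℕ) :
    expEigenvalues γ (k + j) = expEigenvalues γ k * Real.exp (-γ) ^ j := by
  simp only [expEigenvalues]
  rw [← Real.exp_nat_mul, ← Real.exp_add]
  congr 1
  push_cast
  ring

variable {γ : ℝ}

lemma expEigenvalues_le_one (hγ : 0 ≤ γ) (j : ℕ) : expEigenvalues γ j ≤ 1 :=
  Real.exp_le_one_iff.2 (mul_nonpos_of_nonpos_of_nonneg (neg_nonpos.2 hγ) (by positivity))

lemma expEigenvalues_add_le (hγ : 0 ≤ γ) (k j : ℕ) :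
    expEigenvalues γ (k + j) ≤ expEigenvalues γ k := by
  rw [expEigenvalues_add]
  exact mul_le_of_le_one_right (expEigenvalues_pos γ k).le
    (pow_le_one₀ (Real.exp_pos _).le (Real.exp_le_one_iff.2 (neg_nonpos.2 hγ)))

lemma expEigenvalues_block_le {a : ℝ} {n : ℕ} (hγ : 0 ≤ γ) (ha : a ≤ γ * n) (k b j : ℕ) :
    expEigenvalues γ (k + (b * n + j)) ≤ expEigenvalues γ k * Real.exp (-a) ^ b := by
  rw [← add_assoc]
  refine (expEigenvalues_add_le hγ _ _).trans ?_
  rw [expEigenvalues_add, mul_comm b, pow_mul, ← Real.exp_nat_mul]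
  have hpos := (expEigenvalues_pos γ k).le
  gcongr
  linarith

lemma hasSum_expEigenvalues_sq (hγ : 0 < γ) (k : ℕ) :
    HasSum (fun j => expEigenvalues γ (k + j) ^ 2)
      (expEigenvalues γ k ^ 2 / (1 - Real.exp (-2 * γ))) := by
  have hlt : Real.exp (-2 * γ) < 1 := Real.exp_lt_one_iff.2 (by linarith)
  have h := (hasSum_geometric_of_lt_one (Real.exp_pos _).le hlt).mul_left (expEigenvalues γ k ^ 2)
  rw [div_eq_mul_inv]
  convert! h using 1
  funext j
  rw [expEigenvalues_add, mul_pow, ← pow_mul, mul_comm j 2, pow_mul, ← Real.exp_nat_mul]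
  congr 3
  push_cast
  ring

lemma tsum_tail_expEigenvalues_mul_sq (γ : ℝ) (k : ℕ) (θ : ℕ → ℝ) :
    (∑' i, if i ∈ Finset.range k then 0 else expEigenvalues γ i * θ i ^ 2) =
      ∑' j : ℕ, θ (k + j) ^ 2 * Real.exp (-γ * ((k : ℝ) + j + 1)) := by
  rw [tsum_ite_mem_range k fun i => expEigenvalues γ i * θ i ^ 2]
  refine tsum_congr fun j => ?_
  rw [mul_comm, expEigenvalues, Nat.cast_add]

lemma sum_head_sq_div_expEigenvalues {n : ℕ} (hn : n ≠ 0) (γ : ℝ) (k : ℕ) (θ : ℕ → ℝ) :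
    ((n : ℝ) * expEigenvalues γ k) ^ 2 / n ^ 2 *
        ∑ i ∈ Finset.range k, θ i ^ 2 / expEigenvalues γ i =
      ∑ j ∈ Finset.range k,
        θ j ^ 2 * Real.exp (-γ * (2 * ((k : ℝ) + 1) - ((j : ℝ) + 1))) := by
  rw [mul_pow, mul_div_cancel_left₀ _ (by positivity), Finset.mul_sum]
  refine Finset.sum_congr rfl fun j _ => ?_
  have hexp : Real.exp (-γ * (2 * ((k : ℝ) + 1) - ((j : ℝ) + 1))) =
      expEigenvalues γ k ^ 2 / expEigenvalues γ j := by
    rw [expEigenvalues, expEigenvalues, ← Real.exp_nat_mul, ← Real.exp_sub]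
    congr 1
    push_cast
    ring
  rw [hexp]
  ring

lemma mul_tsum_tail_expEigenvalues_sq_div {n : ℕ} (hγ : 0 < γ) (hn : n ≠ 0) (k : ℕ) :
    (n : ℝ) * (∑' i, if i ∈ Finset.range k then 0 else expEigenvalues γ i ^ 2) /
      (n * expEigenvalues γ k) ^ 2 = 1 / (n * (1 - Real.exp (-2 * γ))) := by
  have hlt : Real.exp (-2 * γ) < 1 := Real.exp_lt_one_iff.2 (by linarith)
  have hpos := expEigenvalues_pos γ k
  have hn0 : (n : ℝ) ≠ 0 := Nat.cast_ne_zero.2 hn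
  rw [tsum_ite_mem_range k fun i => expEigenvalues γ i ^ 2, (hasSum_expEigenvalues_sq hγ k).tsum_eq]
  generalize hd : 1 - Real.exp (-2 * γ) = d
  have hd0 : d ≠ 0 := by linarith
  field_simp

/-- The bound, in units of `n λ_{k+1}`, for the largest eigenvalue of the tail Gram matrix. -/
noncomputable def expTailConstant (σx a : ℝ) : ℝ := 160 * (4 * σx ^ 2) / (1 - Real.exp (-a))

lemma expTailConstant_nonneg (σx : ℝ) {a : ℝ} (ha : 0 ≤ a) : 0 ≤ expTailConstant σx a :=
  div_nonneg (by positivity) (sub_nonneg.2 (Real.exp_le_one_iff.2 (neg_nonpos.2 ha)))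

lemma summable_sq_designTransposeMul_add {n : ℕ} (x : Fin n → FeatureSpace ℕ) (v : Fin n → ℝ)
    (k : ℕ) : Summable fun j => (∑ a, v a * x a (k + j)) ^ 2 := by
  simpa only [designTransposeMul_apply, Function.comp_def] using
    (hasSum_sq_coord (designTransposeMul x v)).summable.comp_injective (add_right_injective k)

lemma isTailControlled_expEigenvalues {n k : ℕ} {M : ℝ} {x : Fin n → FeatureSpace ℕ}
    (hγ : 0 ≤ γ) (hn : n ≠ 0)
    (hbound : ∀ v : Fin n → ℝ, ∑' j, (∑ a, v a * x a (k + j)) ^ 2 ≤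
      M * (n * expEigenvalues γ k) * ∑ a, v a ^ 2) :
    IsTailControlled (n * expEigenvalues γ k) x (Finset.range k) (expEigenvalues γ)
      (n * expEigenvalues γ k) (1 + M) M := by
  have hn0 : (n : ℝ) ≠ 0 := Nat.cast_ne_zero.2 hn
  have hpos := expEigenvalues_pos γ k
  have hquad : ∀ v : Fin n → ℝ,
      v ⬝ᵥ tailGram (n * expEigenvalues γ k) x (Finset.range k) *ᵥ v =
        n * expEigenvalues γ k * ∑ a, v a ^ 2 + ∑' j, (∑ a, v a * x a (k + j)) ^ 2 := fun v => by
    rw [dotProduct_tailGram_mulVec, tsum_ite_mem_range k fun i => (∑ a, v a * x a i) ^ 2]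
  refine ⟨fun v => ?_, fun v => ?_, fun v => ?_⟩
  · rw [hquad]
    exact le_add_of_nonneg_right (tsum_nonneg fun _ => sq_nonneg _)
  · rw [hquad]
    linarith [hbound v]
  · have hsum := summable_sq_designTransposeMul_add x v k
    have hterm : ∀ j, expEigenvalues γ (k + j) * (∑ a, v a * x a (k + j)) ^ 2 ≤
        expEigenvalues γ k * (∑ a, v a * x a (k + j)) ^ 2 := fun j =>
      mul_le_mul_of_nonneg_right (expEigenvalues_add_le hγ k j) (sq_nonneg _)
    have hsum_left := Summable.of_nonneg_of_le
      (fun j => mul_nonneg (expEigenvalues_pos γ (k + j)).le (sq_nonneg _)) hterm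
      (hsum.mul_left (expEigenvalues γ k))
    rw [tsum_ite_mem_range k fun i => expEigenvalues γ i * (∑ a, v a * x a i) ^ 2]
    calc ∑' j, expEigenvalues γ (k + j) * (∑ a, v a * x a (k + j)) ^ 2
        ≤ expEigenvalues γ k * ∑' j, (∑ a, v a * x a (k + j)) ^ 2 := by
          rw [← tsum_mul_left]
          exact hsum_left.tsum_le_tsum hterm (hsum.mul_left _)
      _ ≤ expEigenvalues γ k * (M * (n * expEigenvalues γ k) * ∑ a, v a ^ 2) := by
          gcongr
          exact hbound v
      _ = M * (n * expEigenvalues γ k) ^ 2 / n * ∑ a, v a ^ 2 := by field_simp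

end ExpEigenvalues

namespace RidgeModel

variable {Ω : Type*} [MeasurableSpace Ω] {μ : Measure Ω} [IsProbabilityMeasure μ] {n : ℕ}
  {σx σε γ a : ℝ} {X : Fin n → Ω → FeatureSpace ℕ} {ε : Ω → Fin n → ℝ}

lemma measureReal_not_isTailControlled_expEigenvalues_le
    (hM : RidgeModel μ n (expEigenvalues γ) σx σε X ε) (hσx : 0 < σx) (hn : n ≠ 0) (ha : 0 < a)
    (hγ : a / n ≤ γ) (k : ℕ) :
    μ.real {ω | ¬ IsTailControlled (n * expEigenvalues γ k) (fun b => X b ω) (Finset.range k)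
      (expEigenvalues γ) (n * expEigenvalues γ k) (1 + expTailConstant σx a)
      (expTailConstant σx a)} ≤ Real.exp (-n) := by
  have hn0 : (0 : ℝ) < n := Nat.cast_pos.2 (Nat.pos_of_ne_zero hn)
  have hγ0 : 0 ≤ γ := (div_pos ha hn0).le.trans hγ
  have hpos := expEigenvalues_pos γ k
  have hnonneg := expTailConstant_nonneg σx ha.le
  have hbound := hM.measureReal_tail_gram_le_of_geometric (expEigenvalues_pos γ) hσx hn k hpos.le
    (Real.exp_pos (-a)).le (Real.exp_lt_one_iff.2 (by linarith))
    fun b j => expEigenvalues_block_le hγ0 ((div_le_iff₀ hn0).1 hγ) k b j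
  refine (measureReal_mono (fun ω hω => ?_) (measure_ne_top _ _)).trans hbound
  by_contra hgood
  simp only [Set.mem_ofPred_eq, not_exists, not_lt] at hgood
  refine hω (isTailControlled_expEigenvalues hγ0 hn fun v => ?_)
  have hconst : 160 * n * (4 * σx ^ 2) * (expEigenvalues γ k / (1 - Real.exp (-a))) =
      expTailConstant σx a * (n * expEigenvalues γ k) := by
    rw [expTailConstant]
    ring
  have hsum := summable_sq_designTransposeMul_add (fun b => X b ω) v k
  have hv := hgood v
  rw [hconst, ← ENNReal.ofReal_tsum_of_nonneg (fun _ => sq_nonneg _) hsum] at hv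
  exact (ENNReal.ofReal_le_ofReal_iff (by positivity)).1 hv

lemma one_sub_le_measureReal_expEigenvalues
    (hM : RidgeModel μ n (expEigenvalues γ) σx σε X ε) (hσx : 0 < σx) (hσε : 0 ≤ σε) (ha : 0 < a)
    (hγ : a / n ≤ γ) {k : ℕ} (hk : (k : ℝ) < n / sampleRatio σx) {t : ℝ}
    (hct : sampleRatio σx < t) (htn : t < n / sampleRatio σx) (θ : FeatureSpace ℕ) :
    1 - 20 * Real.exp (-t / sampleRatio σx) ≤ μ.real {ω |
      IsUnit (regGram (n * Real.exp (-γ * (k + 1))) (fun b => X b ω)).det ∧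
      biasTerm (expEigenvalues γ) (n * Real.exp (-γ * (k + 1))) (fun b => X b ω) θ ≤
        ridgeConstant σx (1 + expTailConstant σx a) (expTailConstant σx a) *
          ((∑' j : ℕ, θ (k + j) ^ 2 * Real.exp (-γ * ((k : ℝ) + j + 1))) +
            ∑ j ∈ Finset.range k,
              θ j ^ 2 * Real.exp (-γ * (2 * ((k : ℝ) + 1) - ((j : ℝ) + 1)))) ∧
      varianceTerm (expEigenvalues γ) (n * Real.exp (-γ * (k + 1))) (fun b => X b ω) (ε ω) ≤
        ridgeConstant σx (1 + expTailConstant σx a) (expTailConstant σx a) * (σε ^ 2 * t) *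
          ((k : ℝ) / n + 1 / (n * (1 - Real.exp (-2 * γ))))} := by
  have hn := sampleSize_pos hct htn
  have hn0 : (0 : ℝ) < n := Nat.cast_pos.2 hn
  have hγ0 : 0 < γ := (div_pos ha hn0).trans_le hγ
  have hnonneg := expTailConstant_nonneg σx ha.le
  have hsquares : Summable fun i => expEigenvalues γ i ^ 2 := by
    simpa only [zero_add] using (hasSum_expEigenvalues_sq hγ0 0).summable
  have hmain := hM.one_sub_le_measureReal_of_card_lt (expEigenvalues_pos γ)
    (expEigenvalues_le_one hγ0.le) hsquares hσx hσε (s := Finset.range k)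
    (by rwa [Finset.card_range]) hct htn (mul_pos hn0 (expEigenvalues_pos γ k))
    (le_add_of_nonneg_right hnonneg) hnonneg
    (hM.measureReal_not_isTailControlled_expEigenvalues_le hσx hn.ne' ha hγ k)
    (by linarith [Real.exp_pos (-(n : ℝ))]) θ
  rwa [tsum_tail_expEigenvalues_mul_sq, sum_head_sq_div_expEigenvalues hn.ne',
    mul_tsum_tail_expEigenvalues_sq_div hγ0 hn.ne', Finset.card_range] at hmain

end RidgeModel

/-! ### Spiked covariance -/

section SpikedEigenvalues

lemma tsum_ite_mem_eq_sum_compl {ι : Type*} [Fintype ι] [DecidableEq ι] (s : Finset ι)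
    (f : ι → ℝ) : (∑' i, if i ∈ s then 0 else f i) = ∑ i ∈ sᶜ, f i := by
  rw [tsum_fintype, ← Finset.sum_add_sum_compl s,
    Finset.sum_eq_zero fun i hi => if_pos hi, zero_add]
  exact Finset.sum_congr rfl fun i hi => if_neg (Finset.mem_compl.1 hi)

/-- The first `k` features, which carry the large eigenvalue of a spiked covariance. -/
def headIndices (p k : ℕ) : Finset (Fin p) := Finset.univ.filter fun i => (i : ℕ) < k

variable {p k : ℕ} {top tail : ℝ}

lemma mem_headIndices {i : Fin p} : i ∈ headIndices p k ↔ (i : ℕ) < k := by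
  rw [headIndices, Finset.mem_filter, and_iff_right (Finset.mem_univ i)]

lemma card_headIndices (hkp : k ≤ p) : (headIndices p k).card = k := by
  rw [headIndices, Fin.card_filter_val_lt, min_eq_right hkp]

lemma card_compl_headIndices (hkp : k ≤ p) : ((headIndices p k)ᶜ.card : ℝ) = p - k := by
  rw [Finset.card_compl, card_headIndices hkp, Fintype.card_fin, Nat.cast_sub hkp]

lemma spikedEigenvalues_of_mem {i : Fin p} (hi : i ∈ headIndices p k) :
    spikedEigenvalues p k top tail i = top := if_pos (mem_headIndices.1 hi)

lemma spikedEigenvalues_of_mem_compl {i : Fin p} (hi : i ∈ (headIndices p k)ᶜ) :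
    spikedEigenvalues p k top tail i = tail :=
  if_neg fun h => Finset.mem_compl.1 hi (mem_headIndices.2 h)

lemma spikedEigenvalues_pos (htop : 0 < top) (htail : 0 < tail) (i : Fin p) :
    0 < spikedEigenvalues p k top tail i := by
  unfold spikedEigenvalues
  split_ifs <;> assumption

lemma spikedEigenvalues_le (htop : tail ≤ top) (i : Fin p) :
    spikedEigenvalues p k top tail i ≤ top := by
  unfold spikedEigenvalues
  split_ifs
  exacts [le_rfl, htop]

lemma headNormSq_eq_sum (k : ℕ) (θ : FeatureSpace (Fin p)) :
    headNormSq k θ = ∑ i ∈ headIndices p k, θ i ^ 2 := (Finset.sum_filter _ _).symm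

lemma tailNormSq_eq_sum (k : ℕ) (θ : FeatureSpace (Fin p)) :
    tailNormSq k θ = ∑ i ∈ (headIndices p k)ᶜ, θ i ^ 2 := by
  rw [tailNormSq, ← Finset.sum_filter]
  refine Finset.sum_congr (Finset.ext fun i => ?_) fun _ _ => rfl
  rw [Finset.mem_compl, mem_headIndices, not_lt, Finset.mem_filter,
    and_iff_right (Finset.mem_univ i)]

lemma headNormSq_nonneg (k : ℕ) (θ : FeatureSpace (Fin p)) : 0 ≤ headNormSq k θ :=
  (headNormSq_eq_sum k θ).symm ▸ Finset.sum_nonneg fun _ _ => sq_nonneg _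

lemma tailNormSq_nonneg (k : ℕ) (θ : FeatureSpace (Fin p)) : 0 ≤ tailNormSq k θ :=
  (tailNormSq_eq_sum k θ).symm ▸ Finset.sum_nonneg fun _ _ => sq_nonneg _

lemma tsum_tail_spikedEigenvalues_mul_sq (θ : FeatureSpace (Fin p)) :
    (∑' i, if i ∈ headIndices p k then 0 else spikedEigenvalues p k top tail i * θ i ^ 2) =
      tailNormSq k θ * tail := by
  rw [tsum_ite_mem_eq_sum_compl, tailNormSq_eq_sum, Finset.sum_mul]
  exact Finset.sum_congr rfl fun i hi => by rw [spikedEigenvalues_of_mem_compl hi, mul_comm]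

lemma sum_head_sq_div_spikedEigenvalues (θ : FeatureSpace (Fin p)) :
    ∑ i ∈ headIndices p k, θ i ^ 2 / spikedEigenvalues p k top tail i =
      headNormSq k θ / top := by
  rw [headNormSq_eq_sum, Finset.sum_div]
  exact Finset.sum_congr rfl fun i hi => by rw [spikedEigenvalues_of_mem hi]

lemma tsum_tail_spikedEigenvalues_sq_le (hkp : k ≤ p) :
    (∑' i, if i ∈ headIndices p k then 0 else spikedEigenvalues p k top tail i ^ 2) ≤
      p * tail ^ 2 := by
  rw [tsum_ite_mem_eq_sum_compl,
    Finset.sum_congr rfl fun i hi => by rw [spikedEigenvalues_of_mem_compl hi],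
    Finset.sum_const, nsmul_eq_mul, card_compl_headIndices hkp]
  exact mul_le_mul_of_nonneg_right (sub_le_self _ k.cast_nonneg) (sq_nonneg _)

lemma sum_tail_sq_eq_mul_sum_div (htail : tail ≠ 0) (y : Fin p → ℝ) :
    ∑ i ∈ (headIndices p k)ᶜ, y i ^ 2 =
      tail * ∑ i ∈ (headIndices p k)ᶜ, y i ^ 2 / spikedEigenvalues p k top tail i := by
  rw [Finset.mul_sum]
  exact Finset.sum_congr rfl fun i hi => by
    rw [spikedEigenvalues_of_mem_compl hi, mul_div_cancel₀ _ htail]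

lemma isTailControlled_spikedEigenvalues {n : ℕ} {x : Fin n → FeatureSpace (Fin p)}
    {ρ α L κ m δ : ℝ} (htail : 0 < tail)
    (hdev : ∀ v : Fin n → ℝ,
      |∑ i ∈ (headIndices p k)ᶜ, (∑ a, v a * x a i) ^ 2 / spikedEigenvalues p k top tail i -
        m * ∑ a, v a ^ 2| ≤ δ * ∑ a, v a ^ 2)
    (hlower : α ≤ tail * (ρ + m - δ)) (hupper : tail * (ρ + m + δ) ≤ L * α)
    (hweighted : tail ^ 2 * (m + δ) ≤ κ * α ^ 2 / n) :
    IsTailControlled (tail * ρ) x (headIndices p k) (spikedEigenvalues p k top tail) α L κ := by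
  have hquad : ∀ v : Fin n → ℝ, v ⬝ᵥ tailGram (tail * ρ) x (headIndices p k) *ᵥ v =
      tail * (ρ * ∑ a, v a ^ 2 + ∑ i ∈ (headIndices p k)ᶜ,
        (∑ a, v a * x a i) ^ 2 / spikedEigenvalues p k top tail i) := fun v => by
    rw [dotProduct_tailGram_mulVec, tsum_ite_mem_eq_sum_compl,
      sum_tail_sq_eq_mul_sum_div (top := top) htail.ne' fun i => ∑ a, v a * x a i]
    ring
  have hnorm : ∀ v : Fin n → ℝ, 0 ≤ ∑ a, v a ^ 2 := fun v =>
    Finset.sum_nonneg fun _ _ => sq_nonneg _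
  refine ⟨fun v => ?_, fun v => ?_, fun v => ?_⟩
  · rw [hquad]
    refine (mul_le_mul_of_nonneg_right hlower (hnorm v)).trans ?_
    rw [mul_assoc]
    gcongr
    linarith [(abs_le.1 (hdev v)).1]
  · rw [hquad]
    refine le_trans ?_ (mul_le_mul_of_nonneg_right hupper (hnorm v))
    rw [mul_assoc]
    gcongr
    linarith [(abs_le.1 (hdev v)).2]
  · rw [tsum_ite_mem_eq_sum_compl,
      Finset.sum_congr rfl fun i hi => by rw [spikedEigenvalues_of_mem_compl hi],
      ← Finset.mul_sum,
      sum_tail_sq_eq_mul_sum_div (top := top) htail.ne' fun i => ∑ a, v a * x a i, ← mul_assoc,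
      ← sq]
    refine le_trans ?_ (mul_le_mul_of_nonneg_right hweighted (hnorm v))
    rw [mul_assoc]
    gcongr
    linarith [(abs_le.1 (hdev v)).2]

end SpikedEigenvalues

section SpikedRegime

variable {σx : ℝ} {n k p : ℕ}

lemma head_le_of_lt (hk : (k : ℝ) < n / sampleRatio σx) : (k : ℝ) ≤ n / 100 :=
  hk.le.trans
    (div_le_div_of_nonneg_left n.cast_nonneg (by norm_num) (hundred_le_sampleRatio σx))

lemma hundred_mul_le_of_lt (hp : n * sampleRatio σx < (p : ℝ)) : 100 * (n : ℝ) ≤ p := by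
  linarith [mul_le_mul_of_nonneg_left (hundred_le_sampleRatio σx) (n.cast_nonneg (α := ℝ))]

lemma add_le_dimension (hk : (k : ℝ) < n / sampleRatio σx)
    (hp : n * sampleRatio σx < (p : ℝ)) : n + k ≤ p := by
  have hsum : ((n + k : ℕ) : ℝ) ≤ p := by
    push_cast
    linarith [head_le_of_lt hk, hundred_mul_le_of_lt hp, n.cast_nonneg (α := ℝ)]
  exact_mod_cast hsum

lemma tailDeviation_mul_sqrt_le (hσx : 0 < σx) (hp : n * sampleRatio σx < (p : ℝ)) :
    tailDeviation σx * √(p * n) ≤ p / 4 := by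
  have hpos : 0 < 2 * tailDeviation σx := by
    unfold tailDeviation
    positivity
  have hhalf := mul_sqrt_mul_div_le_half hpos p.cast_nonneg
    (by linarith [sixteen_mul_tailDeviation_sq_le_sampleRatio σx] :
      4 * (2 * tailDeviation σx) ^ 2 ≤ sampleRatio σx)
  have hsqrt : √((p : ℝ) * n) ≤ √(p * (p / sampleRatio σx)) :=
    Real.sqrt_le_sqrt (mul_le_mul_of_nonneg_left
      ((le_div_iff₀ (sampleRatio_pos σx)).2 hp.le) p.cast_nonneg)
  linarith [mul_le_mul_of_nonneg_left hsqrt hpos.le]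

end SpikedRegime

section Rescale

lemma bias_bound_rescale {C tail top Q H B m : ℝ} (hC : 0 ≤ C) (htail : 0 ≤ tail) (htop : 0 ≤ top)
    (hQ : 0 ≤ Q) (hH : 0 ≤ H) :
    C * (Q * tail + (tail * (B / 4)) ^ 2 / m ^ 2 * (H / top)) ≤
      16 * C * (Q * tail + H * ((tail * B) ^ 2 / (top * m ^ 2))) := by
  have hsplit : (tail * (B / 4)) ^ 2 / m ^ 2 * (H / top) =
      H * ((tail * B) ^ 2 / (top * m ^ 2)) / 16 := by ring
  have hhead : 0 ≤ H * ((tail * B) ^ 2 / (top * m ^ 2)) := by positivity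
  rw [hsplit, mul_comm 16, mul_assoc]
  gcongr
  linarith [mul_nonneg hQ htail]

lemma variance_bound_rescale {C s S T tail B : ℝ} {n k : ℕ} (hC : 0 ≤ C * s)
    (hST : S ≤ T) :
    C * s * ((k : ℝ) / n + n * S / (tail * (B / 4)) ^ 2) ≤
      16 * C * s * ((k : ℝ) / n + n * T / (tail * B) ^ 2) := by
  have hsplit : n * S / (tail * (B / 4)) ^ 2 = 16 * (n * S / (tail * B) ^ 2) := by ring
  rw [hsplit, mul_assoc 16, mul_comm 16 (C * s), mul_assoc (C * s) 16]
  gcongr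
  have hle : n * S / (tail * B) ^ 2 ≤ n * T / (tail * B) ^ 2 := by gcongr
  linarith [div_nonneg (k.cast_nonneg (α := ℝ)) (n.cast_nonneg (α := ℝ))]

end Rescale

namespace RidgeModel

variable {Ω : Type*} [MeasurableSpace Ω] {μ : Measure Ω} [IsProbabilityMeasure μ] {n k p : ℕ}
  {top tail σx σε t : ℝ} {X : Fin n → Ω → FeatureSpace (Fin p)} {ε : Ω → Fin n → ℝ}

lemma measureReal_not_isTailControlled_spikedEigenvalues_le
    (hM : RidgeModel μ n (spikedEigenvalues p k top tail) σx σε X ε)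
    (hind : ∀ a, iIndepFun (fun (i : Fin p) (ω : Ω) => X a ω i) μ) (hσx : 0 < σx)
    (htail : 0 < tail) (htop : 0 < top) (hnp : n + k ≤ p) {ρ α L κ : ℝ}
    (hlower : α ≤ tail * (ρ + p - k - tailDeviation σx * √(p * n)))
    (hupper : tail * (ρ + p + tailDeviation σx * √(p * n)) ≤ L * α)
    (hweighted : tail ^ 2 * (p + tailDeviation σx * √(p * n)) ≤ κ * α ^ 2 / n) :
    μ.real {ω | ¬ IsTailControlled (tail * ρ) (fun a => X a ω) (headIndices p k)
      (spikedEigenvalues p k top tail) α L κ} ≤ 2 * Real.exp (-n) := by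
  have hk0 : (0 : ℝ) ≤ k := k.cast_nonneg
  have hcard := card_compl_headIndices (p := p) (k := k) (by omega)
  have hnpk : (n : ℝ) ≤ p - k := le_sub_iff_add_le.2 (by exact_mod_cast hnp)
  have hdev := hM.measureReal_tail_gram_le (spikedEigenvalues_pos htop htail) hσx hind
    (headIndices p k)ᶜ le_rfl (hcard ▸ hnpk)
  rw [hcard] at hdev
  refine (measureReal_mono (fun ω hω => ?_) (measure_ne_top _ _)).trans hdev
  by_contra hgood
  simp only [Set.mem_ofPred_eq, not_exists, not_lt] at hgood
  have hsqrt : 448 * (36 * (4 * σx ^ 2)) * √((p - k) * n) ≤ tailDeviation σx * √(p * n) := by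
    rw [tailDeviation]
    gcongr
    linarith
  refine hω (isTailControlled_spikedEigenvalues htail
    (fun v => (hgood v).trans (mul_le_mul_of_nonneg_right hsqrt
      (Finset.sum_nonneg fun _ _ => sq_nonneg _)))
    (by rwa [add_sub_assoc] at hlower) (le_trans ?_ hupper) (le_trans ?_ hweighted))
  all_goals
    gcongr
    linarith

/-- With `ρ` the regularization and `B` the size of the eigenvalues of the regularized tail Gram
matrix, both in units of `tail`. -/
lemma one_sub_le_measureReal_spikedEigenvalues
    (hM : RidgeModel μ n (spikedEigenvalues p k top tail) σx σε X ε)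
    (hind : ∀ a, iIndepFun (fun (i : Fin p) (ω : Ω) => X a ω i) μ) (hσx : 0 < σx) (hσε : 0 ≤ σε)
    (htail : 0 < tail) (htop : tail ≤ top) (hk : (k : ℝ) < n / sampleRatio σx)
    (hp : n * sampleRatio σx < (p : ℝ)) (hct : sampleRatio σx < t)
    (htn : t < n / sampleRatio σx) {ρ B : ℝ} (hB : 0 < B)
    (hlower : B / 4 ≤ ρ + p - k - tailDeviation σx * √(p * n))
    (hupper : ρ + p + tailDeviation σx * √(p * n) ≤ 3 / 2 * B)
    (hweighted : n * (p + tailDeviation σx * √(p * n)) ≤ 3 / 2 * B ^ 2)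
    (θ : FeatureSpace (Fin p)) :
    1 - 20 * Real.exp (-t / sampleRatio σx) ≤ μ.real {ω |
      IsUnit (regGram (tail * ρ) (fun a => X a ω)).det ∧
      biasTerm (spikedEigenvalues p k top tail) (tail * ρ) (fun a => X a ω) θ ≤
        16 * ridgeConstant σx 6 24 *
          (tailNormSq k θ * tail + headNormSq k θ * ((tail * B) ^ 2 / (top * (n : ℝ) ^ 2))) ∧
      varianceTerm (spikedEigenvalues p k top tail) (tail * ρ) (fun a => X a ω) (ε ω) ≤
        16 * ridgeConstant σx 6 24 * (σε ^ 2 * t) *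
          ((k : ℝ) / n + n * (p * tail ^ 2) / (tail * B) ^ 2)} := by
  have htop0 : 0 < top := htail.trans_le htop
  have hn0 : (0 : ℝ) < n := Nat.cast_pos.2 (sampleSize_pos hct htn)
  have hnp := add_le_dimension hk hp
  have hcard := card_headIndices (p := p) (k := k) (by omega)
  have hcontrol := hM.measureReal_not_isTailControlled_spikedEigenvalues_le hind hσx htail htop0
    (α := tail * (B / 4)) (L := 6) (κ := 24) hnp
    (mul_le_mul_of_nonneg_left hlower htail.le)
    ((mul_le_mul_of_nonneg_left hupper htail.le).trans_eq (by ring))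
    ((le_div_iff₀ hn0).2 (by linarith [mul_le_mul_of_nonneg_left hweighted (sq_nonneg tail)]))
  have hmain := hM.one_sub_le_measureReal_of_card_lt (spikedEigenvalues_pos htop0 htail)
    (spikedEigenvalues_le htop) Summable.of_finite hσx hσε (hcard.symm ▸ hk) hct htn (by positivity)
    (by norm_num) (by norm_num) hcontrol le_rfl θ
  rw [tsum_tail_spikedEigenvalues_mul_sq, sum_head_sq_div_spikedEigenvalues, hcard] at hmain
  have hC := (ridgeConstant_pos hσx.ne' 6 24).le
  have ht0 : 0 < t := (sampleRatio_pos σx).trans hct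
  refine hmain.trans (measureReal_mono (fun ω hω => ⟨hω.1,
    hω.2.1.trans (bias_bound_rescale hC htail.le htop0.le
      (tailNormSq_nonneg k θ) (headNormSq_nonneg k θ)),
    hω.2.2.trans (variance_bound_rescale (by positivity) (tsum_tail_spikedEigenvalues_sq_le
      (by omega)))⟩) (measure_ne_top _ _))

lemma one_sub_le_measureReal_spikedEigenvalues_zero
    (hM : RidgeModel μ n (spikedEigenvalues p k top tail) σx σε X ε)
    (hind : ∀ a, iIndepFun (fun (i : Fin p) (ω : Ω) => X a ω i) μ) (hσx : 0 < σx) (hσε : 0 ≤ σε)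
    (htail : 0 < tail) (htop : tail ≤ top) (hk : (k : ℝ) < n / sampleRatio σx)
    (hp : n * sampleRatio σx < (p : ℝ)) (hct : sampleRatio σx < t)
    (htn : t < n / sampleRatio σx) (θ : FeatureSpace (Fin p)) :
    1 - 20 * Real.exp (-t / sampleRatio σx) ≤ μ.real {ω |
      IsUnit (regGram 0 (fun a => X a ω)).det ∧
      biasTerm (spikedEigenvalues p k top tail) 0 (fun a => X a ω) θ ≤
        16 * ridgeConstant σx 6 24 * (tailNormSq k θ * tail +
          headNormSq k θ * (tail ^ 2 * (p : ℝ) ^ 2 / (top * (n : ℝ) ^ 2))) ∧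
      varianceTerm (spikedEigenvalues p k top tail) 0 (fun a => X a ω) (ε ω) ≤
        16 * ridgeConstant σx 6 24 * (σε ^ 2 * t) * ((k : ℝ) / n + (n : ℝ) / p)} := by
  have hn0 : (0 : ℝ) < n := Nat.cast_pos.2 (sampleSize_pos hct htn)
  have hkn := head_le_of_lt hk
  have hnp := hundred_mul_le_of_lt hp
  have hp0 : (0 : ℝ) < p := by linarith
  have hdeviation := tailDeviation_mul_sqrt_le hσx hp
  have hweighted : n * (p + tailDeviation σx * √(p * n)) ≤ 3 / 2 * (p : ℝ) ^ 2 :=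
    calc n * (p + tailDeviation σx * √(p * n)) ≤ n * (p + p / 4) := by gcongr
      _ ≤ p * (p + p / 4) := mul_le_mul_of_nonneg_right (by linarith) (by positivity)
      _ ≤ 3 / 2 * (p : ℝ) ^ 2 := by linarith [sq_nonneg (p : ℝ)]
  have hmain := hM.one_sub_le_measureReal_spikedEigenvalues hind hσx hσε htail htop hk hp hct htn
    (ρ := 0) hp0 (by linarith) (by linarith) hweighted θ
  have hvariance : n * (p * tail ^ 2) / (tail * (p : ℝ)) ^ 2 = n / p := by field_simp
  rwa [mul_zero, hvariance, mul_pow] at hmain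

lemma one_sub_le_measureReal_spikedEigenvalues_shifted
    (hM : RidgeModel μ n (spikedEigenvalues p k top tail) σx σε X ε)
    (hind : ∀ a, iIndepFun (fun (i : Fin p) (ω : Ω) => X a ω i) μ) (hσx : 0 < σx) (hσε : 0 ≤ σε)
    (htail : 0 < tail) (htop : tail ≤ top) (hk : (k : ℝ) < n / sampleRatio σx)
    (hp : n * sampleRatio σx < (p : ℝ)) (hct : sampleRatio σx < t)
    (htn : t < n / sampleRatio σx) {ξ : ℝ} (hξ : sampleRatio σx < ξ) (θ : FeatureSpace (Fin p)) :
    1 - 20 * Real.exp (-t / sampleRatio σx) ≤ μ.real {ω |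
      IsUnit (regGram (-tail * p + ξ * tail * √(n * p)) (fun a => X a ω)).det ∧
      biasTerm (spikedEigenvalues p k top tail) (-tail * p + ξ * tail * √(n * p))
          (fun a => X a ω) θ ≤
        16 * ridgeConstant σx 6 24 * (tailNormSq k θ * tail +
          headNormSq k θ * (ξ ^ 2 * tail ^ 2 * p / (top * n))) ∧
      varianceTerm (spikedEigenvalues p k top tail) (-tail * p + ξ * tail * √(n * p))
          (fun a => X a ω) (ε ω) ≤
        16 * ridgeConstant σx 6 24 * (σε ^ 2 * t) * ((k : ℝ) / n + 1 / ξ ^ 2)} := by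
  have hn0 : (0 : ℝ) < n := Nat.cast_pos.2 (sampleSize_pos hct htn)
  have hξ100 : 100 < ξ := (hundred_le_sampleRatio σx).trans_lt hξ
  have hkn := head_le_of_lt hk
  have hnp := hundred_mul_le_of_lt hp
  have hp0 : (0 : ℝ) < p := by linarith
  have htop0 : 0 < top := htail.trans_le htop
  have hdeviation := tailDeviation_mul_sqrt_le hσx hp
  have hR2 : √((p : ℝ) * n) ^ 2 = p * n := Real.sq_sqrt (by positivity)
  have hR0 : 0 < √((p : ℝ) * n) := by positivity
  have hnR : (n : ℝ) ≤ √((p : ℝ) * n) := Real.le_sqrt_of_sq_le (by nlinarith)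
  set R := √((p : ℝ) * n)
  have hξR : (tailDeviation σx + 1) * R ≤ ξ / 2 * R := by
    gcongr
    linarith [two_mul_tailDeviation_add_le_sampleRatio σx]
  have hξR0 : 0 < ξ * R := by positivity
  have hlower : ξ * R / 4 ≤ -p + ξ * R + p - k - tailDeviation σx * R := by linarith
  have hupper : -p + ξ * R + p + tailDeviation σx * R ≤ 3 / 2 * (ξ * R) := by linarith
  have hweighted : n * (p + tailDeviation σx * R) ≤ 3 / 2 * (ξ * R) ^ 2 :=
    calc n * (p + tailDeviation σx * R) ≤ n * (p + p / 4) := by gcongr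
      _ ≤ 3 / 2 * (1 * (p * n)) := by linarith [mul_pos hp0 hn0]
      _ ≤ 3 / 2 * (ξ ^ 2 * (p * n)) := by gcongr; exact one_le_pow₀ (by linarith)
      _ = 3 / 2 * (ξ * R) ^ 2 := by rw [mul_pow, hR2]
  have hmain := hM.one_sub_le_measureReal_spikedEigenvalues hind hσx hσε htail htop hk hp hct htn
    (ρ := -p + ξ * R) (B := ξ * R) hξR0 hlower hupper hweighted θ
  have hreg : tail * (-p + ξ * R) = -tail * p + ξ * tail * √(n * p) := by
    rw [mul_comm (n : ℝ)]
    ring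
  have hbias : (tail * (ξ * R)) ^ 2 / (top * (n : ℝ) ^ 2) = ξ ^ 2 * tail ^ 2 * p / (top * n) := by
    rw [mul_pow, mul_pow, hR2]
    field_simp
  have hvariance : n * (p * tail ^ 2) / (tail * (ξ * R)) ^ 2 = 1 / ξ ^ 2 := by
    rw [mul_pow, mul_pow, hR2]
    field_simp
  rwa [hreg, hbias, hvariance] at hmain

end RidgeModel

theorem mainTheorem6 (σx : ℝ) (hσx : 0 < σx) :
    ∃ c : ℝ, 0 < c ∧
      -- exponentially decaying eigenvalues
      (∀ a : ℝ, 0 < a → ∃ C : ℝ, 0 < C ∧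
        ∀ (Ω : Type*) (_ : MeasurableSpace Ω) (μ : Measure Ω) (_ : IsProbabilityMeasure μ)
          (n k : ℕ) (γ σε t : ℝ) (X : Fin n → Ω → FeatureSpace ℕ) (ε : Ω → Fin n → ℝ)
          (θ : FeatureSpace ℕ),
          a / n ≤ γ → 0 ≤ σε →
          RidgeModel μ n (expEigenvalues γ) σx σε X ε →
          (k : ℝ) < n / c → c < t → t < n / c →
          1 - 26 * Real.exp (-t / c) ≤ μ.real {ω |
            IsUnit (regGram (n * Real.exp (-γ * (k + 1))) (fun a => X a ω)).det ∧
            biasTerm (expEigenvalues γ) (n * Real.exp (-γ * (k + 1))) (fun a => X a ω) θ ≤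
              C * ((∑' j : ℕ, θ (k + j) ^ 2 * Real.exp (-γ * ((k : ℝ) + j + 1))) +
                ∑ j ∈ Finset.range k,
                  θ j ^ 2 * Real.exp (-γ * (2 * ((k : ℝ) + 1) - ((j : ℝ) + 1)))) ∧
            varianceTerm (expEigenvalues γ) (n * Real.exp (-γ * (k + 1))) (fun a => X a ω) (ε ω) ≤
              C * (σε ^ 2 * t) *
                ((k : ℝ) / n + 1 / (n * (1 - Real.exp (-2 * γ))))}) ∧
      -- spiked covariance with independent components
      (∃ C : ℝ, 0 < C ∧
        ∀ (Ω : Type*) (_ : MeasurableSpace Ω) (μ : Measure Ω) (_ : IsProbabilityMeasure μ)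
          (n k p : ℕ) (top tail σε t : ℝ) (X : Fin n → Ω → FeatureSpace (Fin p))
          (ε : Ω → Fin n → ℝ) (θ : FeatureSpace (Fin p)),
          0 < tail → tail ≤ top → 0 ≤ σε →
          RidgeModel μ n (spikedEigenvalues p k top tail) σx σε X ε →
          (∀ a, iIndepFun (fun (i : Fin p) (ω : Ω) => X a ω i) μ) →
          (k : ℝ) < n / c → n * c < (p : ℝ) → c < t → t < n / c →
          -- zero regularization
          (1 - 22 * Real.exp (-t / c) ≤ μ.real {ω |
            IsUnit (regGram 0 (fun a => X a ω)).det ∧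
            biasTerm (spikedEigenvalues p k top tail) 0 (fun a => X a ω) θ ≤
              C * (tailNormSq k θ * tail +
                headNormSq k θ * (tail ^ 2 * (p : ℝ) ^ 2 / (top * (n : ℝ) ^ 2))) ∧
            varianceTerm (spikedEigenvalues p k top tail) 0 (fun a => X a ω) (ε ω) ≤
              C * (σε ^ 2 * t) * ((k : ℝ) / n + (n : ℝ) / p)}) ∧
          -- shifted, possibly negative, regularization
          (∀ ξ reg : ℝ, c < ξ → reg = -tail * p + ξ * tail * √((n : ℝ) * p) →
            1 - 20 * Real.exp (-t / c) ≤ μ.real {ω |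
              IsUnit (regGram reg (fun a => X a ω)).det ∧
              biasTerm (spikedEigenvalues p k top tail) reg (fun a => X a ω) θ ≤
                C * (tailNormSq k θ * tail +
                  headNormSq k θ * (ξ ^ 2 * tail ^ 2 * p / (top * n))) ∧
              varianceTerm (spikedEigenvalues p k top tail) reg (fun a => X a ω) (ε ω) ≤
                C * (σε ^ 2 * t) * ((k : ℝ) / n + 1 / ξ ^ 2)})) := by
  have hweaken : ∀ {t : ℝ} {m : ℝ}, 20 ≤ m → 1 - m * Real.exp (-t / sampleRatio σx) ≤
      1 - 20 * Real.exp (-t / sampleRatio σx) := fun hm =>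
    sub_le_sub_left (mul_le_mul_of_nonneg_right hm (Real.exp_pos _).le) 1
  refine ⟨sampleRatio σx, sampleRatio_pos σx, fun a ha =>
    ⟨ridgeConstant σx (1 + expTailConstant σx a) (expTailConstant σx a),
      ridgeConstant_pos hσx.ne' _ _, ?_⟩,
    ⟨16 * ridgeConstant σx 6 24, mul_pos (by norm_num) (ridgeConstant_pos hσx.ne' 6 24), ?_⟩⟩
  · intro Ω _ μ _ n k γ σε t X ε θ hγ hσε hM hk hct htn
    exact (hweaken (by norm_num)).trans
      (hM.one_sub_le_measureReal_expEigenvalues hσx hσε ha hγ hk hct htn θ)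
  · intro Ω _ μ _ n k p top tail σε t X ε θ htail htop hσε hM hind hk hp hct htn
    refine ⟨(hweaken (by norm_num)).trans (hM.one_sub_le_measureReal_spikedEigenvalues_zero hind hσx
      hσε htail htop hk hp hct htn θ), fun ξ reg hξ hreg => ?_⟩
    subst hreg
    exact hM.one_sub_le_measureReal_spikedEigenvalues_shifted hind hσx hσε htail htop hk hp
      hct htn hξ θ
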